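/- Let $I=(G,\tau,\mu,q)$ be an instance of \textsc{Zero Extension}: $G$ is a finite simple graph with $n$ vertices and $m$ edges, $\tau$ is a partial labelling of $V(G)$ with labels from a finite set $D$, $\mu\colon D\times D\to\mathbb{Z}_{\ge 0}$ is a symmetric cost function with $\mu(x,x)=0$, and $q$ is an integer; the question is whether there is a labelling $\lambda\colon V(G)\to D$ that agrees with $\tau$ wherever $\tau$ is defined and has cost $\sum_{uv\in E(G)}\mu(\lambda(u),\lambda(v))\le q$. Suppose that $\mu$ is an induced tree metric, that is, $D\subseteq V(T)$ for a tree $T$ with $|T|$ nodes, which is given with the input, and $\mu$ is the restriction to $D$ of the distance $\hat\mu=d_T$ (number of edges on the path). Let $p$ be the optimum of the relaxed instance $\hat I=(G,\tau,\hat\mu,q)$, i.e. the minimum of $\sum_{uv\in E(G)} d_T(\lambda(u),\lambda(v))$ over all $\lambda\colon V(G)\to V(T)$ that agree with $\tau$ wherever $\tau$ is defined. Then there is an algorithm (a fixed program of a unit-cost random access machine with addition and subtraction) that decides every such instance $I$ in time $$O\bigl(|D|^{\max(q-p,\,0)}\;|T|\,|D|\,n\,m+1\bigr),$$ where the implied constant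 is absolute. -/

import Mathlib

/-! ### Zero Extension -/

/-- A simple cost function over `D`: symmetric, non-negative, and zero on the diagonal. -/
structure SimpleCost (D : Type*) where
  /-- the value of the cost function on a pair of labels -/
  val : D → D → ℕ
  symm : ∀ x y, val x y = val y x
  self : ∀ x, val x x = 0

/-- An instance `(G, τ, μ, q)` of Zero Extension with vertex set `V` and label set `D`. The partial
labelling `τ` is defined on the vertices `v` with `τ v ≠ none`. -/
structure ZeroExtension (V D : Type*) where
  G : SimpleGraph V
  τ : V → Option D
  μ : SimpleCost D
  q : ℤ

namespace ZeroExtension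

variable {V D : Type*}

/-- The labelling `l` agrees with the partial labelling `τ` wherever the latter is defined. -/
def IsExtension (I : ZeroExtension V D) (l : V → D) : Prop :=
  ∀ v d, I.τ v = some d → l v = d

/-- The price of an (unordered) edge under a labelling. -/
def edgeCost (I : ZeroExtension V D) (l : V → D) (e : Sym2 V) : ℕ :=
  Sym2.lift ⟨fun u v => I.μ.val (l u) (l v), fun u v => I.μ.symm (l u) (l v)⟩ e

open Classical in
/-- The cost of a labelling: the sum of the prices of all edges. -/
noncomputable def cost [Fintype V] (I : ZeroExtension V D) (l : V → D) : ℕ :=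
  ∑ e ∈ I.G.edgeFinset, I.edgeCost l e

/-- The question of the problem: is there an extension of `τ` of cost at most `q`? -/
def IsYes [Fintype V] (I : ZeroExtension V D) : Prop :=
  ∃ l : V → D, I.IsExtension l ∧ (I.cost l : ℤ) ≤ I.q

/-- The minimum cost of an extension of `τ`. -/
noncomputable def opt [Fintype V] (I : ZeroExtension V D) : ℕ :=
  sInf {c | ∃ l : V → D, I.IsExtension l ∧ I.cost l = c}

/-- If there is a label at all, then `opt` is an attained minimum. -/
theorem isLeast_opt [Fintype V] [Nonempty D] (I : ZeroExtension V D) :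
    IsLeast {c | ∃ l : V → D, I.IsExtension l ∧ I.cost l = c} I.opt := by
  have hne : {c | ∃ l : V → D, I.IsExtension l ∧ I.cost l = c}.Nonempty :=
    ⟨_, fun v => (I.τ v).getD (Classical.arbitrary D), fun v d h => by simp [h], rfl⟩
  exact ⟨Nat.sInf_mem hne, fun c hc => Nat.sInf_le hc⟩

end ZeroExtension

/-- The tree metric of a tree `T`: the number of edges of the path between two nodes. -/
noncomputable def treeMetric {W : Type*} (T : SimpleGraph W) : SimpleCost W where
  val := T.dist
  symm _ _ := T.dist_comm
  self _ := T.dist_self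

/-- The restriction of a cost function to a subset of the labels. -/
def SimpleCost.restrict {W : Type*} (μ : SimpleCost W) (D : Finset W) : SimpleCost D where
  val x y := μ.val x y
  symm x y := μ.symm x y
  self x := μ.self x

/-- The data that determine an instance of Zero Extension whose cost function is an induced tree
metric: a graph `G` on the vertices `0, …, n - 1`, a tree `T` on the nodes `0, …, t - 1`, a set `D`
of nodes of `T` (the labels), a partial labelling `τ` by elements of `D`, and an integer `q`. -/
structure TreeInstance where
  n : ℕ
  t : ℕ
  G : SimpleGraph (Fin n)
  T : SimpleGraph (Fin t)
  isTree : T.IsTree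
  D : Finset (Fin t)
  τ : Fin n → Option D
  q : ℤ

namespace TreeInstance

/-- The instance `(G, τ, μ, q)`, where `μ` is the tree metric of `T` restricted to `D`. -/
noncomputable def inst (I : TreeInstance) : ZeroExtension (Fin I.n) I.D where
  G := I.G
  τ := I.τ
  μ := (treeMetric I.T).restrict I.D
  q := I.q

/-- The relaxed instance, in which every node of `T` may be used as a label. -/
noncomputable def relaxed (I : TreeInstance) : ZeroExtension (Fin I.n) (Fin I.t) where
  G := I.G
  τ v := (I.τ v).map Subtype.val
  μ := treeMetric I.T
  q := I.q

/-- The number of edges of `G`. -/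
noncomputable def m (I : TreeInstance) : ℕ := I.G.edgeSet.ncard

end TreeInstance

/-! ### Encoding of instances as sequences of machine words -/

/-- The list `es` contains every edge of `G` exactly once, in one of its two orientations, and
nothing else; the order is arbitrary. -/
def ListsEdges {V : Type*} (es : List (V × V)) (G : SimpleGraph V) : Prop :=
  (es.map fun e => s(e.1, e.2)).Nodup ∧ ∀ e : Sym2 V, e ∈ es.map (fun e => s(e.1, e.2)) ↔ e ∈ G.edgeSet

/-- A list of pairs of numbers as a sequence of words. -/
def pairWords {k : ℕ} (es : List (Fin k × Fin k)) : List ℕ :=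
  es.flatMap fun e => [e.1.val, e.2.val]

/-- The word sequence `w` encodes the instance: the numbers of vertices, edges, tree nodes and
labels; sign and absolute value of `q`; the edges of `G`; the edges of `T`; the labels; and for each
vertex in turn `0` if it is not labelled by `τ` and `x + 1` if its label is the node `x`. -/
def TreeInstance.EncodedBy (I : TreeInstance) (w : List ℕ) : Prop :=
  ∃ (es : List (Fin I.n × Fin I.n)) (ts : List (Fin I.t × Fin I.t)) (ds : List (Fin I.t)),
    ListsEdges es I.G ∧ ListsEdges ts I.T ∧ ds.Nodup ∧ (∀ x, x ∈ ds ↔ x ∈ I.D) ∧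
    w = [I.n, es.length, I.t, ds.length, if I.q < 0 then 1 else 0, I.q.natAbs]
      ++ pairWords es ++ pairWords ts ++ ds.map Fin.val
      ++ List.ofFn fun v => ((I.τ v).map fun d => d.val.val + 1).getD 0

/-! ### A random access machine with unit cost

The machine has registers and a main memory, both of which hold natural numbers. A program mentions
finitely many registers; the main memory is accessed indirectly, at an address held in a register.
The only arithmetic operations are addition and (truncated) subtraction. -/

namespace RAM

/-- The contents of the registers and of the main memory. -/
structure State where
  reg : ℕ → ℕ
  mem : ℕ → ℕ

/-- The elementary instructions. -/
inductive Instr where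
  /-- `R[d] := c` -/
  | const (d c : ℕ)
  /-- `R[d] := R[a]` -/
  | move (d a : ℕ)
  /-- `R[d] := R[a] + R[b]` -/
  | add (d a b : ℕ)
  /-- `R[d] := R[a] - R[b]`, or `0` if this is negative -/
  | sub (d a b : ℕ)
  /-- `R[d] := M[R[a]]` -/
  | load (d a : ℕ)
  /-- `M[R[a]] := R[b]` -/
  | store (a b : ℕ)

/-- The effect of an elementary instruction. -/
def Instr.apply : Instr → State → State
  | .const d c, s => { s with reg := Function.update s.reg d c }
  | .move d a, s => { s with reg := Function.update s.reg d (s.reg a) }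
  | .add d a b, s => { s with reg := Function.update s.reg d (s.reg a + s.reg b) }
  | .sub d a b, s => { s with reg := Function.update s.reg d (s.reg a - s.reg b) }
  | .load d a, s => { s with reg := Function.update s.reg d (s.mem (s.reg a)) }
  | .store a b, s => { s with mem := Function.update s.mem (s.reg a) (s.reg b) }

/-- The elementary tests. -/
inductive Test where
  /-- `R[a] = R[b]` -/
  | eq (a b : ℕ)
  /-- `R[a] < R[b]` -/
  | lt (a b : ℕ)

/-- A state passes a test. -/
def Test.Holds : Test → State → Prop
  | .eq a b, s => s.reg a = s.reg b
  | .lt a b, s => s.reg a < s.reg b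

/-- Programs. -/
inductive Prog where
  | instr (i : Instr)
  | seq (P Q : Prog)
  | ite (c : Test) (P Q : Prog)
  | loop (c : Test) (P : Prog)

/-- `Exec P s k s'`: started in the state `s`, the program `P` halts in the state `s'` after exactly
`k` steps, where each elementary instruction and each evaluation of a test is one step. The program
`loop c P` repeats `P` as long as the test `c` holds. -/
inductive Exec : Prog → State → ℕ → State → Prop where
  | instr (i : Instr) (s : State) : Exec (.instr i) s 1 (i.apply s)
  | seq {P Q : Prog} {s s' s'' : State} {k l : ℕ} :
      Exec P s k s' → Exec Q s' l s'' → Exec (.seq P Q) s (k + l) s''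
  | ite_pos {c : Test} {P Q : Prog} {s s' : State} {k : ℕ} :
      c.Holds s → Exec P s k s' → Exec (.ite c P Q) s (k + 1) s'
  | ite_neg {c : Test} {P Q : Prog} {s s' : State} {k : ℕ} :
      ¬ c.Holds s → Exec Q s k s' → Exec (.ite c P Q) s (k + 1) s'
  | loop_stop {c : Test} {P : Prog} {s : State} :
      ¬ c.Holds s → Exec (.loop c P) s 1 s
  | loop_step {c : Test} {P : Prog} {s s' s'' : State} {k l : ℕ} :
      c.Holds s → Exec P s k s' → Exec (.loop c P) s' l s'' →
        Exec (.loop c P) s (k + l + 1) s''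

/-- The initial state on the input `w`: the words of `w` are in the memory cells `0, 1, …`, and all
other cells and all registers are `0`. -/
def init (w : List ℕ) : State where
  reg _ := 0
  mem a := w.getD a 0

end RAM

/-!
# Zero Extension with an induced tree metric

A tree metric is a sum of cut metrics: every edge of the tree `T` splits the nodes into two sides,
and the distance of two nodes is the number of splits that separate them (`Splits.OfTree.dist_eq`).
Hence the cost of a labelling by nodes of `T` is the sum over all splits of the cut that the
labelling induces in the graph (`ZeroExt.labelCost_eq`), and it is at least the sum of the minimum
cuts that separate the vertices which `τ` assigns to the two sides (`ArcGraph.bound`). Pushing all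
vertices of a minimum cut for one edge of the tree to the end of this edge increases none of the
cuts, by submodularity (`ArcGraph.cut_pushTo_edge`). This has two consequences. First, the sum of
the minimum cuts is the cost of some labelling by nodes, so that it is the optimum `p` of the
relaxed instance (`ArcGraph.exists_labelCost_le`). Second, if for a label `d` a set of vertices lies
in a minimum cut on the side of `d` for every split, then these vertices may be given the label `d`,
even if only labels in `D` are allowed (`ArcGraph.Persistent.exists_extends`).

The algorithm is a branching on partial labellings. It computes the lower bound, and abandons a
partial labelling for which it exceeds `q`. Otherwise it fixes all persistent sets. If no vertex is
left without a label, then the bound is the cost and the answer is yes. If some vertex is left, the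
algorithm branches on its label; since the vertex was not persistent for any label, every branch
increases the bound (`ArcGraph.sideCut_lt_assign`). So the depth of the branching is at most
`q - p + 1`. A partial labelling that is not abandoned needs `|T| * |D|` minimum cuts, an abandoned one
only `|T|`; the latter saves a factor of `|D|` on the last level of the branching, where there may
be `|D| ^ (q - p + 1)` partial labellings. The accounting is done by the budgets `ZeroExt.weight`.

A minimum cut has to be computed in time `O(n * m)`. The capacities are one, and the push-relabel
method with a current arc for every vertex achieves this: a vertex is lifted at most `n + 2` times,
and between two pushes along the same arc its two ends are lifted, which is expressed by the
potential `ArcGraph.pot`. Heights go up to `n + 2`, and excess that reaches this height cannot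
reach a sink any more and is abandoned, so that the result is a preflow rather than a flow; that is
enough for a minimum cut (`ArcGraph.cut_le_of_preflow`).

The splits are computed by removing the leaves of `T` one after the other (`Pruned`), in time `O(|T|
* |D|)`.

The program is written in a small imperative language with variables and arrays, for which there is
a program logic with running times (`Imp.Tri`), and which is compiled to the random access machine
with a constant overhead (`Imp.Com.exec_compile`). The arrays are interleaved in the memory, to
which end the input is first spread out to the multiples of 32. This takes linear time, and must not
happen if there are no edges or no labels, because then the time bound is a constant; a prelude
decides these instances, and those with a negative `q` or a single label, from the header of the
input.
-/

/-! ### A small imperative language and its compilation to the random access machine -/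

namespace Imp

/-- The state of an imperative program: natural numbers held by variables, and unbounded arrays. -/
@[ext] structure Store (V A : Type) where
  v : V → ℕ
  a : A → ℕ → ℕ

variable {V A : Type}

/-- Arithmetic expressions; subtraction is truncated. An expression also serves as a condition,
which holds if the value is not zero. -/
inductive AExp (V A : Type) where
  | const (c : ℕ)
  | var (x : V)
  | get (X : A) (e : AExp V A)
  | add (e f : AExp V A)
  | sub (e f : AExp V A)

namespace AExp

def eval (s : Store V A) : AExp V A → ℕ
  | const c => c
  | var x => s.v x
  | get X e => s.a X (e.eval s)
  | add e f => e.eval s + f.eval s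
  | sub e f => e.eval s - f.eval s

instance : Add (AExp V A) := ⟨add⟩
instance : Sub (AExp V A) := ⟨sub⟩
instance (n : ℕ) : OfNat (AExp V A) n := ⟨const n⟩

/-- The condition `e < f`. -/
def lt (e f : AExp V A) : AExp V A := f - e

/-- The condition `e = f`. -/
def eq (e f : AExp V A) : AExp V A := 1 - ((e - f) + (f - e))

/-- The conjunction of two conditions. -/
def and (e f : AExp V A) : AExp V A := 1 - ((1 - e) + (1 - f))

variable (s : Store V A) (e f : AExp V A)

@[simp] theorem eval_const (c : ℕ) : (const c : AExp V A).eval s = c := rfl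
@[simp] theorem eval_var (x : V) : (var x : AExp V A).eval s = s.v x := rfl
@[simp] theorem eval_get (X : A) : (get X e).eval s = s.a X (e.eval s) := rfl
@[simp] theorem eval_add : (e + f).eval s = e.eval s + f.eval s := rfl
@[simp] theorem eval_sub : (e - f).eval s = e.eval s - f.eval s := rfl
@[simp] theorem eval_zero : (0 : AExp V A).eval s = 0 := rfl
@[simp] theorem eval_one : (1 : AExp V A).eval s = 1 := rfl
@[simp] theorem eval_ofNat (n : ℕ) : (no_index (OfNat.ofNat n) : AExp V A).eval s = n := rfl

@[simp] theorem eval_lt : (lt e f).eval s = 0 ↔ ¬ e.eval s < f.eval s := by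
  simp [lt]; omega

@[simp] theorem eval_eq : (eq e f).eval s = 0 ↔ ¬ e.eval s = f.eval s := by
  simp [eq]; omega

@[simp] theorem eval_and : (and e f).eval s = 0 ↔ ¬ (e.eval s ≠ 0 ∧ f.eval s ≠ 0) := by
  simp [and]; omega

end AExp

/-- Commands. -/
inductive Com (V A : Type) where
  | skip
  | assign (x : V) (e : AExp V A)
  | store (X : A) (i e : AExp V A)
  | seq (P Q : Com V A)
  | ite (e : AExp V A) (P Q : Com V A)
  | while (e : AExp V A) (P : Com V A)

infixr:60 " ;; " => Com.seq

section Semantics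

variable [DecidableEq V] [DecidableEq A]

def Store.setV (s : Store V A) (x : V) (n : ℕ) : Store V A :=
  { s with v := Function.update s.v x n }

def Store.setA (s : Store V A) (X : A) (i n : ℕ) : Store V A :=
  { s with a := Function.update s.a X (Function.update (s.a X) i n) }

omit [DecidableEq A] in
@[simp] theorem Store.setV_v (s : Store V A) (x y : V) (n : ℕ) :
    (s.setV x n).v y = if y = x then n else s.v y := by
  simp [Store.setV, Function.update_apply]

omit [DecidableEq A] in
@[simp] theorem Store.setV_a (s : Store V A) (x : V) (n : ℕ) : (s.setV x n).a = s.a := rfl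

omit [DecidableEq V] in
@[simp] theorem Store.setA_v (s : Store V A) (X : A) (i n : ℕ) : (s.setA X i n).v = s.v := rfl

omit [DecidableEq V] in
@[simp] theorem Store.setA_a (s : Store V A) (X Y : A) (i n : ℕ) :
    (s.setA X i n).a Y = if Y = X then Function.update (s.a X) i n else s.a Y := by
  by_cases h : Y = X
  · subst h; simp [Store.setA]
  · simp [Store.setA, h]

/-- `Run P s k s'`: the command `P` leads from `s` to `s'` in `k` steps, where every elementary
command and every test is one step. -/
inductive Run : Com V A → Store V A → ℕ → Store V A → Prop where
  | skip (s) : Run .skip s 1 s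
  | assign (x e s) : Run (.assign x e) s 1 (s.setV x (e.eval s))
  | store (X i e s) : Run (.store X i e) s 1 (s.setA X (i.eval s) (e.eval s))
  | seq {P Q s s' s'' k l} : Run P s k s' → Run Q s' l s'' → Run (.seq P Q) s (k + l) s''
  | ite_pos {e P Q s s' k} : e.eval s ≠ 0 → Run P s k s' → Run (.ite e P Q) s (k + 1) s'
  | ite_neg {e P Q s s' k} : e.eval s = 0 → Run Q s k s' → Run (.ite e P Q) s (k + 1) s'
  | while_done {e P s} : e.eval s = 0 → Run (.while e P) s 1 s
  | while_step {e P s s' s'' k l} : e.eval s ≠ 0 → Run P s k s' → Run (.while e P) s' l s'' →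
      Run (.while e P) s (k + l + 1) s''

/-! ### Compilation -/

/-- How variables and arrays are laid out: the variable `x` is the register `2 * cv x`, and the
entry `i` of the array `X` is the memory cell `2 ^ w * i + ca X`. -/
structure Layout (V A : Type) where
  w : ℕ
  cv : V → ℕ
  ca : A → ℕ
  cv_inj : Function.Injective cv
  ca_inj : Function.Injective ca
  ca_lt : ∀ X, ca X < 2 ^ w

/-- The store that a machine state represents. -/
def Layout.view (L : Layout V A) (s : RAM.State) : Store V A where
  v x := s.reg (2 * L.cv x)
  a X i := s.mem (2 ^ L.w * i + L.ca X)

open RAM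

/-- A program that doubles the register `r` for `n` times. -/
def double (r : ℕ) : ℕ → Prog
  | 0 => .instr (.move r r)
  | n + 1 => .seq (.instr (.add r r r)) (double r n)

/-- A program that puts the value of an expression into the register `2 * k + 1`, leaving alone the
registers of the variables and the odd registers below. -/
def AExp.compile (L : Layout V A) : ℕ → AExp V A → Prog
  | k, const c => .instr (.const (2 * k + 1) c)
  | k, var x => .instr (.move (2 * k + 1) (2 * L.cv x))
  | k, get X e => .seq (e.compile L k) (.seq (double (2 * k + 1) L.w)
      (.seq (.instr (.const (2 * k + 3) (L.ca X)))
        (.seq (.instr (.add (2 * k + 1) (2 * k + 1) (2 * k + 3)))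
          (.instr (.load (2 * k + 1) (2 * k + 1))))))
  | k, add e f => .seq (e.compile L k) (.seq (f.compile L (k + 1))
      (.instr (.add (2 * k + 1) (2 * k + 1) (2 * k + 3))))
  | k, sub e f => .seq (e.compile L k) (.seq (f.compile L (k + 1))
      (.instr (.sub (2 * k + 1) (2 * k + 1) (2 * k + 3))))

/-- The number of machine steps taken by a compiled expression. -/
def AExp.steps (w : ℕ) : AExp V A → ℕ
  | const _ => 1
  | var _ => 1
  | get _ e => e.steps w + (w + 1 + 3)
  | add e f => e.steps w + (f.steps w + 1)
  | sub e f => e.steps w + (f.steps w + 1)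

/-- A program that puts the value of a condition into register 1 and zero into register 3. -/
def AExp.compileTest (L : Layout V A) (e : AExp V A) : Prog :=
  .seq (e.compile L 0) (.instr (.const 3 0))

def Com.compile (L : Layout V A) : Com V A → Prog
  | skip => .instr (.const 1 0)
  | assign x e => .seq (e.compile L 0) (.instr (.move (2 * L.cv x) 1))
  | store X i e => .seq (i.compile L 0) (.seq (double 1 L.w)
      (.seq (.instr (.const 3 (L.ca X))) (.seq (.instr (.add 1 1 3))
        (.seq (e.compile L 1) (.instr (.store 1 3))))))
  | seq P Q => .seq (P.compile L) (Q.compile L)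
  | ite e P Q => .seq (e.compileTest L) (.ite (.lt 3 1) (P.compile L) (Q.compile L))
  | .while e P => .seq (e.compileTest L) (.loop (.lt 3 1) (.seq (P.compile L) (e.compileTest L)))

/-- A bound on the number of machine steps per step of a command. -/
def Com.factor (w : ℕ) : Com V A → ℕ
  | skip => 1
  | assign _ e => e.steps w + 1
  | store _ i e => i.steps w + (w + 1) + e.steps w + 3
  | seq P Q => P.factor w + Q.factor w
  | ite e P Q => e.steps w + 2 + P.factor w + Q.factor w
  | .while e P => e.steps w + 2 + P.factor w

omit [DecidableEq V] [DecidableEq A] in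
theorem exec_double (r n : ℕ) (s : State) :
    ∃ s', Exec (double r n) s (n + 1) s' ∧ s'.mem = s.mem ∧ s'.reg r = 2 ^ n * s.reg r ∧
      ∀ x, x ≠ r → s'.reg x = s.reg x := by
  induction n generalizing s with
  | zero =>
    refine ⟨_, Exec.instr _ _, rfl, by simp [Instr.apply], fun x hx => ?_⟩
    simp [Instr.apply]
  | succ n ih =>
    obtain ⟨s', h1, h2, h3, h4⟩ := ih ((Instr.add r r r).apply s)
    refine ⟨s', ?_, h2, ?_, fun x hx => ?_⟩
    · have := Exec.seq (Exec.instr (.add r r r) s) h1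
      rwa [Nat.add_comm 1] at this
    · rw [h3]; simp [Instr.apply]; ring
    · rw [h4 x hx]; simp [Instr.apply, hx]

omit [DecidableEq V] [DecidableEq A] in
theorem AExp.exec_compile (L : Layout V A) (e : AExp V A) (k : ℕ) (s : State) :
    ∃ s', Exec (e.compile L k) s (e.steps L.w) s' ∧ s'.mem = s.mem ∧
      s'.reg (2 * k + 1) = e.eval (L.view s) ∧
      (∀ x, s'.reg (2 * x) = s.reg (2 * x)) ∧ ∀ x, x < k → s'.reg (2 * x + 1) = s.reg (2 * x + 1) := by
  induction e generalizing k s with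
  | const c =>
    refine ⟨_, Exec.instr _ _, rfl, by simp [Instr.apply], fun x => ?_, fun x hx => ?_⟩
    · simp [Instr.apply, Function.update_apply]; omega
    · simp [Instr.apply, Function.update_apply]; omega
  | var x =>
    refine ⟨_, Exec.instr _ _, rfl, by simp [Instr.apply, Layout.view], fun x => ?_, fun x hx => ?_⟩
    · simp [Instr.apply, Function.update_apply]; omega
    · simp [Instr.apply, Function.update_apply]; omega
  | get X e ih =>
    obtain ⟨s1, h1, m1, v1, r1, o1⟩ := ih k s
    obtain ⟨s2, h2, m2, v2, r2⟩ := exec_double (2 * k + 1) L.w s1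
    refine ⟨_, Exec.seq h1 (Exec.seq h2 (Exec.seq (Exec.instr _ _) (Exec.seq (Exec.instr _ _)
      (Exec.instr _ _)))), ?_, ?_, fun x => ?_, fun x hx => ?_⟩
    · simp [Instr.apply, m1, m2]
    · simp [Instr.apply, m1, m2, v1, v2, Layout.view]
    · simp only [Instr.apply, Function.update_apply]
      rw [if_neg (by omega), if_neg (by omega), if_neg (by omega), r2 _ (by omega), r1]
    · simp only [Instr.apply, Function.update_apply]
      rw [if_neg (by omega), if_neg (by omega), if_neg (by omega), r2 _ (by omega), o1 x hx]
  | add e f ihe ihf =>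
    obtain ⟨s1, h1, m1, v1, r1, o1⟩ := ihe k s
    obtain ⟨s2, h2, m2, v2, r2, o2⟩ := ihf (k + 1) s1
    have hv : L.view s1 = L.view s := by ext <;> simp [Layout.view, r1, m1]
    refine ⟨_, Exec.seq h1 (Exec.seq h2 (Exec.instr _ _)), ?_, ?_, fun x => ?_, fun x hx => ?_⟩
    · simp [Instr.apply, m1, m2]
    · have : 2 * k + 3 = 2 * (k + 1) + 1 := by ring
      simp [Instr.apply, this, v2, o2 k (by omega), v1, hv]; rfl
    · simp only [Instr.apply, Function.update_apply]
      rw [if_neg (by omega), r2, r1]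
    · simp only [Instr.apply, Function.update_apply]
      rw [if_neg (by omega), o2 _ (by omega), o1 x hx]
  | sub e f ihe ihf =>
    obtain ⟨s1, h1, m1, v1, r1, o1⟩ := ihe k s
    obtain ⟨s2, h2, m2, v2, r2, o2⟩ := ihf (k + 1) s1
    have hv : L.view s1 = L.view s := by ext <;> simp [Layout.view, r1, m1]
    refine ⟨_, Exec.seq h1 (Exec.seq h2 (Exec.instr _ _)), ?_, ?_, fun x => ?_, fun x hx => ?_⟩
    · simp [Instr.apply, m1, m2]
    · have : 2 * k + 3 = 2 * (k + 1) + 1 := by ring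
      simp [Instr.apply, this, v2, o2 k (by omega), v1, hv]; rfl
    · simp only [Instr.apply, Function.update_apply]
      rw [if_neg (by omega), r2, r1]
    · simp only [Instr.apply, Function.update_apply]
      rw [if_neg (by omega), o2 _ (by omega), o1 x hx]

omit [DecidableEq V] [DecidableEq A] in
theorem AExp.exec_compileTest (L : Layout V A) (e : AExp V A) (s : State) :
    ∃ s', Exec (e.compileTest L) s (e.steps L.w + 1) s' ∧ L.view s' = L.view s ∧
      ((Test.lt 3 1).Holds s' ↔ e.eval (L.view s) ≠ 0) := by
  obtain ⟨s1, h1, m1, v1, r1, o1⟩ := e.exec_compile L 0 s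
  refine ⟨_, Exec.seq h1 (Exec.instr _ _), ?_, ?_⟩
  · ext x
    · simp only [Instr.apply, Layout.view, Function.update_apply]
      rw [if_neg (by omega), r1]
    · simp [Instr.apply, Layout.view, m1]
  · simp only [Nat.mul_zero, Nat.zero_add] at v1
    simp [Instr.apply, Test.Holds, v1]
    omega

theorem Com.exec_compile (L : Layout V A) (P : Com V A) {s₀ : Store V A} {k : ℕ} {s₁ : Store V A}
    (h : Run P s₀ k s₁) (s : State) (hs : L.view s = s₀) :
    ∃ s' k', Exec (P.compile L) s k' s' ∧ k' ≤ P.factor L.w * k ∧ L.view s' = s₁ := by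
  induction h generalizing s with
  | skip s₀ =>
    refine ⟨_, _, Exec.instr _ _, by simp [factor], ?_⟩
    rw [← hs]
    ext x
    · simp only [Instr.apply, Layout.view, Function.update_apply]
      rw [if_neg (by omega)]
    · simp [Instr.apply, Layout.view]
  | assign x e s₀ =>
    obtain ⟨s1, h1, m1, v1, r1, o1⟩ := e.exec_compile L 0 s
    refine ⟨_, _, Exec.seq h1 (Exec.instr _ _), by simp [factor], ?_⟩
    rw [← hs]
    ext y
    · simp only [Instr.apply, Layout.view, Function.update_apply, Store.setV_v]
      by_cases hxy : y = x
      · subst hxy; simp at v1 ⊢; exact v1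
      · rw [if_neg, if_neg hxy, r1]
        intro h; exact hxy (L.cv_inj (by omega))
    · simp [Instr.apply, Layout.view, m1]
  | store X i e s₀ =>
    obtain ⟨s1, h1, m1, v1, r1, o1⟩ := i.exec_compile L 0 s
    obtain ⟨s2, h2, m2, v2, r2⟩ := exec_double 1 L.w s1
    obtain ⟨s3, h3, m3, v3, r3, o3⟩ := e.exec_compile L 1
      ((Instr.add 1 1 3).apply ((Instr.const 3 (L.ca X)).apply s2))
    have hv : L.view ((Instr.add 1 1 3).apply ((Instr.const 3 (L.ca X)).apply s2)) = L.view s := by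
      ext x
      · simp only [Instr.apply, Layout.view, Function.update_apply]
        rw [if_neg (by omega), if_neg (by omega), r2 _ (by omega), r1]
      · simp [Instr.apply, Layout.view, m1, m2]
    refine ⟨_, _, Exec.seq h1 (Exec.seq h2 (Exec.seq (Exec.instr _ _) (Exec.seq (Exec.instr _ _)
      (Exec.seq h3 (Exec.instr _ _))))), by simp only [factor]; omega, ?_⟩
    have ha : s3.reg 1 = 2 ^ L.w * i.eval s₀ + L.ca X := by
      have := o3 0 (by omega)
      simp only [Nat.mul_zero, Nat.zero_add] at this v1
      rw [this]
      simp [Instr.apply, v2, v1, hs]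
    rw [hv, hs] at v3
    simp only [Nat.mul_one, Nat.reduceAdd] at v3
    rw [← hs]
    ext Y j
    · simp only [Instr.apply, Layout.view, Store.setA_v]
      rw [r3]
      simp only [Instr.apply, Function.update_apply]
      rw [if_neg (by omega), if_neg (by omega), r2 _ (by omega), r1]
    · have hm : s3.mem = s.mem := by rw [m3]; simp [Instr.apply, m2, m1]
      simp only [Instr.apply, Layout.view, Store.setA_a, Function.update_apply, ha, v3, hm]
      by_cases hY : Y = X
      · subst hY
        simp only [if_true, Function.update_apply]
        have hpos : 0 < 2 ^ L.w := by positivity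
        by_cases hj : j = i.eval s₀
        · subst hj; simp [← hs, Layout.view]
        · rw [if_neg, if_neg]
          · rwa [← hs] at hj
          · intro h
            exact hj (Nat.eq_of_mul_eq_mul_left hpos (by omega))
      · rw [if_neg hY, if_neg]
        intro h
        have h1 := congrArg (· % 2 ^ L.w) h
        simp only [Nat.mul_add_mod, Nat.mod_eq_of_lt (L.ca_lt _)] at h1
        exact hY (L.ca_inj h1)
  | seq _ _ ih1 ih2 =>
    obtain ⟨s1, k1, e1, l1, v1⟩ := ih1 s hs
    obtain ⟨s2, k2, e2, l2, v2⟩ := ih2 s1 v1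
    refine ⟨s2, _, Exec.seq e1 e2, ?_, v2⟩
    simp only [factor]; nlinarith
  | @ite_pos e P Q s₀ s₁ k hc _ ih =>
    obtain ⟨s1, e1, v1, t1⟩ := e.exec_compileTest L s
    obtain ⟨s2, k2, e2, l2, v2⟩ := ih s1 (v1.trans hs)
    refine ⟨s2, _, Exec.seq e1 (Exec.ite_pos (t1.2 (hs ▸ hc)) e2), ?_, v2⟩
    simp only [factor]; nlinarith
  | @ite_neg e P Q s₀ s₁ k hc _ ih =>
    obtain ⟨s1, e1, v1, t1⟩ := e.exec_compileTest L s
    obtain ⟨s2, k2, e2, l2, v2⟩ := ih s1 (v1.trans hs)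
    refine ⟨s2, _, Exec.seq e1 (Exec.ite_neg (fun h => t1.1 h (hs ▸ hc)) e2), ?_, v2⟩
    simp only [factor]; nlinarith
  | @while_done e P s₀ hc =>
    obtain ⟨s1, e1, v1, t1⟩ := e.exec_compileTest L s
    refine ⟨s1, _, Exec.seq e1 (Exec.loop_stop fun h => t1.1 h (hs ▸ hc)), ?_, v1.trans hs⟩
    simp only [factor]; omega
  | @while_step e P s₀ s₁ s₂ k l hc _ _ ih1 ih2 =>
    obtain ⟨s1, e1, v1, t1⟩ := e.exec_compileTest L s
    obtain ⟨s2, k2, e2, l2, v2⟩ := ih1 s1 (v1.trans hs)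
    obtain ⟨s3, k3, e3, l3, v3⟩ := ih2 s2 v2
    cases e3 with
    | seq e3 e4 =>
      refine ⟨s3, _, Exec.seq e1 (Exec.loop_step (t1.2 (hs ▸ hc)) (Exec.seq e2 e3) e4), ?_, v3⟩
      simp only [factor] at l3 ⊢
      nlinarith

/-! ### Program logic -/

/-- Started in `s`, the command `P` terminates, with a number of steps and a final store that
satisfy `Q`. -/
def Tri (P : Com V A) (s : Store V A) (Q : ℕ → Store V A → Prop) : Prop :=
  ∃ k s', Run P s k s' ∧ Q k s'

namespace Com

/-- The variables assigned by a command. -/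
def wv : Com V A → V → Bool
  | skip, _ => false
  | assign x _, y => decide (y = x)
  | store _ _ _, _ => false
  | seq P Q, y => P.wv y || Q.wv y
  | ite _ P Q, y => P.wv y || Q.wv y
  | .while _ P, y => P.wv y

/-- The arrays written by a command. -/
def wa : Com V A → A → Bool
  | skip, _ => false
  | assign _ _, _ => false
  | store X _ _, Y => decide (Y = X)
  | seq P Q, Y => P.wa Y || Q.wa Y
  | ite _ P Q, Y => P.wa Y || Q.wa Y
  | .while _ P, Y => P.wa Y

end Com

/-- Two stores differ only in what the command `P` may write. -/
def Frame (P : Com V A) (s s' : Store V A) : Prop :=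
  (∀ x, P.wv x = false → s'.v x = s.v x) ∧ ∀ X, P.wa X = false → s'.a X = s.a X

theorem Run.frame {P : Com V A} {s s' : Store V A} {k : ℕ} (h : Run P s k s') : Frame P s s' := by
  induction h with
  | skip s => exact ⟨fun _ _ => rfl, fun _ _ => rfl⟩
  | assign x e s => exact ⟨fun y hy => by simp_all [Com.wv], fun _ _ => rfl⟩
  | store X i e s => exact ⟨fun y hy => rfl, fun Y hY => by simp_all [Com.wa]⟩
  | seq _ _ ih1 ih2 =>
    refine ⟨fun x hx => ?_, fun X hX => ?_⟩
    · simp only [Com.wv, Bool.or_eq_false_iff] at hx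
      rw [ih2.1 x hx.2, ih1.1 x hx.1]
    · simp only [Com.wa, Bool.or_eq_false_iff] at hX
      rw [ih2.2 X hX.2, ih1.2 X hX.1]
  | ite_pos _ _ ih =>
    refine ⟨fun x hx => ?_, fun X hX => ?_⟩
    · simp only [Com.wv, Bool.or_eq_false_iff] at hx
      exact ih.1 x hx.1
    · simp only [Com.wa, Bool.or_eq_false_iff] at hX
      exact ih.2 X hX.1
  | ite_neg _ _ ih =>
    refine ⟨fun x hx => ?_, fun X hX => ?_⟩
    · simp only [Com.wv, Bool.or_eq_false_iff] at hx
      exact ih.1 x hx.2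
    · simp only [Com.wa, Bool.or_eq_false_iff] at hX
      exact ih.2 X hX.2
  | while_done _ => exact ⟨fun _ _ => rfl, fun _ _ => rfl⟩
  | while_step _ _ _ ih1 ih2 =>
    refine ⟨fun x hx => ?_, fun X hX => ?_⟩
    · rw [ih2.1 x hx, ih1.1 x hx]
    · rw [ih2.2 X hX, ih1.2 X hX]

theorem Tri.mono {P : Com V A} {s : Store V A} {Q Q' : ℕ → Store V A → Prop} (h : Tri P s Q)
    (hQ : ∀ k s', Frame P s s' → Q k s' → Q' k s') : Tri P s Q' := by
  obtain ⟨k, s', hr, hq⟩ := h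
  exact ⟨k, s', hr, hQ k s' hr.frame hq⟩

@[simp] theorem tri_skip {s : Store V A} {Q : ℕ → Store V A → Prop} : Tri .skip s Q ↔ Q 1 s := by
  refine ⟨?_, fun h => ⟨_, _, .skip _, h⟩⟩
  rintro ⟨_, _, ⟨⟩, h⟩
  exact h

@[simp] theorem tri_assign {x : V} {e : AExp V A} {s : Store V A}
    {Q : ℕ → Store V A → Prop} : Tri (.assign x e) s Q ↔ Q 1 (s.setV x (e.eval s)) := by
  refine ⟨?_, fun h => ⟨_, _, .assign _ _ _, h⟩⟩
  rintro ⟨_, _, ⟨⟩, h⟩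
  exact h

@[simp] theorem tri_store {X : A} {i e : AExp V A} {s : Store V A}
    {Q : ℕ → Store V A → Prop} :
    Tri (.store X i e) s Q ↔ Q 1 (s.setA X (i.eval s) (e.eval s)) := by
  refine ⟨?_, fun h => ⟨_, _, .store _ _ _ _, h⟩⟩
  rintro ⟨_, _, ⟨⟩, h⟩
  exact h

@[simp] theorem tri_seq {P R : Com V A} {s : Store V A} {Q : ℕ → Store V A → Prop} :
    Tri (.seq P R) s Q ↔ Tri P s fun k s' => Tri R s' fun l s'' => Q (k + l) s'' := by
  refine ⟨?_, fun ⟨k, s', hr, l, s'', hr', hq⟩ => ⟨_, _, .seq hr hr', hq⟩⟩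
  rintro ⟨_, _, h, hq⟩
  cases h with
  | seq h1 h2 => exact ⟨_, _, h1, _, _, h2, hq⟩

@[simp] theorem tri_ite {e : AExp V A} {P R : Com V A} {s : Store V A}
    {Q : ℕ → Store V A → Prop} :
    Tri (.ite e P R) s Q ↔ (e.eval s ≠ 0 → Tri P s fun k s' => Q (k + 1) s') ∧
      (e.eval s = 0 → Tri R s fun k s' => Q (k + 1) s') := by
  constructor
  · rintro ⟨_, _, h, hq⟩
    cases h with
    | ite_pos hc h => exact ⟨fun _ => ⟨_, _, h, hq⟩, fun h0 => absurd h0 hc⟩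
    | ite_neg hc h => exact ⟨fun h0 => absurd hc h0, fun _ => ⟨_, _, h, hq⟩⟩
  · rintro ⟨h1, h2⟩
    by_cases h : e.eval s = 0
    · obtain ⟨k, s', hr, hq⟩ := h2 h
      exact ⟨_, _, .ite_neg h hr, hq⟩
    · obtain ⟨k, s', hr, hq⟩ := h1 h
      exact ⟨_, _, .ite_pos h hr, hq⟩

/-- Loops are analysed with an invariant and a potential that pays for every iteration. -/
theorem tri_while {e : AExp V A} {P : Com V A} (I : Store V A → Prop) (pot : Store V A → ℕ)
    {s : Store V A} {Q : ℕ → Store V A → Prop} (h0 : I s)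
    (hstep : ∀ s', Frame P s s' → I s' → e.eval s' ≠ 0 →
      Tri P s' fun k s'' => I s'' ∧ k + 1 + pot s'' ≤ pot s')
    (hQ : ∀ k s', Frame P s s' → I s' → e.eval s' = 0 → k + pot s' ≤ 1 + pot s → Q k s') :
    Tri (.while e P) s Q := by
  suffices H : ∀ n s', pot s' ≤ n → Frame P s s' → I s' →
      ∃ k s'', Run (.while e P) s' k s'' ∧ Frame P s s'' ∧ I s'' ∧ e.eval s'' = 0 ∧
        k + pot s'' ≤ 1 + pot s' by
    obtain ⟨k, s'', hr, hf, hI, he, hk⟩ :=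
      H _ s le_rfl ⟨fun _ _ => rfl, fun _ _ => rfl⟩ h0
    exact ⟨k, s'', hr, hQ k s'' hf hI he hk⟩
  intro n
  induction n with
  | zero =>
    intro s' hp hf hI
    by_cases he : e.eval s' = 0
    · exact ⟨1, s', .while_done he, hf, hI, he, le_rfl⟩
    · obtain ⟨k, s'', hr, hI', hk⟩ := hstep s' hf hI he
      omega
  | succ n ih =>
    intro s' hp hf hI
    by_cases he : e.eval s' = 0
    · exact ⟨1, s', .while_done he, hf, hI, he, le_rfl⟩
    · obtain ⟨k, s'', hr, hI', hk⟩ := hstep s' hf hI he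
      have hf' := hr.frame
      obtain ⟨l, s₃, hr', hf₃, hI₃, he₃, hk₃⟩ := ih s'' (by omega)
        ⟨fun x hx => (hf'.1 x hx).trans (hf.1 x hx), fun X hX => (hf'.2 X hX).trans (hf.2 X hX)⟩ hI'
      exact ⟨_, s₃, .while_step he hr hr', hf₃, hI₃, he₃, by omega⟩

/-- The loop that executes `P` for `x = 0, …, N - 1`. -/
def Com.for (x : V) (N : AExp V A) (P : Com V A) : Com V A :=
  .assign x 0 ;; .while (.lt (.var x) N) (P ;; .assign x (.var x + 1))

/-- The rule for counting loops with amortized cost: iteration `i` starts in a store that satisfies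
`I i`, and pays with the decrease of the potential in addition to a budget of `T` steps. -/
theorem tri_for_pot {x : V} {N : AExp V A} {P : Com V A} (I : ℕ → Store V A → Prop)
    (pot : Store V A → ℕ) (n T : ℕ)
    {s : Store V A} {Q : ℕ → Store V A → Prop}
    (hN : ∀ i s', i ≤ n → s'.v x = i → Frame (Com.for x N P) s s' → I i s' → N.eval s' = n)
    (h0 : I 0 (s.setV x 0))
    (hstep : ∀ i s', i < n → s'.v x = i → Frame (Com.for x N P) s s' → I i s' →
      Tri P s' fun k s'' => s''.v x = i ∧ k + pot (s''.setV x (i + 1)) ≤ T + pot s' ∧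
        I (i + 1) (s''.setV x (i + 1)))
    (hQ : ∀ k s', Frame (Com.for x N P) s s' → I n s' → s'.v x = n →
      k + pot s' ≤ 2 + n * (T + 2) + pot (s.setV x 0) → Q k s') :
    Tri (Com.for x N P) s Q := by
  have hfr : ∀ s', Frame (P ;; .assign x (.var x + 1)) (s.setV x 0) s' →
      Frame (Com.for x N P) s s' := by
    intro s' hf
    refine ⟨fun y hy => ?_, fun Y hY => ?_⟩
    · simp only [Com.for, Com.wv, Bool.or_eq_false_iff] at hy
      rw [hf.1 y (by simp [Com.wv, hy])]
      simp only [decide_eq_false_iff_not] at hy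
      simp [hy.1]
    · simp only [Com.for, Com.wa, Bool.or_eq_false_iff] at hY
      rw [hf.2 Y (by simp [Com.wa, hY])]
      rfl
  refine tri_seq.2 (tri_assign.2 ?_)
  refine tri_while (I := fun s' => s'.v x ≤ n ∧ I (s'.v x) s')
    (pot := fun s' => pot s' + (n - s'.v x) * (T + 2)) ?_ ?_ ?_
  · simpa using h0
  · rintro s' hf ⟨hi, hI⟩ he
    have hf' := hfr s' hf
    have hNe := hN _ s' hi rfl hf' hI
    rw [ne_eq, AExp.eval_lt, not_not] at he
    simp only [AExp.eval_var, hNe] at he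
    refine tri_seq.2 ((hstep _ s' he rfl hf' hI).mono ?_)
    rintro k s'' - ⟨hx, hk, hI'⟩
    refine tri_assign.2 ?_
    simp only [AExp.eval_add, AExp.eval_var, AExp.eval_one, hx, Store.setV_v, if_true]
    refine ⟨⟨he, hI'⟩, ?_⟩
    have h1 : n - s'.v x = (n - (s'.v x + 1)) + 1 := by omega
    rw [h1, Nat.add_mul]
    omega
  · rintro k s' hf ⟨hi, hI⟩ he hk
    have hf' := hfr s' hf
    have hNe := hN _ s' hi rfl hf' hI
    have he' : ¬ (s'.v x < n) := by
      simpa [hNe] using he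
    have hx : s'.v x = n := by omega
    rw [hx] at hI
    refine hQ _ s' hf' hI hx ?_
    simp only [Store.setV_v, if_true, AExp.eval_zero, Nat.sub_zero] at hk
    omega

/-- The rule for counting loops each of whose iterations takes at most `T` steps. -/
theorem tri_for {x : V} {N : AExp V A} {P : Com V A} (I : ℕ → Store V A → Prop) (n T : ℕ)
    {s : Store V A} {Q : ℕ → Store V A → Prop}
    (hN : ∀ i s', i ≤ n → s'.v x = i → Frame (Com.for x N P) s s' → I i s' → N.eval s' = n)
    (h0 : I 0 (s.setV x 0))
    (hstep : ∀ i s', i < n → s'.v x = i → Frame (Com.for x N P) s s' → I i s' →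
      Tri P s' fun k s'' => s''.v x = i ∧ k ≤ T ∧ I (i + 1) (s''.setV x (i + 1)))
    (hQ : ∀ k s', Frame (Com.for x N P) s s' → I n s' → s'.v x = n →
      k ≤ 2 + n * (T + 2) → Q k s') :
    Tri (Com.for x N P) s Q :=
  tri_for_pot I (fun _ => 0) n T hN h0 (by simpa using hstep) (by simpa using hQ)

end Semantics

end Imp

/-! ### Cuts -/

/-- A finite symmetric digraph without loops, given by numbered arcs: the vertices are the numbers
below `n`, the arcs are the numbers below `M`, the arc `c` leaves the vertex `tl c`, and `rv c` is
the arc in the opposite direction. -/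
structure ArcGraph where
  n : ℕ
  M : ℕ
  tl : ℕ → ℕ
  rv : ℕ → ℕ
  tl_lt : ∀ c < M, tl c < n
  rv_lt : ∀ c < M, rv c < M
  rv_rv : ∀ c < M, rv (rv c) = c
  tl_rv_ne : ∀ c < M, tl (rv c) ≠ tl c

namespace ArcGraph

open Finset
open scoped Classical

variable (G : ArcGraph)

/-- The vertex that the arc `c` enters. -/
def hd (c : ℕ) : ℕ := G.tl (G.rv c)

theorem hd_lt {c : ℕ} (hc : c < G.M) : G.hd c < G.n := G.tl_lt _ (G.rv_lt c hc)

theorem hd_rv {c : ℕ} (hc : c < G.M) : G.hd (G.rv c) = G.tl c := by rw [hd, G.rv_rv c hc]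

theorem hd_ne {c : ℕ} (hc : c < G.M) : G.hd c ≠ G.tl c := G.tl_rv_ne c hc

theorem rv_ne {c : ℕ} (hc : c < G.M) : G.rv c ≠ c := fun h => G.tl_rv_ne c hc (by rw [h])

theorem sum_rv {β : Type*} [AddCommMonoid β] (f : ℕ → β) :
    ∑ c ∈ range G.M, f (G.rv c) = ∑ c ∈ range G.M, f c := by
  refine Finset.sum_nbij' G.rv G.rv ?_ ?_ ?_ ?_ ?_
  · intro c hc; simpa using G.rv_lt c (by simpa using hc)
  · intro c hc; simpa using G.rv_lt c (by simpa using hc)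
  · intro c hc; exact G.rv_rv c (by simpa using hc)
  · intro c hc; exact G.rv_rv c (by simpa using hc)
  · intro c _; rfl

/-- The number of arcs that leave a set of vertices. -/
noncomputable def cut (X : Set ℕ) : ℕ := ∑ c ∈ range G.M, if G.tl c ∈ X ∧ G.hd c ∉ X then 1 else 0

theorem cut_compl (X : Set ℕ) : G.cut Xᶜ = G.cut X := by
  unfold cut
  rw [← G.sum_rv]
  refine sum_congr rfl fun c hc => ?_
  rw [hd_rv _ (mem_range.1 hc)]
  have h : G.tl (G.rv c) = G.hd c := rfl
  simp only [Set.mem_compl_iff, not_not, h, and_comm]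

theorem cut_submod (X Y : Set ℕ) : G.cut (X ∪ Y) + G.cut (X ∩ Y) ≤ G.cut X + G.cut Y := by
  unfold cut
  rw [← sum_add_distrib, ← sum_add_distrib]
  refine sum_le_sum fun c _ => ?_
  by_cases h1 : G.tl c ∈ X <;> by_cases h2 : G.tl c ∈ Y <;> by_cases h3 : G.hd c ∈ X <;>
    by_cases h4 : G.hd c ∈ Y <;> simp [h1, h2, h3, h4]

theorem cut_posimod (X Y : Set ℕ) : G.cut (X \ Y) + G.cut (Y \ X) ≤ G.cut X + G.cut Y := by
  have h := G.cut_submod X Yᶜ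
  rw [G.cut_compl, ← G.cut_compl (X ∪ Yᶜ)] at h
  have h1 : (X ∪ Yᶜ)ᶜ = Y \ X := by ext v; simp [and_comm]
  have h2 : X ∩ Yᶜ = X \ Y := rfl
  rw [h1, h2] at h
  omega

theorem cut_congr {X Y : Set ℕ} (h : ∀ v < G.n, v ∈ X ↔ v ∈ Y) : G.cut X = G.cut Y := by
  refine sum_congr rfl fun c hc => ?_
  have hc := mem_range.1 hc
  rw [h _ (G.tl_lt c hc), h _ (G.hd_lt hc)]

/-- The set `X` separates `A` from `B`. -/
def Separates (A B X : Set ℕ) : Prop := A ⊆ X ∧ ∀ v ∈ B, v ∉ X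

/-- The minimum size of a cut that separates `A` from `B`. -/
noncomputable def mincut (A B : Set ℕ) : ℕ := sInf {k | ∃ X, Separates A B X ∧ G.cut X = k}

variable {G}

theorem mincut_le {A B X : Set ℕ} (h : Separates A B X) : G.mincut A B ≤ G.cut X :=
  Nat.sInf_le ⟨X, h, rfl⟩

theorem exists_mincut {A B : Set ℕ} (h : ∀ v ∈ A, v ∉ B) :
    ∃ X, Separates A B X ∧ G.cut X = G.mincut A B :=
  Nat.sInf_mem (s := {k | ∃ X, Separates A B X ∧ G.cut X = k})
    ⟨_, A, ⟨subset_rfl, fun _ hB hA => h _ hA hB⟩, rfl⟩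

theorem mincut_eq {A B X : Set ℕ} (h : Separates A B X)
    (hmin : ∀ Y, Separates A B Y → G.cut X ≤ G.cut Y) : G.mincut A B = G.cut X := by
  refine le_antisymm (mincut_le h) ?_
  obtain ⟨Y, hY, hc⟩ := exists_mincut (G := G) (A := A) (B := B) fun v hA hB => h.2 v hB (h.1 hA)
  rw [← hc]; exact hmin Y hY

theorem mincut_mono {A B A' B' : Set ℕ} (hA : A ⊆ A') (hB : B ⊆ B') (h : ∀ v ∈ A', v ∉ B') :
    G.mincut A B ≤ G.mincut A' B' := by
  obtain ⟨X, hX, hc⟩ := exists_mincut (G := G) h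
  rw [← hc]
  exact mincut_le ⟨hA.trans hX.1, fun v hv => hX.2 v (hB hv)⟩

theorem Separates.compl {A B X : Set ℕ} (h : Separates A B X) : Separates B A Xᶜ :=
  ⟨h.2, fun _ hv hX => hX (h.1 hv)⟩

theorem mincut_comm {A B : Set ℕ} (h : ∀ v ∈ A, v ∉ B) : G.mincut A B = G.mincut B A := by
  have key : ∀ {A B : Set ℕ}, (∀ v ∈ A, v ∉ B) → G.mincut B A ≤ G.mincut A B := by
    intro A B h
    obtain ⟨X, hX, hc⟩ := exists_mincut (G := G) h
    rw [← hc, ← G.cut_compl]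
    exact mincut_le hX.compl
  exact le_antisymm (key fun v hB hA => h v hA hB) (key h)

/-! ### Preflows

A preflow is represented by its residual capacities: the arc `c` has residual capacity `r c`, where
`r c + r (rv c) = 2`; the flow along `c` is `1 - r c`. -/

variable (G)

/-- The net amount of flow that enters `v`. -/
noncomputable def inflow (r : ℕ → ℕ) (v : ℕ) : ℤ :=
  ∑ c ∈ range G.M, if G.tl c = v then (r c : ℤ) - 1 else 0

/-- The net amount of flow that enters a set is what crosses its boundary. -/
theorem sum_inflow {r : ℕ → ℕ} (hr : ∀ c < G.M, r c + r (G.rv c) = 2) (Y : Set ℕ) :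
    ∑ v ∈ range G.n, (if v ∈ Y then G.inflow r v else 0) =
      ∑ c ∈ range G.M, if G.tl c ∈ Y ∧ G.hd c ∉ Y then (r c : ℤ) - 1 else 0 := by
  have h1 : ∑ v ∈ range G.n, (if v ∈ Y then G.inflow r v else 0) =
      ∑ c ∈ range G.M, if G.tl c ∈ Y then (r c : ℤ) - 1 else 0 := by
    have : ∀ v, (if v ∈ Y then G.inflow r v else 0) =
        ∑ c ∈ range G.M, if G.tl c = v then (if v ∈ Y then (r c : ℤ) - 1 else 0) else 0 := by
      intro v
      unfold inflow
      split_ifs with hv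
      · rfl
      · simp
    simp only [this]
    rw [sum_comm]
    refine sum_congr rfl fun c hc => ?_
    rw [sum_ite_eq, if_pos (mem_range.2 (G.tl_lt c (mem_range.1 hc)))]
  have h2 : ∑ c ∈ range G.M, (if G.tl c ∈ Y ∧ G.hd c ∈ Y then (r c : ℤ) - 1 else 0) = 0 := by
    have h3 := G.sum_rv fun c => if G.tl c ∈ Y ∧ G.hd c ∈ Y then (r c : ℤ) - 1 else 0
    have h4 : ∑ c ∈ range G.M, (if G.tl (G.rv c) ∈ Y ∧ G.hd (G.rv c) ∈ Y then
        (r (G.rv c) : ℤ) - 1 else 0) =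
        - ∑ c ∈ range G.M, (if G.tl c ∈ Y ∧ G.hd c ∈ Y then (r c : ℤ) - 1 else 0) := by
      rw [← sum_neg_distrib]
      refine sum_congr rfl fun c hc => ?_
      have hc := mem_range.1 hc
      rw [G.hd_rv hc]
      have h : G.tl (G.rv c) = G.hd c := rfl
      have := hr c hc
      by_cases a : G.tl c ∈ Y <;> by_cases b : G.hd c ∈ Y <;> simp [a, b, h]
      omega
    omega
  rw [h1, ← sub_eq_zero, ← sum_sub_distrib]
  refine Eq.trans ?_ h2
  refine sum_congr rfl fun c _ => ?_
  by_cases a : G.tl c ∈ Y <;> by_cases b : G.hd c ∈ Y <;> simp [a, b]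

variable {G}

/-- The total excess outside of a cut is bounded by the size of the cut, and the difference is at
least the number of residual arcs leaving the cut. -/
theorem sum_inflow_le_cut {r : ℕ → ℕ} (hr : ∀ c < G.M, r c + r (G.rv c) = 2) (X : Set ℕ) :
    ∑ v ∈ range G.n, (if v ∉ X then G.inflow r v else 0) +
      ∑ c ∈ range G.M, (if G.tl c ∈ X ∧ G.hd c ∉ X then (r c : ℤ) else 0) = G.cut X := by
  have h := G.sum_inflow hr Xᶜ
  simp only [Set.mem_compl_iff, not_not] at h
  rw [h, ← G.sum_rv, cut, ← sum_add_distrib]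
  push_cast
  refine sum_congr rfl fun c hc => ?_
  have hc := mem_range.1 hc
  rw [G.hd_rv hc]
  have h : G.tl (G.rv c) = G.hd c := rfl
  have := hr c hc
  by_cases a : G.tl c ∈ X <;> by_cases b : G.hd c ∈ X <;> simp [a, b, h]
  omega

/-- A preflow from `A` none of whose excess can still reach `B` proves that a cut is minimum. Here
`Z` is a set that contains `B` and that no residual arc enters. -/
theorem cut_le_of_preflow {r : ℕ → ℕ} (hr : ∀ c < G.M, r c + r (G.rv c) = 2) {A B Z X : Set ℕ}
    (hpos : ∀ v < G.n, v ∉ A → 0 ≤ G.inflow r v) (hBZ : B ⊆ Z)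
    (hZ : ∀ c < G.M, G.hd c ∈ Z → 0 < r c → G.tl c ∈ Z)
    (hzero : ∀ v < G.n, v ∈ Z → v ∉ B → G.inflow r v = 0) (hX : Separates A B X) :
    (G.cut Zᶜ : ℤ) +
      ∑ c ∈ range G.M, (if G.tl c ∈ X ∧ G.hd c ∉ X then (r c : ℤ) else 0) ≤ G.cut X := by
  have h0 : ∑ c ∈ range G.M, (if G.tl c ∉ Z ∧ G.hd c ∈ Z then (r c : ℤ) else 0) = 0 := by
    refine sum_eq_zero fun c hc => ?_
    split_ifs with h
    · by_contra hne
      exact h.1 (hZ c (mem_range.1 hc) h.2 (by omega))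
    · rfl
  have h1 := sum_inflow_le_cut hr Zᶜ
  simp only [Set.mem_compl_iff, not_not] at h1
  rw [← sum_inflow_le_cut hr X, ← h1, h0, add_zero]
  gcongr with v hv
  have hv := mem_range.1 hv
  by_cases hB : v ∈ B
  · simp [hBZ hB, hX.2 v hB]
  · by_cases hvX : v ∈ X
    · simp only [hvX, not_true, if_false]
      split_ifs with hvZ
      · exact (hzero v hv hvZ hB).le
      · rfl
    · have := hpos v hv fun h => hvX (hX.1 h)
      simp only [hvX, not_false_eq_true, if_true]
      split_ifs with hvZ
      · rfl
      · exact this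

end ArcGraph

/-! ### Push and relabel with unit capacities -/

namespace ArcGraph

open Finset
open scoped Classical

variable (G : ArcGraph)

/-- The residual capacities after one unit of flow was sent along the arc `c`. -/
def pushArc (r : ℕ → ℕ) (c : ℕ) : ℕ → ℕ :=
  Function.update (Function.update r c (r c - 1)) (G.rv c) (r (G.rv c) + 1)

/-- The height of the vertices that cannot send flow to the sinks any more. -/
def top : ℕ := G.n + 2

/-- The state of the push-relabel method for sending flow from `A` to `B`: residual capacities `r`,
heights `d`, and for each vertex `u` the least arc `pt u` that may still be admissible, that is, have
positive residual capacity and descend by one. The vertex `v` holds `tok v` units of excess that are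
yet to be moved; further excess occurs only in `B` and at the height `top`, where it is abandoned. -/
structure PushState (A B : Set ℕ) (r d pt tok : ℕ → ℕ) : Prop where
  res : ∀ c < G.M, r c + r (G.rv c) = 2
  dA : ∀ v ∈ A, d v = G.top
  dB : ∀ v ∈ B, d v = 0
  dpos : ∀ v < G.n, v ∉ B → 0 < d v
  dle : ∀ v < G.n, d v ≤ G.top
  valid : ∀ c < G.M, 0 < r c → d (G.tl c) ≤ d (G.hd c) + 1
  ptr : ∀ c < G.M, c < pt (G.tl c) → ¬ (0 < r c ∧ d (G.tl c) = d (G.hd c) + 1)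
  exc : ∀ v < G.n, v ∉ A → (tok v : ℤ) ≤ G.inflow r v
  exc_eq : ∀ v < G.n, v ∉ B → d v < G.top → G.inflow r v = tok v

/-- The part of the potential of the arc `c` that pays for pushing along `c` and along its
reverse. -/
noncomputable def arcPot (r d : ℕ → ℕ) (c : ℕ) : ℕ :=
  2 * (G.top - d (G.tl c)) +
    if d (G.hd c) < d (G.tl c) then 2 * r c else if d (G.hd c) = d (G.tl c) then 1 else 0

/-- A potential that decreases with every operation of the push-relabel method. -/
noncomputable def pot (r d pt : ℕ → ℕ) : ℕ :=
  ∑ c ∈ range G.M, (2 * (G.top - d (G.tl c)) + if pt (G.tl c) ≤ c then 1 else 0) +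
    ∑ c ∈ range G.M, (G.arcPot r d c + G.arcPot r d (G.rv c))

variable {G}

theorem pot_le {r d pt : ℕ → ℕ} (hr : ∀ c < G.M, r c + r (G.rv c) = 2) :
    G.pot r d pt ≤ G.M * (6 * G.n + 30) := by
  have h1 : ∑ c ∈ range G.M, (2 * (G.top - d (G.tl c)) + if pt (G.tl c) ≤ c then 1 else 0) ≤
      ∑ _c ∈ range G.M, (2 * G.n + 5) := by
    refine sum_le_sum fun c _ => ?_
    have : G.top = G.n + 2 := rfl
    split_ifs <;> omega
  have h2 : ∑ c ∈ range G.M, (G.arcPot r d c + G.arcPot r d (G.rv c)) ≤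
      ∑ _c ∈ range G.M, (4 * G.n + 16) := by
    refine sum_le_sum fun c hc => ?_
    have := hr c (mem_range.1 hc)
    have : G.top = G.n + 2 := rfl
    unfold arcPot
    split_ifs <;> omega
  simp only [sum_const, card_range, smul_eq_mul] at h1 h2
  unfold pot
  nlinarith

theorem inflow_pushArc {r : ℕ → ℕ} {c : ℕ} (hc : c < G.M) (hrc : 0 < r c) (v : ℕ) :
    G.inflow (G.pushArc r c) v =
      G.inflow r v - (if v = G.tl c then 1 else 0) + if v = G.hd c then 1 else 0 := by
  have hne := G.rv_ne hc
  have hrv := G.rv_lt c hc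
  have key : ∀ e ∈ range G.M, (if G.tl e = v then (G.pushArc r c e : ℤ) - 1 else 0) =
      (if G.tl e = v then (r e : ℤ) - 1 else 0) + ((if e = c then (if v = G.tl c then -1 else 0) else 0)
        + (if e = G.rv c then (if v = G.hd c then 1 else 0) else 0)) := by
    intro e _
    unfold pushArc
    by_cases h1 : e = G.rv c
    · subst h1
      simp only [Function.update_self, hne, if_false, if_true, zero_add, hd, eq_comm (a := v)]
      split_ifs <;> simp
    · rw [Function.update_of_ne h1]
      by_cases h2 : e = c
      · subst h2
        simp only [Function.update_self, h1, if_false, if_true, add_zero, eq_comm (a := v)]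
        split_ifs <;> omega
      · rw [Function.update_of_ne h2]
        simp [h1, h2]
  unfold inflow
  rw [sum_congr rfl key, sum_add_distrib, sum_add_distrib, sum_ite_eq', sum_ite_eq',
    if_pos (mem_range.2 hc), if_pos (mem_range.2 hrv)]
  split_ifs <;> ring

/-- Replacing `r`, `d`, `pt` pays if no arc loses and some arc gains. -/
theorem sum_lt_of_arc {f g : ℕ → ℕ} (hle : ∀ c < G.M, f c ≤ g c) {c : ℕ} (hc : c < G.M)
    (hlt : f c < g c) : ∑ c ∈ range G.M, f c < ∑ c ∈ range G.M, g c :=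
  sum_lt_sum (fun c hc => hle c (mem_range.1 hc)) ⟨c, mem_range.2 hc, hlt⟩

namespace PushState

variable {A B : Set ℕ} {r d pt w tok : ℕ → ℕ} {u : ℕ}

/-- A unit of excess moves along an admissible arc. -/
theorem push (h : G.PushState A B r d pt fun v => w v + if v = u then 1 else 0) {c : ℕ}
    (hc : c < G.M) (hu : G.tl c = u) (hrc : 0 < r c) (had : d u = d (G.hd c) + 1)
    (hlt : d u < G.top) :
    G.PushState A B (G.pushArc r c) d pt (fun v => w v + if v = G.hd c then 1 else 0) ∧
      G.pot (G.pushArc r c) d pt < G.pot r d pt := by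
  subst hu
  have hne := G.rv_ne hc
  have hrv := G.rv_lt c hc
  have hrr := G.rv_rv c hc
  have hself : G.pushArc r c c = r c - 1 := by
    rw [pushArc, Function.update_of_ne hne.symm, Function.update_self]
  have hrev : G.pushArc r c (G.rv c) = r (G.rv c) + 1 := by rw [pushArc, Function.update_self]
  have hoth : ∀ e, e ≠ c → e ≠ G.rv c → G.pushArc r c e = r e := by
    intro e h1 h2
    rw [pushArc, Function.update_of_ne h2, Function.update_of_ne h1]
  have hr2 := h.res c hc
  have hhne := G.hd_ne hc
  have htl : G.tl (G.rv c) = G.hd c := rfl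
  have hhd := G.hd_rv hc
  refine ⟨⟨?_, h.dA, h.dB, h.dpos, h.dle, ?_, ?_, ?_, ?_⟩, ?_⟩
  · intro e he
    by_cases h1 : e = c
    · subst h1; rw [hself, hrev]; omega
    by_cases h2 : e = G.rv c
    · subst h2; rw [hrr, hself, hrev]; omega
    rw [hoth e h1 h2, hoth (G.rv e) _ _, h.res e he]
    · intro h3; exact h2 (by rw [← h3, G.rv_rv e he])
    · intro h3; exact h1 (by rw [← G.rv_rv e he, h3, hrr])
  · intro e he hre
    by_cases h1 : e = c
    · subst h1; exact h.valid e he hrc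
    by_cases h2 : e = G.rv c
    · subst h2; rw [htl, hhd]; omega
    exact h.valid e he (by rwa [hoth e h1 h2] at hre)
  · rintro e he hpt ⟨hre, hd⟩
    by_cases h1 : e = c
    · subst h1; exact h.ptr e he hpt ⟨hrc, hd⟩
    by_cases h2 : e = G.rv c
    · subst h2; rw [htl, hhd] at hd; omega
    exact h.ptr e he hpt ⟨by rwa [hoth e h1 h2] at hre, hd⟩
  · intro v hv hA
    have := h.exc v hv hA
    rw [inflow_pushArc hc hrc]
    push_cast at this ⊢
    linarith
  · intro v hv hB hd
    have := h.exc_eq v hv hB hd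
    rw [inflow_pushArc hc hrc, this]
    push_cast
    ring
  · unfold pot
    refine Nat.add_lt_add_left (sum_lt_of_arc ?_ hc ?_) _
    · intro e he
      by_cases h1 : e = c
      · subst h1
        unfold arcPot
        rw [hself, hrev, htl, hhd]
        split_ifs <;> omega
      by_cases h2 : e = G.rv c
      · subst h2
        unfold arcPot
        rw [hrr, hself, hrev, htl, hhd]
        split_ifs <;> omega
      have h3 : G.rv e ≠ c := fun h3 => h2 (by rw [← h3, G.rv_rv e he])
      have h4 : G.rv e ≠ G.rv c := fun h3 => h1 (by rw [← G.rv_rv e he, h3, hrr])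
      unfold arcPot
      rw [hoth e h1 h2, hoth _ h3 h4]
    · unfold arcPot
      rw [hself, hrev, htl, hhd]
      split_ifs <;> omega

/-- The pointer of a vertex moves past an arc that is not admissible. -/
theorem advance (h : G.PushState A B r d pt tok) (hc : pt u < G.M) (hu : G.tl (pt u) = u)
    (had : ¬ (0 < r (pt u) ∧ d u = d (G.hd (pt u)) + 1)) {f : ℕ} (hf : pt u < f)
    (hskip : ∀ c < G.M, pt u < c → c < f → G.tl c ≠ u) :
    G.PushState A B r d (Function.update pt u f) tok ∧
      G.pot r d (Function.update pt u f) < G.pot r d pt := by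
  refine ⟨⟨h.res, h.dA, h.dB, h.dpos, h.dle, h.valid, ?_, h.exc, h.exc_eq⟩, ?_⟩
  · intro c hc hlt
    by_cases h1 : G.tl c = u
    · rw [h1, Function.update_self] at hlt
      rcases lt_trichotomy c (pt u) with h2 | h2 | h2
      · exact h.ptr c hc (by rwa [h1])
      · rw [h1, h2]; exact had
      · exact absurd h1 (hskip c hc h2 hlt)
    · rw [Function.update_of_ne h1] at hlt
      exact h.ptr c hc hlt
  · unfold pot
    refine Nat.add_lt_add_right (sum_lt_of_arc ?_ hc ?_) _
    · intro e he
      by_cases h1 : G.tl e = u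
      · rw [h1, Function.update_self]
        split_ifs <;> omega
      · rw [Function.update_of_ne h1]
    · rw [hu, Function.update_self]
      split_ifs <;> omega

/-- A vertex without admissible arcs is lifted. -/
theorem relabel (h : G.PushState A B r d pt tok) (hpos : 0 < d u) (hlt : d u < G.top)
    (hpt : G.M ≤ pt u) {c₀ : ℕ} (hc₀ : c₀ < G.M) (hu : G.tl c₀ = u) {f : ℕ}
    (hf : ∀ c < G.M, G.tl c = u → f ≤ c) :
    G.PushState A B r (Function.update d u (d u + 1)) (Function.update pt u f) tok ∧
      G.pot r (Function.update d u (d u + 1)) (Function.update pt u f) < G.pot r d pt := by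
  have hun : u < G.n := hu ▸ G.tl_lt c₀ hc₀
  have hadm : ∀ c < G.M, G.tl c = u → 0 < r c → d u ≤ d (G.hd c) := by
    intro c hc h1 h2
    have h3 := h.ptr c hc (by rw [h1]; omega)
    have h4 := h.valid c hc h2
    rw [h1] at h3 h4
    by_contra h5
    exact h3 ⟨h2, by omega⟩
  have huA : u ∉ A := fun hA => by have := h.dA u hA; omega
  have huB : u ∉ B := fun hB => by have := h.dB u hB; omega
  have hself : Function.update d u (d u + 1) u = d u + 1 := Function.update_self ..
  have hoth : ∀ v, v ≠ u → Function.update d u (d u + 1) v = d v :=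
    fun v hv => Function.update_of_ne hv ..
  refine ⟨⟨h.res, ?_, ?_, ?_, ?_, ?_, ?_, h.exc, ?_⟩, ?_⟩
  · intro v hv
    rw [hoth v (fun e => huA (e ▸ hv)), h.dA v hv]
  · intro v hv
    rw [hoth v (fun e => huB (e ▸ hv)), h.dB v hv]
  · intro v hv hB
    by_cases hvu : v = u
    · rw [hvu, hself]; omega
    · rw [hoth v hvu]; exact h.dpos v hv hB
  · intro v hv
    by_cases hvu : v = u
    · rw [hvu, hself]; omega
    · rw [hoth v hvu]; exact h.dle v hv
  · intro c hc hrc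
    have h1 := h.valid c hc hrc
    have h2 := G.hd_ne hc
    by_cases h3 : G.tl c = u
    · have := hadm c hc h3 hrc
      rw [h3, hself, hoth _ (h3 ▸ h2)]; omega
    · rw [hoth _ h3]
      by_cases h4 : G.hd c = u
      · rw [h4] at h1 ⊢; rw [hself]; omega
      · rwa [hoth _ h4]
  · rintro c hc hlt ⟨hrc, hd⟩
    by_cases h3 : G.tl c = u
    · rw [h3, Function.update_self] at hlt
      have := hf c hc h3
      omega
    · rw [Function.update_of_ne h3] at hlt
      rw [hoth _ h3] at hd
      by_cases h4 : G.hd c = u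
      · rw [h4, hself] at hd
        have := h.valid c hc hrc
        rw [h4] at this
        omega
      · rw [hoth _ h4] at hd
        exact h.ptr c hc hlt ⟨hrc, hd⟩
  · intro v hv hB hd
    by_cases hvu : v = u
    · exact h.exc_eq v hv hB (by rw [hvu]; exact hlt)
    · rw [hoth v hvu] at hd; exact h.exc_eq v hv hB hd
  · unfold pot
    refine Nat.add_lt_add_of_lt_of_le (sum_lt_of_arc ?_ hc₀ ?_) (sum_le_sum fun c hc => ?_)
    · intro e he
      by_cases h1 : G.tl e = u
      · rw [h1, hself, Function.update_self]
        split_ifs <;> omega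
      · rw [hoth _ h1, Function.update_of_ne h1]
    · rw [hu, hself, Function.update_self]
      split_ifs <;> omega
    · have hc := mem_range.1 hc
      have htl : G.tl (G.rv c) = G.hd c := rfl
      have hr1 := h.res c hc
      have hne := G.hd_ne hc
      have a1 := hadm c hc
      have a2 := hadm (G.rv c) (G.rv_lt c hc)
      have v1 := h.valid c hc
      have v2 := h.valid (G.rv c) (G.rv_lt c hc)
      rw [htl, G.hd_rv hc] at a2 v2
      unfold arcPot
      rw [htl, G.hd_rv hc]
      by_cases h1 : G.tl c = u
      · have h2 : G.hd c ≠ u := h1 ▸ hne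
        rw [h1] at a1 v1 v2 ⊢
        rw [hself, hoth _ h2]
        have a1 := a1 rfl
        split_ifs <;> omega
      · by_cases h2 : G.hd c = u
        · rw [h2] at a2 v1 v2 ⊢
          rw [hself, hoth _ h1]
          have a2 := a2 rfl
          split_ifs <;> omega
        · rw [hoth _ h1, hoth _ h2]

/-- A unit that has arrived in `B` or at the height `top` needs no further care. -/
theorem drop (h : G.PushState A B r d pt fun v => w v + if v = u then 1 else 0)
    (hu : u < G.n) (hd : d u = 0 ∨ G.top ≤ d u) : G.PushState A B r d pt w := by
  refine ⟨h.res, h.dA, h.dB, h.dpos, h.dle, h.valid, h.ptr, ?_, ?_⟩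
  · intro v hv hA
    have := h.exc v hv hA
    push_cast at this
    split_ifs at this <;> omega
  · intro v hv hB hlt
    rw [h.exc_eq v hv hB hlt]
    by_cases hvu : v = u
    · have := h.dpos v hv hB
      subst hvu; omega
    · simp [hvu]

end PushState

/-- The number of units that start at `v` if one unit is sent along each of the arcs from `k`
onwards that lead out of `A`. -/
noncomputable def pending (G : ArcGraph) (A : Set ℕ) (k v : ℕ) : ℕ :=
  ∑ c ∈ range G.M, if k ≤ c ∧ G.tl c ∈ A ∧ G.hd c ∉ A ∧ v = G.hd c then 1 else 0

theorem pending_succ {A : Set ℕ} {k : ℕ} (hk : k < G.M) (v : ℕ) :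
    G.pending A k v = G.pending A (k + 1) v +
      if G.tl k ∈ A ∧ G.hd k ∉ A ∧ v = G.hd k then 1 else 0 := by
  have : ∀ c ∈ range G.M, (if k ≤ c ∧ G.tl c ∈ A ∧ G.hd c ∉ A ∧ v = G.hd c then 1 else 0) =
      (if k + 1 ≤ c ∧ G.tl c ∈ A ∧ G.hd c ∉ A ∧ v = G.hd c then 1 else 0) +
      if c = k then (if G.tl k ∈ A ∧ G.hd k ∉ A ∧ v = G.hd k then 1 else 0) else 0 := by
    intro c _
    rcases lt_trichotomy c k with h | h | h
    · rw [if_neg (by omega), if_neg (by omega), if_neg (by omega)]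
    · subst h
      simp
    · have h1 : k ≤ c := by omega
      have h2 : k + 1 ≤ c := by omega
      have h3 : c ≠ k := by omega
      simp [h1, h2, h3]
  unfold pending
  rw [sum_congr rfl this, sum_add_distrib, sum_ite_eq', if_pos (mem_range.2 hk)]

theorem pending_last (A : Set ℕ) (v : ℕ) : G.pending A G.M v = 0 := by
  refine sum_eq_zero fun c hc => if_neg ?_
  have := mem_range.1 hc
  omega

/-- The push-relabel method starts with all arcs out of `A` saturated. -/
theorem PushState.start {A B : Set ℕ} {r d pt : ℕ → ℕ}
    (hr : ∀ c < G.M, r c =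
      if G.tl c ∈ A then (if G.hd c ∈ A then 1 else 0) else if G.hd c ∈ A then 2 else 1)
    (hdA : ∀ v ∈ A, d v = G.top) (hdB : ∀ v ∈ B, d v = 0)
    (hd : ∀ v < G.n, v ∉ A → v ∉ B → d v = 1) (hpt : ∀ c < G.M, pt (G.tl c) ≤ c) :
    G.PushState A B r d pt (G.pending A 0) := by
  have htop : G.top = G.n + 2 := rfl
  have hle : ∀ v < G.n, v ∉ A → d v ≤ 1 := by
    intro v hv hA
    by_cases hB : v ∈ B
    · rw [hdB v hB]; omega
    · rw [hd v hv hA hB]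
  have hin : ∀ v < G.n, v ∉ A → G.inflow r v = G.pending A 0 v := by
    intro v hv hA
    unfold inflow pending
    rw [← G.sum_rv]
    push_cast
    refine sum_congr rfl fun c hc => ?_
    have hc := mem_range.1 hc
    have h1 : G.tl (G.rv c) = G.hd c := rfl
    rw [hr _ (G.rv_lt c hc), h1, G.hd_rv hc]
    by_cases h2 : G.hd c = v
    · rw [h2]
      by_cases h3 : G.tl c ∈ A <;> simp [h3, hA]
    · simp [h2, Ne.symm h2]
  refine ⟨?_, hdA, hdB, ?_, ?_, ?_, ?_, ?_, ?_⟩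
  · intro c hc
    rw [hr c hc, hr _ (G.rv_lt c hc), G.hd_rv hc]
    have h1 : G.tl (G.rv c) = G.hd c := rfl
    rw [h1]
    split_ifs <;> rfl
  · intro v hv hB
    by_cases hA : v ∈ A
    · rw [hdA v hA]; omega
    · rw [hd v hv hA hB]; omega
  · intro v hv
    by_cases hA : v ∈ A
    · rw [hdA v hA]
    · have := hle v hv hA; omega
  · intro c hc hrc
    rw [hr c hc] at hrc
    by_cases h1 : G.tl c ∈ A
    · by_cases h2 : G.hd c ∈ A
      · rw [hdA _ h1, hdA _ h2]; omega
      · simp [h1, h2] at hrc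
    · have := hle _ (G.tl_lt c hc) h1; omega
  · intro c hc hlt
    have := hpt c hc
    omega
  · intro v hv hA
    rw [hin v hv hA]
  · intro v hv hB hlt
    refine hin v hv fun hA => ?_
    have := hdA v hA
    omega

/-- When no unit is left to be moved, the set `Z` of the vertices from which `B` can be reached along
residual arcs is the complement of a minimum cut, and it is disjoint from every minimum cut. -/
theorem PushState.cut_eq {A B Z : Set ℕ} {r d pt tok : ℕ → ℕ} (h : G.PushState A B r d pt tok)
    (htok : ∀ v, tok v = 0) (hBn : ∀ v ∈ B, v < G.n) (hBZ : B ⊆ Z)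
    (hZ : ∀ c < G.M, G.hd c ∈ Z → 0 < r c → G.tl c ∈ Z)
    (hmin : ∀ Y : Set ℕ, B ⊆ Y → (∀ c < G.M, G.hd c ∈ Y → 0 < r c → G.tl c ∈ Y) → Z ⊆ Y) :
    Separates A B Zᶜ ∧ G.cut Zᶜ = G.mincut A B ∧
      ∀ X, Separates A B X → G.cut X ≤ G.mincut A B → ∀ v ∈ Z, v ∉ X := by
  have htop : G.top = G.n + 2 := rfl
  -- There are more heights strictly between `0` and `top` than vertices, so one of them is unused.
  obtain ⟨k, hk, hgap⟩ : ∃ k ∈ Icc 1 (G.n + 1), k ∉ (range G.n).image d := by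
    refine exists_mem_notMem_of_card_lt_card (lt_of_le_of_lt card_image_le ?_)
    simp
  rw [mem_Icc] at hk
  have hgap : ∀ v < G.n, d v ≠ k := fun v hv he =>
    hgap (mem_image.2 ⟨v, mem_range.2 hv, he⟩)
  have hZk : Z ⊆ {v | v < G.n ∧ d v < k} := by
    refine hmin _ (fun v hv => ⟨hBn v hv, ?_⟩) ?_
    · rw [h.dB v hv]; omega
    · rintro c hc ⟨h1, h2⟩ hrc
      have h3 := h.valid c hc hrc
      have h4 := hgap _ (G.tl_lt c hc)
      exact ⟨G.tl_lt c hc, by omega⟩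
  have hsep : Separates A B Zᶜ := by
    refine ⟨fun v hA hv => ?_, fun v hB hv => hv (hBZ hB)⟩
    have h1 := (hZk hv).2
    rw [h.dA v hA] at h1
    omega
  have hflow : ∀ X, Separates A B X → (G.cut Zᶜ : ℤ) +
      ∑ c ∈ range G.M, (if G.tl c ∈ X ∧ G.hd c ∉ X then (r c : ℤ) else 0) ≤ G.cut X := by
    intro X hX
    refine cut_le_of_preflow h.res (fun v hv hA => ?_) hBZ hZ (fun v hv hvZ hB => ?_) hX
    · have := h.exc v hv hA
      rw [htok] at this
      exact this
    · have := (hZk hvZ).2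
      rw [h.exc_eq v hv hB (by omega), htok]
      rfl
  have hnn : ∀ X : Set ℕ, ∀ c ∈ range G.M,
      0 ≤ (if G.tl c ∈ X ∧ G.hd c ∉ X then (r c : ℤ) else 0) := by
    intro X c _
    split_ifs <;> simp
  have hle : ∀ X, Separates A B X → G.cut Zᶜ ≤ G.cut X := by
    intro X hX
    have := hflow X hX
    have := sum_nonneg (hnn X)
    omega
  have heq : G.mincut A B = G.cut Zᶜ := mincut_eq hsep hle
  refine ⟨hsep, heq.symm, fun X hX hc => ?_⟩
  suffices Z ⊆ Xᶜ from this
  refine hmin _ hX.2 fun c hc h1 hrc h2 => ?_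
  have h3 := hflow X hX
  have h4 := single_le_sum (hnn X) (mem_range.2 hc)
  rw [if_pos ⟨h2, h1⟩] at h4
  omega

end ArcGraph

/-! ### Labellings by the nodes of a tree -/

section

open Finset
open scoped Classical

/-- The splits of the nodes of a tree that its edges induce: for `x < t`, one side of the split `x`
consists of the nodes `y` with `σ x y`. Trivial splits are allowed. -/
structure Splits (W : Type*) where
  t : ℕ
  σ : ℕ → W → Prop

namespace Splits

variable {W : Type*} (S : Splits W)

/-- The split `x` is the only one that separates `a` from `b`, that is, `x` belongs to the edge of
the tree between `a` and `b`, where `a` is on the first side. -/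
def Edge (x : ℕ) (a b : W) : Prop :=
  S.σ x a ∧ ¬ S.σ x b ∧ ∀ y < S.t, y ≠ x → (S.σ y a ↔ S.σ y b)

/-- The properties of the splits induced by the edges of a tree. -/
structure IsTree : Prop where
  edge : ∀ x < S.t, (∀ y z, S.σ x y ↔ S.σ x z) ∨ ∃ a b, S.Edge x a b
  cross : ∀ x < S.t, ∀ y < S.t, x ≠ y → ∀ a b, S.Edge x a b →
    (∀ z, S.σ x z → (S.σ y z ↔ S.σ y a)) ∨ ∀ z, ¬ S.σ x z → (S.σ y z ↔ S.σ y a)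
  incident : ∀ d z, d ≠ z → ∃ x < S.t, (∃ e, S.Edge x d e ∨ S.Edge x e d) ∧ ¬ (S.σ x d ↔ S.σ x z)

end Splits

namespace ArcGraph

variable (G : ArcGraph) {W : Type*}

/-- The vertices that the partial labelling `τ` assigns to the side `P`. -/
def terms (τ : ℕ → Option W) (P : W → Prop) : Set ℕ := {v | v < G.n ∧ ∃ y, τ v = some y ∧ P y}

/-- The labelling `l` extends the partial labelling `τ`. -/
def Extends (τ : ℕ → Option W) (l : ℕ → W) : Prop := ∀ v < G.n, ∀ y, τ v = some y → l v = y

/-- The size of a minimum cut between the vertices that `τ` assigns to the two sides of `P`. -/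
noncomputable def sideCut (τ : ℕ → Option W) (P : W → Prop) : ℕ :=
  G.mincut (G.terms τ P) (G.terms τ fun y => ¬ P y)

/-- The set `X` separates the vertices that `τ` assigns to the two sides of `P`. -/
def SepSides (τ : ℕ → Option W) (P : W → Prop) (X : Set ℕ) : Prop :=
  Separates (G.terms τ P) (G.terms τ fun y => ¬ P y) X

/-- The cost of a labelling for the tree metric, cut by cut. -/
noncomputable def labelCost (S : Splits W) (l : ℕ → W) : ℕ :=
  ∑ x ∈ range S.t, G.cut {v | S.σ x (l v)}

/-- The sum of the minimum cuts for all splits, which is the cost of an optimal labelling. -/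
noncomputable def bound (S : Splits W) (τ : ℕ → Option W) : ℕ :=
  ∑ x ∈ range S.t, G.sideCut τ (S.σ x)

variable {G} {τ : ℕ → Option W} {l : ℕ → W} {P : W → Prop} {S : Splits W}

theorem terms_disjoint : ∀ v ∈ G.terms τ P, v ∉ G.terms τ fun y => ¬ P y := by
  rintro v ⟨-, y, hy, hP⟩ ⟨-, z, hz, hnP⟩
  rw [hy, Option.some_inj] at hz
  exact hnP (hz ▸ hP)

theorem sideCut_not : G.sideCut τ (fun y => ¬ P y) = G.sideCut τ P := by
  unfold sideCut
  simp only [not_not]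
  exact (mincut_comm terms_disjoint).symm

theorem sideCut_iff (d : W) : G.sideCut τ (fun y => P y ↔ P d) = G.sideCut τ P := by
  by_cases h : P d
  · simp only [h, iff_true]
  · simp only [h, iff_false]; exact sideCut_not

theorem Extends.sepSides (h : G.Extends τ l) (P : W → Prop) : G.SepSides τ P {v | P (l v)} := by
  refine ⟨?_, ?_⟩
  · rintro v ⟨hv, y, hy, hP⟩
    simpa [h v hv y hy] using hP
  · rintro v ⟨hv, y, hy, hP⟩
    simpa [h v hv y hy] using hP

theorem exists_sideCut (τ : ℕ → Option W) (P : W → Prop) :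
    ∃ X, G.SepSides τ P X ∧ G.cut X = G.sideCut τ P := exists_mincut terms_disjoint

theorem bound_le (h : G.Extends τ l) : G.bound S τ ≤ G.labelCost S l :=
  sum_le_sum fun x _ => mincut_le (h.sepSides (S.σ x))

/-! ### Pushing a minimum cut -/

/-- Move the vertices of `M` that are not on the side `P` to the node `a`. -/
noncomputable def pushTo (l : ℕ → W) (P : W → Prop) (M : Set ℕ) (a : W) (v : ℕ) : W :=
  if v ∈ M ∧ ¬ P (l v) then a else l v

section Push

variable {M : Set ℕ} {a : W} (hl : G.Extends τ l) (hM : G.SepSides τ P M)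
  (hcut : G.cut M ≤ G.sideCut τ P) (hPa : P a)

include hl hM in
theorem Extends.pushTo : G.Extends τ (pushTo l P M a) := by
  intro v hv y hy
  have h := hl v hv y hy
  unfold ArcGraph.pushTo
  rw [if_neg, h]
  rintro ⟨h1, h2⟩
  exact hM.2 v ⟨hv, y, hy, h ▸ h2⟩ h1

include hPa in
theorem side_pushTo : {v | P (pushTo l P M a v)} = {v | P (l v)} ∪ M := by
  ext v
  simp only [pushTo, Set.mem_ofPred_eq, Set.mem_union]
  by_cases h1 : v ∈ M <;> by_cases h2 : P (l v) <;> simp [h1, h2, hPa]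

include hl hM hcut in
/-- Splits whose boundary lies on either side of `P` do not gain from a push. -/
theorem cut_pushTo {Q : W → Prop} (hQ : (∀ z, P z → (Q z ↔ Q a)) ∨ ∀ z, ¬ P z → (Q z ↔ Q a)) :
    G.cut {v | Q (pushTo l P M a v)} ≤ G.cut {v | Q (l v)} := by
  rcases hQ with hQ | hQ
  · have hc : ∀ f : ℕ → W, G.cut {v | ¬ (Q (f v) ↔ Q a)} = G.cut {v | Q (f v)} := by
      intro f
      by_cases h : Q a
      · simp only [h, iff_true]; exact G.cut_compl _
      · simp only [h, iff_false, not_not]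
    rw [← hc, ← hc l]
    have h1 : {v | ¬ (Q (pushTo l P M a v) ↔ Q a)} = {v | ¬ (Q (l v) ↔ Q a)} \ M := by
      ext v
      simp only [pushTo, Set.mem_ofPred_eq, Set.mem_sdiff]
      by_cases h1 : v ∈ M <;> by_cases h2 : P (l v) <;> simp [h1, h2, hQ]
    rw [h1]
    have h2 := G.cut_posimod {v | ¬ (Q (l v) ↔ Q a)} M
    have hs := hl.sepSides P
    have h3 : G.sideCut τ P ≤ G.cut (M \ {v | ¬ (Q (l v) ↔ Q a)}) := by
      refine mincut_le ⟨fun v hv => ⟨hM.1 hv, fun h => h (hQ _ (hs.1 hv))⟩, fun v hv h => ?_⟩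
      exact hM.2 v hv h.1
    omega
  · refine le_of_eq (congrArg G.cut ?_)
    ext v
    simp only [pushTo, Set.mem_ofPred_eq]
    by_cases h1 : v ∈ M <;> by_cases h2 : P (l v) <;> simp [h1, h2, hQ]

end Push

/-- Pushing towards the end `d` of an edge of the tree does not increase any cut. -/
theorem cut_pushTo_edge (hS : S.IsTree) {x : ℕ} (hx : x < S.t) {d e : W}
    (he : S.Edge x d e ∨ S.Edge x e d) {M : Set ℕ} (hl : G.Extends τ l)
    (hM : G.SepSides τ (fun y => S.σ x y ↔ S.σ x d) M)
    (hcut : G.cut M ≤ G.sideCut τ (S.σ x)) {y : ℕ} (hy : y < S.t) :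
    G.cut {v | S.σ y (pushTo l (fun z => S.σ x z ↔ S.σ x d) M d v)} ≤ G.cut {v | S.σ y (l v)} := by
  rw [← sideCut_iff d] at hcut
  refine cut_pushTo hl hM hcut ?_
  by_cases hxy : x = y
  · subst hxy; exact Or.inl fun z hz => hz
  rcases he with he | he
  · have := hS.cross x hx y hy hxy d e he
    simpa only [he.1, iff_true] using this
  · have := hS.cross x hx y hy hxy e d he
    rw [he.2.2 y hy (Ne.symm hxy)] at this
    simp only [he.2.1, iff_false, not_not]
    exact this.symm

/-- The sum of the minimum cuts for all splits is the cost of some labelling by nodes of the tree: in a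
labelling of minimum cost, all cuts are minimum, since otherwise a minimum cut could be pushed to one
end of the edge and its complement to the other. -/
theorem exists_labelCost_le [Nonempty W] (hS : S.IsTree) (τ : ℕ → Option W) :
    ∃ l, G.Extends τ l ∧ G.labelCost S l ≤ G.bound S τ := by
  have hne : ∃ k l, G.Extends τ l ∧ G.labelCost S l = k :=
    ⟨_, fun v => (τ v).getD (Classical.arbitrary W), fun v _ y h => by simp [h], rfl⟩
  obtain ⟨l, hl, hk⟩ := Nat.find_spec hne
  refine ⟨l, hl, sum_le_sum fun x hx => ?_⟩
  have hxt := mem_range.1 hx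
  obtain ⟨M, hM, hc⟩ := G.exists_sideCut τ (S.σ x)
  rcases hS.edge x hxt with htriv | ⟨a, b, hab⟩
  · have h0 : G.cut {v | S.σ x (l v)} = 0 := by
      refine sum_eq_zero fun c _ => if_neg ?_
      rintro ⟨h1, h2⟩
      exact h2 ((htriv _ _).1 h1)
    rw [h0]; exact Nat.zero_le _
  -- Pushing `M` to `a` and its complement to `b` turns the cut of the split `x` into `M`.
  have ha : S.σ x a := hab.1
  have hb : ¬ S.σ x b := hab.2.1
  have hMa : G.SepSides τ (fun y => S.σ x y ↔ S.σ x a) M := by simpa only [ha, iff_true] using hM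
  set l₁ := pushTo l (fun y => S.σ x y ↔ S.σ x a) M a with hl₁
  have hext₁ : G.Extends τ l₁ := hl.pushTo hMa
  have hMb : G.SepSides τ (fun y => S.σ x y ↔ S.σ x b) Mᶜ := by
    simp only [SepSides, hb, iff_false, not_not]
    exact hM.compl
  have hext₂ : G.Extends τ (pushTo l₁ (fun y => S.σ x y ↔ S.σ x b) Mᶜ b) := hext₁.pushTo hMb
  have hle : ∀ y < S.t, G.cut {v | S.σ y (pushTo l₁ (fun y => S.σ x y ↔ S.σ x b) Mᶜ b v)} ≤
      G.cut {v | S.σ y (l v)} := fun y hy =>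
    (cut_pushTo_edge hS hxt (Or.inr hab) hext₁ hMb (by rw [cut_compl, hc]) hy).trans
      (cut_pushTo_edge hS hxt (Or.inl hab) hl hMa hc.le hy)
  have hxcut : G.cut {v | S.σ x (pushTo l₁ (fun y => S.σ x y ↔ S.σ x b) Mᶜ b v)} =
      G.sideCut τ (S.σ x) := by
    have h1 := side_pushTo (l := l₁) (M := Mᶜ) (P := fun y => S.σ x y ↔ S.σ x b) (a := b) Iff.rfl
    have h2 := side_pushTo (l := l) (M := M) (P := fun y => S.σ x y ↔ S.σ x a) (a := a) Iff.rfl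
    rw [← hl₁] at h2
    simp only [ha, hb, iff_true, iff_false] at h1 h2 ⊢
    rw [← hc]
    refine G.cut_congr fun v _ => ?_
    have h3 := Set.ext_iff.1 h1 v
    have h4 := Set.ext_iff.1 h2 v
    simp only [Set.mem_union, Set.mem_ofPred_eq, Set.mem_compl_iff] at h3 h4 ⊢
    tauto
  have hmin : G.labelCost S l ≤ _ := hk.trans_le (Nat.find_min' hne ⟨_, hext₂, rfl⟩)
  rw [← hxcut]
  by_contra hlt
  exact absurd hmin (not_le.2 (sum_lt_sum (fun y hy => hle y (mem_range.1 hy))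
    ⟨x, hx, not_le.1 hlt⟩))

/-! ### Persistence -/

/-- The partial labelling that assigns `d` to the vertices in `X` and agrees with `τ` elsewhere. -/
noncomputable def assign (τ : ℕ → Option W) (X : Set ℕ) (d : W) (v : ℕ) : Option W :=
  if v ∈ X then some d else τ v

/-- The vertices in `X` are unlabelled and for every split they belong to a minimum cut on the side
of `d`. -/
def Persistent (G : ArcGraph) (S : Splits W) (τ : ℕ → Option W) (d : W) (X : Set ℕ) : Prop :=
  (∀ v ∈ X, τ v = none) ∧ ∀ x < S.t, ∃ M, G.SepSides τ (fun y => S.σ x y ↔ S.σ x d) M ∧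
    G.cut M ≤ G.sideCut τ (S.σ x) ∧ X ⊆ M

theorem terms_assign {X : Set ℕ} {d : W} (hX : ∀ v ∈ X, τ v = none) (P : W → Prop) :
    G.terms τ P ⊆ G.terms (assign τ X d) P := by
  rintro v ⟨hv, y, hy, hP⟩
  refine ⟨hv, y, ?_, hP⟩
  rw [assign, if_neg, hy]
  intro h
  rw [hX v h] at hy
  cases hy

theorem sideCut_le_assign {X : Set ℕ} {d : W} (hX : ∀ v ∈ X, τ v = none) (P : W → Prop) :
    G.sideCut τ P ≤ G.sideCut (assign τ X d) P :=
  mincut_mono (terms_assign hX P) (terms_assign hX _) terms_disjoint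

/-- Fixing a persistent set leaves all minimum cuts unchanged. -/
theorem Persistent.sideCut {d : W} {X : Set ℕ} (h : G.Persistent S τ d X) {x : ℕ} (hx : x < S.t) :
    G.sideCut (assign τ X d) (S.σ x) = G.sideCut τ (S.σ x) := by
  refine le_antisymm ?_ (sideCut_le_assign h.1 _)
  obtain ⟨M, hM, hc, hXM⟩ := h.2 x hx
  refine le_trans ?_ hc
  rw [← sideCut_iff d]
  refine mincut_le ⟨?_, ?_⟩
  · rintro v ⟨hv, y, hy, hP⟩
    by_cases hvX : v ∈ X
    · exact hXM hvX
    · rw [assign, if_neg hvX] at hy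
      exact hM.1 ⟨hv, y, hy, hP⟩
  · rintro v ⟨hv, y, hy, hP⟩
    by_cases hvX : v ∈ X
    · rw [assign, if_pos hvX, Option.some_inj] at hy
      exact absurd (by rw [hy]) hP
    · rw [assign, if_neg hvX] at hy
      exact hM.2 v ⟨hv, y, hy, hP⟩

/-- A persistent set can be fixed without making any labelling more expensive: push the minimum cuts
of all edges at `d` towards `d`. -/
theorem Persistent.exists_extends (hS : S.IsTree) {d : W} {X : Set ℕ} (h : G.Persistent S τ d X)
    (hl : G.Extends τ l) : ∃ l', G.Extends (assign τ X d) l' ∧ G.labelCost S l' ≤ G.labelCost S l ∧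
      ∀ v, l' v = l v ∨ l' v = d := by
  have key : ∀ k ≤ S.t, ∃ l', G.Extends τ l' ∧ (∀ y < S.t, G.cut {v | S.σ y (l' v)} ≤
      G.cut {v | S.σ y (l v)}) ∧ (∀ v, l' v = l v ∨ l' v = d) ∧
      ∀ x < k, (∃ e, S.Edge x d e ∨ S.Edge x e d) → ∀ v ∈ X, (S.σ x (l' v) ↔ S.σ x d) := by
    intro k
    induction k with
    | zero => exact fun _ => ⟨l, hl, fun y _ => le_rfl, fun v => Or.inl rfl, fun x hx => by omega⟩
    | succ k ih =>
      intro hk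
      obtain ⟨l', h1, h2, h3, h4⟩ := ih (by omega)
      by_cases hinc : ∃ e, S.Edge k d e ∨ S.Edge k e d
      · obtain ⟨e, he⟩ := hinc
        obtain ⟨M, hM, hc, hXM⟩ := h.2 k (by omega)
        refine ⟨pushTo l' (fun z => S.σ k z ↔ S.σ k d) M d, h1.pushTo hM,
          fun y hy => (cut_pushTo_edge hS (by omega) he h1 hM hc hy).trans (h2 y hy), ?_, ?_⟩
        · intro v
          unfold ArcGraph.pushTo
          split_ifs
          · exact Or.inr rfl
          · exact h3 v
        · intro x hx hinc v hv
          unfold ArcGraph.pushTo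
          split_ifs with hif
          · exact Iff.rfl
          · by_cases hxk : x = k
            · subst hxk
              by_contra hne
              exact hif ⟨hXM hv, hne⟩
            · exact h4 x (by omega) hinc v hv
      · refine ⟨l', h1, h2, h3, fun x hx hinc' v hv => ?_⟩
        by_cases hxk : x = k
        · subst hxk; exact absurd hinc' hinc
        · exact h4 x (by omega) hinc' v hv
  obtain ⟨l', h1, h2, h3, h4⟩ := key S.t le_rfl
  refine ⟨l', ?_, sum_le_sum fun x hx => h2 x (mem_range.1 hx), h3⟩
  intro v hv y hy
  by_cases hvX : v ∈ X
  · rw [assign, if_pos hvX, Option.some_inj] at hy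
    rw [← hy]
    by_contra hne
    obtain ⟨x, hx, hinc, hsep⟩ := hS.incident d (l' v) (Ne.symm hne)
    exact hsep (h4 x hx hinc v hvX).symm
  · rw [assign, if_neg hvX] at hy
    exact h1 v hv y hy

/-- If the vertex `v` belongs to no minimum cut on the side of `d`, then assigning `d` to `v`
increases the minimum cut. -/
theorem sideCut_lt_assign {v x : ℕ} {d : W} (hv : v < G.n) (hτ : τ v = none)
    (hZ : ∀ X, G.SepSides τ (fun y => S.σ x y ↔ S.σ x d) X → G.cut X ≤ G.sideCut τ (S.σ x) →
      v ∉ X) : G.sideCut τ (S.σ x) < G.sideCut (assign τ {v} d) (S.σ x) := by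
  obtain ⟨X, hX, hc⟩ := G.exists_sideCut (assign τ {v} d) (fun y => S.σ x y ↔ S.σ x d)
  rw [sideCut_iff] at hc
  rw [← hc]
  by_contra hle
  have hnone : ∀ u ∈ ({v} : Set ℕ), τ u = none := by rintro u rfl; exact hτ
  refine hZ X ⟨(terms_assign hnone _).trans hX.1, fun u hu => hX.2 u (terms_assign hnone _ hu)⟩
    (not_lt.1 hle) (hX.1 ⟨hv, d, ?_, Iff.rfl⟩)
  simp [assign]

end ArcGraph

end

/-! ### The minimum cut routine -/

namespace ZeroExt

open Imp

/-- The variables of the program. -/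
inductive Var where
  | ans | n | m | M | t | k | q | v | c | e | u | go | val | xo | side | x | i | p | sp | w | y | z
deriving DecidableEq

/-- The arrays of the program. -/
inductive Arr where
  | inp | tl | rv | fst | nxt | tau | bl | cls | d | pt | mk | r | ok | stk | dg | sm | off | ix
deriving DecidableEq

abbrev Expr := AExp Var Arr
abbrev Cmd := Com Var Arr
abbrev Mem := Store Var Arr

instance : Coe Var Expr := ⟨AExp.var⟩

/-- The entry of the array `X` at an index. -/
abbrev Arr.at (X : Arr) (e : Expr) : Expr := .get X e

/-- The head of an arc. -/
abbrev hdE (e : Expr) : Expr := Arr.tl.at (Arr.rv.at e)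

infix:62 " ≔ " => Com.assign

/-- Classify the vertices: 1 for sources, 2 for sinks, 0 for all others. The sources are the vertices
whose label is on the side `side` of the split that is stored from the position `xo` onwards. -/
def classify : Cmd :=
  .for .v Var.n
    (.ite (.eq (Arr.tau.at Var.v) 0)
      (.store .cls Var.v 0 ;; .store .d Var.v 1 ;; .store .mk Var.v 0)
      (.ite (.eq (Arr.bl.at ((Var.xo : Expr) + (Arr.tau.at Var.v - 1))) Var.side)
        (.store .cls Var.v 1 ;; .store .d Var.v ((Var.n : Expr) + 2) ;; .store .mk Var.v 0)
        (.store .cls Var.v 2 ;; .store .d Var.v 0 ;; .store .mk Var.v 1)) ;;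
      .store .pt Var.v (Arr.fst.at Var.v))

/-- Saturate the arcs out of the sources. -/
def saturate : Cmd :=
  .for .c Var.M
    (.ite (.eq (Arr.cls.at (Arr.tl.at Var.c)) 1)
      (.ite (.eq (Arr.cls.at (hdE Var.c)) 1) (.store .r Var.c 1) (.store .r Var.c 0))
      (.ite (.eq (Arr.cls.at (hdE Var.c)) 1) (.store .r Var.c 2) (.store .r Var.c 1)))

/-- One operation of the push-relabel method at the vertex `u`. -/
def pushRelabel : Cmd :=
  .e ≔ Arr.pt.at Var.u ;;
  .ite (.lt Var.e Var.M)
    (.ite (.and (.lt 0 (Arr.r.at Var.e)) (.eq (Arr.d.at Var.u) (Arr.d.at (hdE Var.e) + 1)))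
      (.store .r Var.e (Arr.r.at Var.e - 1) ;;
        .store .r (Arr.rv.at Var.e) (Arr.r.at (Arr.rv.at Var.e) + 1) ;;
        .u ≔ hdE Var.e)
      (.store .pt Var.u (Arr.nxt.at Var.e)))
    (.store .d Var.u (Arr.d.at Var.u + 1) ;; .store .pt Var.u (Arr.fst.at Var.u))

/-- Move a unit of excess from `u` until it arrives in a sink or is abandoned. -/
def walk : Cmd :=
  .while (.and (.lt 0 (Arr.d.at Var.u)) (.lt (Arr.d.at Var.u) ((Var.n : Expr) + 2))) pushRelabel

/-- Move all units of excess. -/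
def discharge : Cmd :=
  .for .c Var.M
    (.ite (.eq (Arr.cls.at (Arr.tl.at Var.c)) 1)
      (.ite (.eq (Arr.cls.at (hdE Var.c)) 1) .skip (.u ≔ hdE Var.c ;; walk)) .skip)

/-- Mark the vertices from which a sink can be reached along residual arcs. -/
def mark : Cmd :=
  .go ≔ 1 ;;
  .while Var.go
    (.go ≔ 0 ;;
      .for .c Var.M
        (.ite (.and (.lt 0 (Arr.r.at Var.c)) (.and (.eq (Arr.mk.at (hdE Var.c)) 1)
            (.eq (Arr.mk.at (Arr.tl.at Var.c)) 0)))
          (.store .mk (Arr.tl.at Var.c) 1 ;; .go ≔ 1) .skip))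

/-- Count the arcs that enter the set of marked vertices. -/
def count : Cmd :=
  .val ≔ 0 ;;
  .for .c Var.M
    (.ite (.and (.eq (Arr.mk.at (Arr.tl.at Var.c)) 0) (.eq (Arr.mk.at (hdE Var.c)) 1))
      (.val ≔ (Var.val : Expr) + 1) .skip)

def minCut : Cmd := classify ;; saturate ;; discharge ;; mark ;; count

/-- The memory holds the graph `G`; the list of the arcs out of a vertex is linked in increasing
order. -/
structure GraphOK (G : ArcGraph) (s : Mem) : Prop where
  n : s.v .n = G.n
  M : s.v .M = G.M
  tl : s.a .tl = G.tl
  rv : s.a .rv = G.rv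
  fst_le : ∀ c < G.M, s.a .fst (G.tl c) ≤ c
  fst_tl : ∀ v < G.n, s.a .fst v < G.M → G.tl (s.a .fst v) = v
  nxt_gt : ∀ c < G.M, c < s.a .nxt c
  nxt_skip : ∀ c < G.M, ∀ e < G.M, c < e → e < s.a .nxt c → G.tl e ≠ G.tl c
  nxt_tl : ∀ c < G.M, s.a .nxt c < G.M → G.tl (s.a .nxt c) = G.tl c

theorem GraphOK.frame {G : ArcGraph} {s s' : Mem} {P : Cmd} (h : GraphOK G s) (hf : Frame P s s')
    (hP : (P.wv .n || P.wv .M || P.wa .tl || P.wa .rv || P.wa .fst || P.wa .nxt) = false) :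
    GraphOK G s' := by
  simp only [Bool.or_eq_false_iff] at hP
  obtain ⟨⟨⟨⟨⟨h1, h2⟩, h3⟩, h4⟩, h5⟩, h6⟩ := hP
  constructor
  · rw [hf.1 _ h1, h.n]
  · rw [hf.1 _ h2, h.M]
  · rw [hf.2 _ h3, h.tl]
  · rw [hf.2 _ h4, h.rv]
  · rw [hf.2 _ h5]; exact h.fst_le
  · rw [hf.2 _ h5]; exact h.fst_tl
  · rw [hf.2 _ h6]; exact h.nxt_gt
  · rw [hf.2 _ h6]; exact h.nxt_skip
  · rw [hf.2 _ h6]; exact h.nxt_tl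

/-- The class of the vertex `v`. -/
def cls (s : Mem) (v : ℕ) : ℕ :=
  if s.a .tau v = 0 then 0
  else if s.a .bl (s.v .xo + (s.a .tau v - 1)) = s.v .side then 1 else 2

variable {G : ArcGraph}

theorem tri_classify {s : Mem} (hG : GraphOK G s) :
    Tri classify s fun k s' => k ≤ 2 + G.n * 12 ∧ ∀ v < G.n, s'.a .cls v = cls s v ∧
      s'.a .d v = (if cls s v = 1 then G.n + 2 else if cls s v = 2 then 0 else 1) ∧
      s'.a .mk v = (if cls s v = 2 then 1 else 0) ∧ s'.a .pt v = s.a .fst v := by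
  refine tri_for (I := fun i s' => ∀ v < i, s'.a .cls v = cls s v ∧
      s'.a .d v = (if cls s v = 1 then G.n + 2 else if cls s v = 2 then 0 else 1) ∧
      s'.a .mk v = (if cls s v = 2 then 1 else 0) ∧ s'.a .pt v = s.a .fst v) G.n 10 ?_ ?_ ?_ ?_
  · intro i s' _ _ hf _
    rw [AExp.eval_var, hf.1 .n rfl, hG.n]
  · intro v hv; omega
  · intro i s' hi hv hf hI
    have h1 : s'.a .tau = s.a .tau := hf.2 .tau rfl
    have h2 : s'.a .bl = s.a .bl := hf.2 .bl rfl
    have h3 : s'.v .xo = s.v .xo := hf.1 .xo rfl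
    have h4 : s'.v .side = s.v .side := hf.1 .side rfl
    have h5 : s'.a .fst = s.a .fst := hf.2 .fst rfl
    have h6 : s'.v .n = G.n := (hf.1 .n rfl).trans hG.n
    simp [hv, h1, h2, h3, h4, h5, h6]
    refine ⟨fun hc v hvi => ?_, fun hc => ⟨fun hc' v hvi => ?_, fun hc' v hvi => ?_⟩⟩ <;>
      rcases Nat.lt_or_eq_of_le hvi with hlt | rfl
    · simpa [Function.update_apply, hlt.ne] using hI v hlt
    · simp [cls, hc]
    · simpa [Function.update_apply, hlt.ne] using hI v hlt
    · simp [cls, hc, hc']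
    · simpa [Function.update_apply, hlt.ne] using hI v hlt
    · simp [cls, hc, hc']
  · intro k s' hf hI hv hk
    exact ⟨by omega, hI⟩

theorem tri_saturate {s : Mem} (hG : GraphOK G s) :
    Tri saturate s fun k s' => k ≤ 2 + G.M * 6 ∧ ∀ c < G.M, s'.a .r c =
      if s.a .cls (G.tl c) = 1 then (if s.a .cls (G.hd c) = 1 then 1 else 0)
      else if s.a .cls (G.hd c) = 1 then 2 else 1 := by
  refine tri_for (I := fun i s' => ∀ c < i, s'.a .r c =
      if s.a .cls (G.tl c) = 1 then (if s.a .cls (G.hd c) = 1 then 1 else 0)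
      else if s.a .cls (G.hd c) = 1 then 2 else 1) G.M 4 ?_ ?_ ?_ ?_
  · intro i s' _ _ hf _
    rw [AExp.eval_var, hf.1 .M rfl, hG.M]
  · intro v hv; omega
  · intro i s' hi hv hf hI
    have h1 : s'.a .cls = s.a .cls := hf.2 .cls rfl
    have hG' := hG.frame hf rfl
    have h7 : G.tl (G.rv i) = G.hd i := rfl
    simp [hv, h1, hG'.tl, hG'.rv, h7]
    refine ⟨fun hc => ⟨fun hc' c hci => ?_, fun hc' c hci => ?_⟩,
      fun hc => ⟨fun hc' c hci => ?_, fun hc' c hci => ?_⟩⟩ <;>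
      rcases Nat.lt_or_eq_of_le hci with hlt | rfl
    · simpa [Function.update_apply, hlt.ne] using hI c hlt
    · simp [hc, hc']
    · simpa [Function.update_apply, hlt.ne] using hI c hlt
    · simp [hc, hc']
    · simpa [Function.update_apply, hlt.ne] using hI c hlt
    · simp [hc, hc']
    · simpa [Function.update_apply, hlt.ne] using hI c hlt
    · simp [hc, hc']
  · intro k s' hf hI hv hk
    exact ⟨by omega, hI⟩

/-- The pointers of the push-relabel method point to arcs with the right tails. -/
def PtrOK (G : ArcGraph) (pt : ℕ → ℕ) : Prop := ∀ v < G.n, pt v < G.M → G.tl (pt v) = v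

/-- The state of the push-relabel method while a unit of excess moves from `u`. -/
def WalkInv (G : ArcGraph) (A B : Set ℕ) (w : ℕ → ℕ) (s : Mem) : Prop :=
  G.PushState A B (s.a .r) (s.a .d) (s.a .pt) (fun v => w v + if v = s.v .u then 1 else 0) ∧
    PtrOK G (s.a .pt) ∧ ∃ c < G.M, G.tl c = s.v .u

theorem tri_pushRelabel {A B : Set ℕ} {w : ℕ → ℕ} {s : Mem} (hG : GraphOK G s)
    (hI : WalkInv G A B w s) (hpos : 0 < s.a .d (s.v .u)) (hlt : s.a .d (s.v .u) < G.n + 2) :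
    Tri pushRelabel s fun k s' => k ≤ 6 ∧ WalkInv G A B w s' ∧
      G.pot (s'.a .r) (s'.a .d) (s'.a .pt) < G.pot (s.a .r) (s.a .d) (s.a .pt) := by
  obtain ⟨hP, hpt, c₀, hc₀, hu⟩ := hI
  have hun : s.v .u < G.n := hu ▸ G.tl_lt c₀ hc₀
  have hhd : ∀ c, G.tl (G.rv c) = G.hd c := fun _ => rfl
  simp [pushRelabel, hG.M, hG.tl, hG.rv, hhd]
  refine ⟨fun hlt' => ⟨fun hr hd => ?_, fun hnad => ?_⟩, fun hge => ?_⟩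
  · have htl := hpt _ hun hlt'
    obtain ⟨h1, h2⟩ := hP.push hlt' htl (Nat.pos_of_ne_zero hr) hd hlt
    have h3 : Function.update (Function.update (s.a .r) (s.a .pt (s.v .u))
        (s.a .r (s.a .pt (s.v .u)) - 1)) (G.rv (s.a .pt (s.v .u)))
        (Function.update (s.a .r) (s.a .pt (s.v .u)) (s.a .r (s.a .pt (s.v .u)) - 1)
          (G.rv (s.a .pt (s.v .u))) + 1) = G.pushArc (s.a .r) (s.a .pt (s.v .u)) := by
      rw [Function.update_of_ne (G.rv_ne hlt')]; rfl
    rw [h3]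
    refine ⟨⟨?_, ?_, ?_⟩, h2⟩
    · simp
      rw [h3]
      exact h1
    · simpa using hpt
    · exact ⟨_, G.rv_lt _ hlt', by simp [hhd]⟩
  · have htl := hpt _ hun hlt'
    obtain ⟨h1, h2⟩ := hP.advance hlt' htl (fun h => hnad h.1.ne' h.2) (hG.nxt_gt _ hlt')
      (fun c hc h1 h2 => by
        have := hG.nxt_skip _ hlt' c hc h1 h2
        rwa [htl] at this)
    refine ⟨⟨by simpa using h1, ?_, c₀, hc₀, by simpa using hu⟩, h2⟩
    intro v hv hvM
    by_cases hvu : v = s.v .u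
    · subst hvu
      simp at hvM ⊢
      rw [hG.nxt_tl _ hlt' hvM, htl]
    · simp [hvu] at hvM ⊢
      exact hpt v hv hvM
  · obtain ⟨h1, h2⟩ := hP.relabel hpos hlt hge hc₀ hu (f := s.a .fst (s.v .u))
      (fun c hc h => h ▸ hG.fst_le c hc)
    refine ⟨⟨by simpa using h1, ?_, c₀, hc₀, by simpa using hu⟩, h2⟩
    intro v hv hvM
    by_cases hvu : v = s.v .u
    · subst hvu
      simp at hvM ⊢
      exact hG.fst_tl _ hv hvM
    · simp [hvu] at hvM ⊢
      exact hpt v hv hvM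

theorem tri_walk {A B : Set ℕ} {w : ℕ → ℕ} {s : Mem} (hG : GraphOK G s)
    (hI : WalkInv G A B w s) :
    Tri walk s fun k s' => PtrOK G (s'.a .pt) ∧
      G.PushState A B (s'.a .r) (s'.a .d) (s'.a .pt) w ∧
      k + 7 * G.pot (s'.a .r) (s'.a .d) (s'.a .pt) ≤
        1 + 7 * G.pot (s.a .r) (s.a .d) (s.a .pt) := by
  refine tri_while (WalkInv G A B w) (fun s => 7 * G.pot (s.a .r) (s.a .d) (s.a .pt)) hI ?_ ?_
  · intro s' hf hI' hc
    have hG' := hG.frame (P := walk) hf rfl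
    simp [hG'.n] at hc
    refine (tri_pushRelabel hG' hI' (Nat.pos_of_ne_zero hc.1) hc.2).mono ?_
    rintro k s'' - ⟨h1, h2, h3⟩
    exact ⟨h2, by omega⟩
  · intro k s' hf hI' hc hk
    have hG' := hG.frame (P := walk) hf rfl
    simp [hG'.n] at hc
    obtain ⟨hP, hpt, c₀, hc₀, hu⟩ := hI'
    refine ⟨hpt, hP.drop (hu ▸ G.tl_lt c₀ hc₀) ?_, hk⟩
    change _ ∨ G.n + 2 ≤ _
    omega

theorem tri_discharge {A B : Set ℕ} {s : Mem} (hG : GraphOK G s)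
    (hA : ∀ v < G.n, s.a .cls v = 1 ↔ v ∈ A) (hpt : PtrOK G (s.a .pt))
    (hP : G.PushState A B (s.a .r) (s.a .d) (s.a .pt) (G.pending A 0)) :
    Tri discharge s fun k s' => G.PushState A B (s'.a .r) (s'.a .d) (s'.a .pt) (G.pending A G.M) ∧
      k ≤ 2 + G.M * 6 + 7 * (G.M * (6 * G.n + 30)) := by
  refine tri_for_pot (I := fun i s' =>
    G.PushState A B (s'.a .r) (s'.a .d) (s'.a .pt) (G.pending A i) ∧ PtrOK G (s'.a .pt))
    (pot := fun s => 7 * G.pot (s.a .r) (s.a .d) (s.a .pt)) G.M 4 ?_ ?_ ?_ ?_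
  · intro i s' _ _ hf _
    rw [AExp.eval_var, hf.1 .M rfl, hG.M]
  · exact ⟨hP, hpt⟩
  · rintro i s' hi hv hf ⟨hP', hpt'⟩
    have hG' := hG.frame (P := discharge) hf rfl
    have hrv : G.tl (G.rv i) = G.hd i := rfl
    have h1 : s'.a .cls = s.a .cls := hf.2 .cls rfl
    simp [hv, hG'.tl, hG'.rv, hrv, h1, hA _ (G.tl_lt i hi), hA _ (G.hd_lt hi)]
    have hsucc := ArcGraph.pending_succ (G := G) (A := A) hi
    have hsame : ¬ (G.tl i ∈ A ∧ G.hd i ∉ A) → G.pending A i = G.pending A (i + 1) := by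
      intro h
      funext v
      rw [hsucc, if_neg fun h' => h ⟨h'.1, h'.2.1⟩, add_zero]
    refine ⟨fun htl => ⟨fun hhd => ?_, fun hhd => ?_⟩, fun htl => ?_⟩
    · rw [← hsame fun h => h.2 hhd]
      exact ⟨hP', hpt'⟩
    · have hw : WalkInv G A B (G.pending A (i + 1)) (s'.setV .u (G.hd i)) := by
        refine ⟨?_, hpt', G.rv i, G.rv_lt i hi, by simpa using hrv⟩
        have : (G.pending A i) = fun v => G.pending A (i + 1) v +
            if v = (s'.setV .u (G.hd i)).v .u then 1 else 0 := by
          funext v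
          rw [hsucc]
          simp [htl, hhd]
        rw [← this]
        exact hP'
      have hGu : GraphOK G (s'.setV .u (G.hd i)) :=
        hG'.frame (P := .assign .u 0) ⟨fun a ha => by simp [Com.wv] at ha; simp [ha],
          fun _ _ => rfl⟩ rfl
      refine (tri_walk hGu hw).mono ?_
      rintro k s'' hf'' ⟨h1, h2, h3⟩
      have h4 : s''.v .c = i := by rw [hf''.1 .c rfl]; simpa using hv
      refine ⟨h4, ?_, h2, h1⟩
      simp at h3
      omega
    · rw [← hsame fun h => htl h.1]
      exact ⟨hP', hpt'⟩
  · rintro k s' hf ⟨hP', hpt'⟩ hv hk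
    refine ⟨hP', ?_⟩
    have := ArcGraph.pot_le (d := s.a .d) (pt := s.a .pt) hP.res
    simp only [Store.setV_a] at hk
    omega

/-- The set of the marked vertices. -/
def marked (G : ArcGraph) (mk : ℕ → ℕ) : Set ℕ := {v | v < G.n ∧ mk v = 1}

/-- No residual arc enters the set `Y`. -/
def ResClosed (G : ArcGraph) (r : ℕ → ℕ) (Y : Set ℕ) : Prop :=
  ∀ c < G.M, G.hd c ∈ Y → 0 < r c → G.tl c ∈ Y

/-- The marked vertices include those in `B` and can reach `B` along residual arcs. -/
def MarkInv (G : ArcGraph) (r : ℕ → ℕ) (B : Set ℕ) (mk : ℕ → ℕ) : Prop :=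
  (∀ v < G.n, mk v = 0 ∨ mk v = 1) ∧ B ⊆ marked G mk ∧
    ∀ Y, B ⊆ Y → ResClosed G r Y → marked G mk ⊆ Y

/-- The number of vertices that are not marked. -/
def unmarked (G : ArcGraph) (mk : ℕ → ℕ) : ℕ := ((Finset.range G.n).filter fun v => mk v = 0).card

theorem MarkInv.step {r mk : ℕ → ℕ} {B : Set ℕ} (h : MarkInv G r B mk) {c : ℕ} (hc : c < G.M)
    (hr : 0 < r c) (hhd : mk (G.hd c) = 1) (htl : mk (G.tl c) = 0) :
    MarkInv G r B (Function.update mk (G.tl c) 1) ∧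
      unmarked G (Function.update mk (G.tl c) 1) + 1 ≤ unmarked G mk := by
  have hsub : marked G (Function.update mk (G.tl c) 1) ⊆ insert (G.tl c) (marked G mk) := by
    rintro v ⟨hv, hm⟩
    by_cases h1 : v = G.tl c
    · exact Or.inl h1
    · rw [Function.update_of_ne h1] at hm
      exact Or.inr ⟨hv, hm⟩
  refine ⟨⟨fun v hv => ?_, fun v hv => ?_, fun Y hB hY => ?_⟩, ?_⟩
  · by_cases h1 : v = G.tl c
    · subst h1; simp
    · simpa [h1] using h.1 v hv
  · obtain ⟨h1, h2⟩ := h.2.1 hv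
    refine ⟨h1, ?_⟩
    by_cases h3 : v = G.tl c
    · subst h3; simp
    · simpa [h3] using h2
  · refine hsub.trans (Set.insert_subset ?_ (h.2.2 Y hB hY))
    exact hY c hc (h.2.2 Y hB hY ⟨G.hd_lt hc, hhd⟩) hr
  · refine Finset.card_lt_card (Finset.ssubset_iff_of_subset ?_ |>.2 ⟨G.tl c, ?_, ?_⟩)
    · intro v hv
      simp only [Finset.mem_filter] at hv ⊢
      refine ⟨hv.1, ?_⟩
      by_cases h3 : v = G.tl c
      · rw [h3]; exact htl
      · simpa [h3] using hv.2
    · simp [htl, G.tl_lt c hc]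
    · simp

theorem tri_mark {B : Set ℕ} {s : Mem} (hG : GraphOK G s)
    (hI : MarkInv G (s.a .r) B (s.a .mk)) :
    Tri mark s fun k s' => MarkInv G (s.a .r) B (s'.a .mk) ∧
      ResClosed G (s.a .r) (marked G (s'.a .mk)) ∧ k ≤ 2 + (G.n + 1) * (G.M * 5 + 4) := by
  refine tri_seq.2 (tri_assign.2 ?_)
  refine tri_while
    (I := fun s' => MarkInv G (s.a .r) B (s'.a .mk) ∧ s'.v .go ≤ 1 ∧
      (s'.v .go = 0 → ResClosed G (s.a .r) (marked G (s'.a .mk))))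
    (pot := fun s' => (unmarked G (s'.a .mk) + s'.v .go) * (G.M * 5 + 4)) ?_ ?_ ?_
  · exact ⟨hI, by simp, by simp⟩
  · rintro s' hf ⟨h1, h2, h3⟩ hgo
    have hr' : s'.a .r = s.a .r := hf.2 .r rfl
    have hM' : s'.v .M = G.M := (hf.1 .M rfl).trans (by simpa using hG.M)
    have htl' : s'.a .tl = G.tl := (hf.2 .tl rfl).trans hG.tl
    have hrv' : s'.a .rv = G.rv := (hf.2 .rv rfl).trans hG.rv
    simp at hgo
    refine tri_seq.2 (tri_assign.2 ?_)
    refine tri_for (I := fun i s'' => MarkInv G (s.a .r) B (s''.a .mk) ∧ s''.v .go ≤ 1 ∧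
      (s''.v .go = 0 → ∀ c < i, s''.a .mk (G.hd c) = 1 → 0 < s.a .r c → s''.a .mk (G.tl c) = 1) ∧
      unmarked G (s''.a .mk) + s''.v .go ≤ unmarked G (s'.a .mk)) G.M 3 ?_ ?_ ?_ ?_
    · intro i s'' _ _ hf' _
      rw [AExp.eval_var, hf'.1 .M rfl]
      simpa using hM'
    · exact ⟨h1, by simp, by simp, by simp⟩
    · rintro i s'' hi hv hf' ⟨i1, i2, i3, i4⟩
      have h5 : s''.a .r = s.a .r := (hf'.2 .r rfl).trans hr'
      have h6 : s''.a .tl = G.tl := (hf'.2 .tl rfl).trans htl'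
      have h7 : s''.a .rv = G.rv := (hf'.2 .rv rfl).trans hrv'
      have h8 : G.tl (G.rv i) = G.hd i := rfl
      simp [hv, h5, h6, h7, h8]
      refine ⟨fun hr hhd htl => ?_, fun hn => ⟨i1, i2, fun hgo c hc => ?_, i4⟩⟩
      · obtain ⟨j1, j2⟩ := i1.step hi (Nat.pos_of_ne_zero hr) hhd htl
        exact ⟨j1, by omega⟩
      · intro hhd hr
        rcases Nat.lt_or_eq_of_le hc with hlt | rfl
        · exact i3 hgo c hlt hhd hr
        · rcases i1.1 _ (G.tl_lt c hi) with h0 | h0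
          · exact absurd h0 (hn hr.ne' hhd)
          · exact h0
    · rintro k s'' hf' ⟨i1, i2, i3, i4⟩ hv hk
      refine ⟨⟨i1, i2, fun hgo c hc hhd hr => ⟨G.tl_lt c hc, i3 hgo c hc hhd.2 hr⟩⟩, ?_⟩
      have h5 : (unmarked G (s''.a .mk) + s''.v .go) * (G.M * 5 + 4) ≤
          unmarked G (s'.a .mk) * (G.M * 5 + 4) := Nat.mul_le_mul_right _ i4
      have h6 : (unmarked G (s'.a .mk) + 1) * (G.M * 5 + 4) ≤
          (unmarked G (s'.a .mk) + s'.v .go) * (G.M * 5 + 4) :=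
        Nat.mul_le_mul_right _ (by omega)
      rw [Nat.add_mul] at h6
      omega
  · rintro k s' hf ⟨h1, h2, h3⟩ hgo hk
    refine ⟨h1, h3 (by simpa using hgo), ?_⟩
    have h4 : unmarked G (s.a .mk) ≤ G.n := (Finset.card_filter_le _ _).trans (by simp)
    simp only [Store.setV_a, Store.setV_v, if_true, AExp.eval_one] at hk
    have h5 : (unmarked G (s.a .mk) + 1) * (G.M * 5 + 4) ≤ (G.n + 1) * (G.M * 5 + 4) :=
      Nat.mul_le_mul_right _ (by omega)
    omega

open scoped Classical in
theorem tri_count {s : Mem} (hG : GraphOK G s) (hmk : ∀ v < G.n, s.a .mk v = 0 ∨ s.a .mk v = 1) :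
    Tri count s fun k s' => s'.v .val = G.cut (marked G (s.a .mk))ᶜ ∧ k ≤ 3 + G.M * 5 := by
  refine tri_seq.2 (tri_assign.2 ?_)
  refine tri_for (I := fun i s' => s'.v .val = ∑ c ∈ Finset.range i,
    if G.tl c ∈ (marked G (s.a .mk))ᶜ ∧ G.hd c ∉ (marked G (s.a .mk))ᶜ then 1 else 0) G.M 3 ?_ ?_ ?_ ?_
  · intro i s' _ _ hf _
    rw [AExp.eval_var, hf.1 .M rfl]
    simpa using hG.M
  · simp
  · intro i s' hi hv hf hI
    have h5 : s'.a .mk = s.a .mk := hf.2 .mk rfl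
    have h6 : s'.a .tl = G.tl := (hf.2 .tl rfl).trans hG.tl
    have h7 : s'.a .rv = G.rv := (hf.2 .rv rfl).trans hG.rv
    have h8 : G.tl (G.rv i) = G.hd i := rfl
    have h1 := hmk _ (G.tl_lt i hi)
    have h2 := hmk _ (G.hd_lt hi)
    rw [Finset.sum_range_succ]
    simp [hv, h5, h6, h7, h8, marked, G.tl_lt i hi, G.hd_lt hi]
    simp [marked] at hI
    refine ⟨fun htl hhd => ?_, fun hn => ?_⟩
    · rw [if_pos ⟨by omega, hhd⟩, hI]
    · rw [if_neg, hI, add_zero]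
      rintro ⟨h3, h4⟩
      exact hn (by omega) h4
  · intro k s' hf hI hv hk
    exact ⟨by unfold ArcGraph.cut; convert hI, by omega⟩

/-- The time bound of the minimum cut routine. -/
def cutTime (G : ArcGraph) : ℕ := 400 * ((G.n + 1) * (G.M + 1))

/-- The minimum cut routine computes the size of a minimum cut between sources and sinks, and marks
the complement of the largest minimum cut. -/
theorem tri_minCut {s : Mem} (hG : GraphOK G s) {A B : Set ℕ}
    (hA : A = {v | v < G.n ∧ cls s v = 1}) (hB : B = {v | v < G.n ∧ cls s v = 2}) :
    Tri minCut s fun k s' => ∃ Z : Set ℕ, k ≤ cutTime G ∧ s'.v .val = G.mincut A B ∧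
      (∀ v < G.n, s'.a .mk v = 1 ↔ v ∈ Z) ∧ ArcGraph.Separates A B Zᶜ ∧
      G.cut Zᶜ = G.mincut A B ∧
      ∀ X, ArcGraph.Separates A B X → G.cut X ≤ G.mincut A B → ∀ v ∈ Z, v ∉ X := by
  have hA' : ∀ v < G.n, v ∈ A ↔ cls s v = 1 := by
    intro v hv; subst hA; simp [hv]
  have hB' : ∀ v < G.n, v ∈ B ↔ cls s v = 2 := by
    intro v hv; subst hB; simp [hv]
  have hAn : ∀ v ∈ A, v < G.n := by
    intro v hv; subst hA; exact hv.1
  have hBn : ∀ v ∈ B, v < G.n := by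
    intro v hv; subst hB; exact hv.1
  refine tri_seq.2 ((tri_classify hG).mono ?_)
  rintro k₁ s₁ hf₁ ⟨hk₁, h₁⟩
  have hG₁ := hG.frame hf₁ rfl
  refine tri_seq.2 ((tri_saturate hG₁).mono ?_)
  rintro k₂ s₂ hf₂ ⟨hk₂, h₂⟩
  have hG₂ := hG₁.frame hf₂ rfl
  have hcls : ∀ v < G.n, s₂.a .cls v = cls s v := by
    intro v hv; rw [hf₂.2 .cls rfl]; exact (h₁ v hv).1
  have hpt : ∀ v < G.n, s₂.a .pt v = s.a .fst v := by
    intro v hv; rw [hf₂.2 .pt rfl]; exact (h₁ v hv).2.2.2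
  have hd : ∀ v < G.n, s₂.a .d v = (if cls s v = 1 then G.n + 2 else if cls s v = 2 then 0 else 1) := by
    intro v hv; rw [hf₂.2 .d rfl]; exact (h₁ v hv).2.1
  have hmk : ∀ v < G.n, s₂.a .mk v = (if cls s v = 2 then 1 else 0) := by
    intro v hv; rw [hf₂.2 .mk rfl]; exact (h₁ v hv).2.2.1
  have hP : G.PushState A B (s₂.a .r) (s₂.a .d) (s₂.a .pt) (G.pending A 0) := by
    refine ArcGraph.PushState.start (fun c hc => ?_) (fun v hv => ?_) (fun v hv => ?_)
      (fun v hv hvA hvB => ?_) (fun c hc => ?_)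
    · rw [h₂ c hc, (h₁ _ (G.tl_lt c hc)).1, (h₁ _ (G.hd_lt hc)).1]
      simp only [hA' _ (G.tl_lt c hc), hA' _ (G.hd_lt hc)]
    · rw [hd v (hAn v hv), if_pos ((hA' v (hAn v hv)).1 hv)]; rfl
    · rw [hd v (hBn v hv), (hB' v (hBn v hv)).1 hv]; rfl
    · rw [hA' v hv] at hvA
      rw [hB' v hv] at hvB
      rw [hd v hv, if_neg hvA, if_neg hvB]
    · rw [hpt _ (G.tl_lt c hc)]; exact hG.fst_le c hc
  refine tri_seq.2 ((tri_discharge hG₂ (fun v hv => by rw [hcls v hv, hA' v hv])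
    (fun v hv hlt => ?_) hP).mono ?_)
  · rw [hpt v hv] at hlt ⊢
    exact hG.fst_tl v hv hlt
  rintro k₃ s₃ hf₃ ⟨hP₃, hk₃⟩
  have hG₃ := hG₂.frame hf₃ rfl
  have hmk₃ : marked G (s₃.a .mk) = B := by
    rw [hf₃.2 .mk rfl]
    ext v
    refine ⟨fun ⟨hv, hm⟩ => ?_, fun hv => ⟨hBn v hv, ?_⟩⟩
    · rw [hmk v hv] at hm
      rw [hB' v hv]
      by_contra hne
      simp [hne] at hm
    · rw [hmk v (hBn v hv), if_pos ((hB' v (hBn v hv)).1 hv)]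
  refine tri_seq.2 ((tri_mark hG₃ (B := B) ⟨fun v hv => ?_, hmk₃.ge, fun Y hY _ => hmk₃ ▸ hY⟩).mono ?_)
  · rw [hf₃.2 .mk rfl, hmk v hv]
    split_ifs <;> simp
  rintro k₄ s₄ hf₄ ⟨⟨hm₁, hm₂, hm₃⟩, hcl, hk₄⟩
  have hG₄ := hG₃.frame hf₄ rfl
  refine (tri_count hG₄ hm₁).mono ?_
  rintro k₅ s₅ hf₅ ⟨hval, hk₅⟩
  obtain ⟨c₁, c₂, c₃⟩ := hP₃.cut_eq (ArcGraph.pending_last A) hBn hm₂ hcl hm₃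
  refine ⟨marked G (s₄.a .mk), ?_, hval.trans c₂, fun v hv => ?_, c₁, c₂, c₃⟩
  · unfold cutTime
    nlinarith [Nat.zero_le (G.n * G.M)]
  · rw [hf₅.2 .mk rfl]
    simp [marked, hv]

end ZeroExt

/-! ### The search for a labelling -/

namespace ArcGraph

variable {G : ArcGraph} {W : Type*} {S : Splits W} {τ τ' : ℕ → Option W} {D : Set W} {q : ℕ}

/-- The partial labelling `τ` extends to a labelling by elements of `D` of cost at most `q`. -/
def Solvable (G : ArcGraph) (S : Splits W) (D : Set W) (q : ℕ) (τ : ℕ → Option W) : Prop :=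
  ∃ l, G.Extends τ l ∧ (∀ v < G.n, l v ∈ D) ∧ G.labelCost S l ≤ q

theorem Solvable.bound_le (h : G.Solvable S D q τ) : G.bound S τ ≤ q := by
  obtain ⟨l, h1, -, h2⟩ := h
  exact (ArcGraph.bound_le h1).trans h2

theorem solvable_of_total [Nonempty W] (hS : S.IsTree) (hτ : ∀ v < G.n, ∃ y ∈ D, τ v = some y)
    (hq : G.bound S τ ≤ q) : G.Solvable S D q τ := by
  obtain ⟨l, h1, h2⟩ := G.exists_labelCost_le hS τ
  refine ⟨l, h1, fun v hv => ?_, h2.trans hq⟩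
  obtain ⟨y, hy, hvy⟩ := hτ v hv
  rw [h1 v hv y hvy]; exact hy

theorem sideCut_mono (h : ∀ v < G.n, ∀ y, τ v = some y → τ' v = some y) (P : W → Prop) :
    G.sideCut τ P ≤ G.sideCut τ' P := by
  refine mincut_mono ?_ ?_ terms_disjoint <;>
  · rintro v ⟨hv, y, hy, hP⟩
    exact ⟨hv, y, h v hv y hy, hP⟩

theorem sideCut_congr (h : ∀ v < G.n, τ v = τ' v) (P : W → Prop) :
    G.sideCut τ P = G.sideCut τ' P :=
  le_antisymm (sideCut_mono (fun v hv _ hy => h v hv ▸ hy) P)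
    (sideCut_mono (fun v hv _ hy => (h v hv).symm ▸ hy) P)

theorem bound_congr (h : ∀ v < G.n, τ v = τ' v) : G.bound S τ = G.bound S τ' :=
  Finset.sum_congr rfl fun _ _ => sideCut_congr h _

theorem Solvable.mono (h : ∀ v < G.n, ∀ y, τ v = some y → τ' v = some y)
    (hs : G.Solvable S D q τ') : G.Solvable S D q τ := by
  obtain ⟨l, h1, h2⟩ := hs
  exact ⟨l, fun v hv y hy => h1 v hv y (h v hv y hy), h2⟩

theorem solvable_congr (h : ∀ v < G.n, τ v = τ' v) :
    G.Solvable S D q τ ↔ G.Solvable S D q τ' :=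
  ⟨Solvable.mono fun v hv _ hy => (h v hv).symm ▸ hy, Solvable.mono fun v hv _ hy => h v hv ▸ hy⟩

theorem le_assign {X : Set ℕ} {d : W} (hX : ∀ v ∈ X, τ v = none) (v : ℕ) (y : W)
    (hy : τ v = some y) : assign τ X d v = some y := by
  rw [assign, if_neg, hy]
  intro h
  rw [hX v h] at hy
  cases hy

theorem Persistent.solvable_iff (hS : S.IsTree) {d : W} (hd : d ∈ D) {X : Set ℕ}
    (h : G.Persistent S τ d X) : G.Solvable S D q (assign τ X d) ↔ G.Solvable S D q τ := by
  refine ⟨Solvable.mono fun v _ y => le_assign h.1 v y, ?_⟩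
  rintro ⟨l, h1, h2, h3⟩
  obtain ⟨l', e1, e2, e3⟩ := h.exists_extends hS h1
  refine ⟨l', e1, fun v hv => ?_, e2.trans h3⟩
  rcases e3 v with e | e
  · rw [e]; exact h2 v hv
  · rw [e]; exact hd

theorem solvable_branch {v : ℕ} (hv : v < G.n) (hτ : τ v = none) :
    G.Solvable S D q τ ↔ ∃ d ∈ D, G.Solvable S D q (assign τ {v} d) := by
  have hX : ∀ u ∈ ({v} : Set ℕ), τ u = none := by rintro u rfl; exact hτ
  constructor
  · rintro ⟨l, h1, h2, h3⟩
    refine ⟨l v, h2 v hv, l, fun u hu y hy => ?_, h2, h3⟩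
    by_cases huv : u = v
    · subst huv
      simpa [assign] using hy
    · rw [assign, if_neg (by simpa using huv)] at hy
      exact h1 u hu y hy
  · rintro ⟨d, -, h⟩
    exact h.mono fun u _ y => le_assign hX u y

end ArcGraph

namespace ZeroExt

open Imp ArcGraph

/-- The sum of the minimum cuts of all splits. -/
def sumCuts : Cmd :=
  .p ≔ 0 ;; .xo ≔ 0 ;; .side ≔ 1 ;;
  .for .x Var.t (minCut ;; .p ≔ ((Var.p : Expr) + Var.val) ;; .xo ≔ ((Var.xo : Expr) + Var.k))

/-- Give the label `i` to all unlabelled vertices that are, for every split, in a minimum cut on the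
side of this label. -/
def fixLabel : Cmd :=
  .for .v Var.n (.store .ok Var.v 1) ;;
  .xo ≔ 0 ;;
  .for .x Var.t
    (.side ≔ Arr.bl.at ((Var.xo : Expr) + Var.i) ;;
      minCut ;;
      .for .v Var.n (.ite (.eq (Arr.mk.at Var.v) 1) (.store .ok Var.v 0) .skip) ;;
      .xo ≔ ((Var.xo : Expr) + Var.k)) ;;
  .for .v Var.n
    (.ite (.and (.eq (Arr.tau.at Var.v) 0) (.eq (Arr.ok.at Var.v) 1))
      (.store .tau Var.v ((Var.i : Expr) + 1)) .skip)

def fixLabels : Cmd := .for .i Var.k fixLabel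

/-- Find an unlabelled vertex `w`; if there is none, `w` becomes `n`. -/
def findFree : Cmd :=
  .w ≔ Var.n ;;
  .for .v Var.n (.ite (.eq (Arr.tau.at Var.v) 0) (.w ≔ Var.v) .skip)

/-- Put the partial labellings that extend the current one to `w` on the stack. -/
def pushChildren : Cmd :=
  .for .i Var.k
    (.for .v Var.n (.store .stk ((Var.sp : Expr) + Var.v) (Arr.tau.at Var.v)) ;;
      .store .stk ((Var.sp : Expr) + Var.w) ((Var.i : Expr) + 1) ;;
      .sp ≔ ((Var.sp : Expr) + Var.n))

/-- Take a partial labelling from the stack. -/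
def pop : Cmd :=
  .sp ≔ ((Var.sp : Expr) - Var.n) ;;
  .for .v Var.n (.store .tau Var.v (Arr.stk.at ((Var.sp : Expr) + Var.v)))

/-- Fix persistent sets; then answer yes if all vertices are labelled, and branch otherwise. -/
def expand : Cmd :=
  fixLabels ;; findFree ;;
  .ite (.eq Var.w Var.n) (.ans ≔ 1 ;; .sp ≔ 0) pushChildren

/-- Process the partial labellings on the stack until it is empty; `p` is the lower bound on the cost
of an extension. -/
def search : Cmd :=
  .while Var.sp (pop ;; sumCuts ;; .ite (.lt Var.q Var.p) .skip expand)

variable {G : ArcGraph} {W : Type*} {S : Splits W} {dl : ℕ → W} {k : ℕ}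

/-- The partial labelling represented by an array: the entry is 0 for an unlabelled vertex and
`i + 1` for a vertex with the label number `i`. -/
def part (dl : ℕ → W) (a : ℕ → ℕ) (v : ℕ) : Option W :=
  if a v = 0 then none else some (dl (a v - 1))

theorem part_eq_none {a : ℕ → ℕ} {v : ℕ} : part dl a v = none ↔ a v = 0 := by
  unfold part; split_ifs <;> simp [*]

open scoped Classical in
/-- The memory holds the graph and, for every split, the sides of the labels. -/
structure Env (G : ArcGraph) (S : Splits W) (dl : ℕ → W) (k : ℕ) (s : Mem) : Prop where
  graph : GraphOK G s
  t_eq : s.v .t = S.t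
  k_eq : s.v .k = k
  bl : ∀ x < S.t, ∀ i < k, s.a .bl (x * k + i) = if S.σ x (dl i) then 1 else 0

theorem Env.frame {s s' : Mem} {P : Cmd} (h : Env G S dl k s) (hf : Frame P s s')
    (hP : (P.wv .n || P.wv .M || P.wa .tl || P.wa .rv || P.wa .fst || P.wa .nxt) = false)
    (hP' : (P.wv .t || P.wv .k || P.wa .bl) = false) : Env G S dl k s' := by
  simp only [Bool.or_eq_false_iff] at hP'
  obtain ⟨⟨h1, h2⟩, h3⟩ := hP'
  refine ⟨h.graph.frame hf hP, ?_, ?_, ?_⟩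
  · rw [hf.1 _ h1, h.t_eq]
  · rw [hf.1 _ h2, h.k_eq]
  · rw [hf.2 _ h3]; exact h.bl

theorem Env.setV {s : Mem} (h : Env G S dl k s) {a : Var}
    (ha : a ≠ .n ∧ a ≠ .M ∧ a ≠ .t ∧ a ≠ .k) {c : ℕ} : Env G S dl k (s.setV a c) := by
  refine h.frame (P := .assign a 0) ⟨fun b hb => ?_, fun _ _ => rfl⟩ ?_ ?_
  · simp [Com.wv] at hb
    simp [hb]
  · simp [Com.wv, Com.wa, ha.1.symm, ha.2.1.symm]
  · simp [Com.wv, Com.wa, ha.2.2.1.symm, ha.2.2.2.symm]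

/-- All entries of the array are 0 or numbers of labels. -/
def TauOK (G : ArcGraph) (k : ℕ) (a : ℕ → ℕ) : Prop := ∀ v < G.n, a v ≤ k

/-- The effect of `minCut` on the split that is stored from the position `xo` onwards: the unmarked
vertices are the largest minimum cut on the side of `P`. -/
theorem tri_minCut_side {s : Mem} (hE : Env G S dl k s) (hτ : TauOK G k (s.a .tau)) {P : W → Prop}
    (hP : ∀ j < k, s.a .bl (s.v .xo + j) = s.v .side ↔ P (dl j)) :
    Tri minCut s fun l s' => ∃ Z : Set ℕ, l ≤ cutTime G ∧
      s'.v .val = G.sideCut (part dl (s.a .tau)) P ∧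
      (∀ v < G.n, s'.a .mk v = 1 ↔ v ∈ Z) ∧ G.SepSides (part dl (s.a .tau)) P Zᶜ ∧
      G.cut Zᶜ = G.sideCut (part dl (s.a .tau)) P ∧
      ∀ X, G.SepSides (part dl (s.a .tau)) P X → G.cut X ≤ G.sideCut (part dl (s.a .tau)) P →
        ∀ v ∈ Z, v ∉ X := by
  have key : ∀ v < G.n, s.a .tau v ≠ 0 →
      (s.a .bl (s.v .xo + (s.a .tau v - 1)) = s.v .side ↔ P (dl (s.a .tau v - 1))) := by
    intro v hv h0
    have := hτ v hv
    exact hP _ (by omega)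
  refine tri_minCut hE.graph ?_ ?_
  · ext v
    simp only [terms, Set.mem_ofPred_eq]
    refine and_congr_right fun hv => ?_
    unfold cls part
    by_cases h0 : s.a .tau v = 0
    · simp [h0]
    · simp [h0, key v hv h0]
  · ext v
    simp only [terms, Set.mem_ofPred_eq]
    refine and_congr_right fun hv => ?_
    unfold cls part
    by_cases h0 : s.a .tau v = 0
    · simp [h0]
    · simp [h0, key v hv h0]

theorem tri_sumCuts {s : Mem} (hE : Env G S dl k s) (hτ : TauOK G k (s.a .tau)) :
    Tri sumCuts s fun l s' => s'.v .p = G.bound S (part dl (s.a .tau)) ∧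
      l ≤ 5 + S.t * (cutTime G + 2 + 2) := by
  refine tri_seq.2 (tri_assign.2 (tri_seq.2 (tri_assign.2 (tri_seq.2 (tri_assign.2 ?_)))))
  have hE₀ := ((hE.setV (a := .p) (c := 0) (by decide)).setV (a := .xo) (c := 0) (by decide)).setV
    (a := .side) (c := 1) (by decide)
  refine tri_for (I := fun x s' => s'.v .p = ∑ y ∈ Finset.range x,
    G.sideCut (part dl (s.a .tau)) (S.σ y) ∧ s'.v .xo = x * k) S.t (cutTime G + 2) ?_ ?_ ?_ ?_
  · intro i s' _ _ hf _
    exact (hE₀.frame hf rfl rfl).t_eq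
  · simp
  · rintro i s' hi hv hf ⟨h1, h2⟩
    have hE' := hE₀.frame hf rfl rfl
    have h3 : s'.a .tau = s.a .tau := hf.2 .tau rfl
    have h4 : s'.v .side = 1 := (hf.1 .side rfl).trans (by simp)
    refine tri_seq.2 ((tri_minCut_side hE' (h3 ▸ hτ) (P := S.σ i) fun j hj => ?_).mono ?_)
    · rw [h2, hE'.bl i hi j hj, h4]
      split_ifs <;> simp [*]
    · rintro l s'' hf' ⟨Z, hl, hval, -⟩
      have h5 : s''.v .x = i := (hf'.1 .x rfl).trans hv
      have h6 : s''.v .p = s'.v .p := hf'.1 .p rfl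
      have h7 : s''.v .xo = i * k := (hf'.1 .xo rfl).trans h2
      have h8 : s''.v .k = k := (hf'.1 .k rfl).trans hE'.k_eq
      simp [h5, h6, h7, h8, h1, hval, h3, Finset.sum_range_succ]
      exact ⟨by omega, by ring⟩
  · rintro l s' hf ⟨h1, h2⟩ hv hl
    exact ⟨h1, by omega⟩

/-- The effect of `fixLabel`: a persistent set gets the label, and assigning the label to any other
vertex would increase some minimum cut. -/
theorem tri_fixLabel {s : Mem} (hE : Env G S dl k s) (hτ : TauOK G k (s.a .tau))
    (hi : s.v .i < k) :
    Tri fixLabel s fun l s' => ∃ X : Set ℕ, G.Persistent S (part dl (s.a .tau)) (dl (s.v .i)) X ∧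
      part dl (s'.a .tau) = assign (part dl (s.a .tau)) X (dl (s.v .i)) ∧ TauOK G k (s'.a .tau) ∧
      (∀ v < G.n, s'.a .tau v = 0 → ∃ x < S.t, G.sideCut (part dl (s.a .tau)) (S.σ x) <
        G.sideCut (assign (part dl (s.a .tau)) {v} (dl (s.v .i))) (S.σ x)) ∧
      l ≤ 7 + G.n * 8 + S.t * (cutTime G + G.n * 5 + 9) := by
  set τ := part dl (s.a .tau) with hτdef
  set d := dl (s.v .i) with hd
  set j := s.v .i
  refine tri_seq.2 (tri_for (I := fun i s' => ∀ v < i, s'.a .ok v = 1) G.n 1 ?_ (by simp) ?_ ?_)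
  · intro i s' _ _ hf _
    exact (hE.frame hf rfl rfl).graph.n
  · intro i s' hi hv hf hI
    simp [hv]
    intro v hvi
    rcases Nat.lt_or_eq_of_le hvi with hlt | rfl
    · simpa [hlt.ne] using hI v hlt
    · simp
  rintro l₁ s₁ hf₁ hok₁ - hl₁
  have hE₁ := (hE.frame hf₁ rfl rfl).setV (a := .xo) (c := 0) (by decide)
  have htau₁ : s₁.a .tau = s.a .tau := hf₁.2 .tau rfl
  have hi₁ : s₁.v .i = j := hf₁.1 .i rfl
  refine tri_seq.2 (tri_assign.2 (tri_seq.2 ?_))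
  -- For the splits treated so far, the vertices that are still `ok` lie in a minimum cut, and the
  -- others lie in no minimum cut of some split.
  refine tri_for (I := fun x s' => s'.v .xo = x * k ∧ (∀ y < x, ∃ M,
      G.SepSides τ (fun z => S.σ y z ↔ S.σ y d) M ∧ G.cut M ≤ G.sideCut τ (S.σ y) ∧
      ∀ v < G.n, s'.a .ok v = 1 → v ∈ M) ∧ ∀ v < G.n, s'.a .ok v ≠ 1 → ∃ y < x,
      ∀ M, G.SepSides τ (fun z => S.σ y z ↔ S.σ y d) M → G.cut M ≤ G.sideCut τ (S.σ y) → v ∉ M)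
    S.t (cutTime G + G.n * 5 + 5) ?_ ?_ ?_ ?_
  · intro i s' _ _ hf _
    exact (hE₁.frame hf rfl rfl).t_eq
  · refine ⟨by simp, by omega, ?_⟩
    intro v hv hne
    exact absurd (hok₁ v hv) hne
  · rintro x s₂ hx hvx hf₂ ⟨hxo, hpos, hneg⟩
    have hE₂ := hE₁.frame hf₂ rfl rfl
    have htau₂ : s₂.a .tau = s.a .tau := (hf₂.2 .tau rfl).trans htau₁
    have hi₂ : s₂.v .i = j := (hf₂.1 .i rfl).trans (by simpa using hi₁)
    refine tri_seq.2 (tri_assign.2 (tri_seq.2 ?_))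
    have hE₃ := hE₂.setV (a := .side) (c := AExp.eval s₂ (Arr.bl.at ((Var.xo : Expr) + Var.i)))
      (by decide)
    refine (tri_minCut_side hE₃ (by simpa [htau₂] using hτ) (P := fun z => S.σ x z ↔ S.σ x d)
      fun b hb => ?_).mono ?_
    · simp only [Store.setV_a, Store.setV_v, AExp.eval_get, AExp.eval_add, AExp.eval_var, if_true,
        if_false, hxo, hi₂, reduceCtorEq]
      rw [hE₂.bl x hx b hb, hE₂.bl x hx j hi]
      split_ifs <;> simp [*]
    rintro l₃ s₃ hf₃ ⟨Z, hl₃, -, hmk, hZ1, hZ2, hZ3⟩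
    simp only [Store.setV_a, htau₂, sideCut_iff, ← hτdef] at hZ1 hZ2 hZ3
    have hE₄ := hE₃.frame hf₃ rfl rfl
    have hok₃ : s₃.a .ok = s₂.a .ok := hf₃.2 .ok rfl
    refine tri_seq.2 (tri_for (I := fun i s' => ∀ v, s'.a .ok v =
      if v < i ∧ s₃.a .mk v = 1 then 0 else s₂.a .ok v) G.n 3 ?_ ?_ ?_ ?_)
    · intro i s' _ _ hf _
      exact (hE₄.frame hf rfl rfl).graph.n
    · simp [hok₃]
    · intro i s₄ hi hv hf hI
      have h1 : s₄.a .mk = s₃.a .mk := hf.2 .mk rfl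
      simp [hv, h1]
      refine ⟨fun hm v => ?_, fun hm v => ?_⟩
      · by_cases hvi : v = i
        · subst hvi; simp [hm]
        · rw [Function.update_of_ne hvi, hI v]
          have : v ≤ i ↔ v < i := by omega
          simp [this]
      · rw [hI v]
        by_cases hvi : v = i
        · subst hvi; simp [hm]
        · have : v ≤ i ↔ v < i := by omega
          simp [this]
    rintro l₅ s₅ hf₅ hok₅ - hl₅
    have hok : ∀ v < G.n, s₅.a .ok v = 1 ↔ s₂.a .ok v = 1 ∧ v ∉ Z := by
      intro v hv
      rw [hok₅ v, ← hmk v hv]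
      by_cases hm : s₃.a .mk v = 1 <;> simp [hm, hv]
    have h1 : s₅.v .x = x := by
      rw [hf₅.1 .x rfl, hf₃.1 .x rfl]; simpa using hvx
    have h2 : s₅.v .xo = x * k := by
      rw [hf₅.1 .xo rfl, hf₃.1 .xo rfl]; simpa using hxo
    have h3 : s₅.v .k = k := (hE₄.frame hf₅ rfl rfl).k_eq
    refine tri_assign.2 ⟨by simpa using h1, by omega, ?_, ?_, ?_⟩
    · simp [h2, h3]; ring
    · intro y hy
      rcases Nat.lt_succ_iff_lt_or_eq.1 hy with hlt | rfl
      · obtain ⟨M, m1, m2, m3⟩ := hpos y hlt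
        exact ⟨M, m1, m2, fun v hv hv1 => m3 v hv ((hok v hv).1 (by simpa using hv1)).1⟩
      · exact ⟨Zᶜ, hZ1, hZ2.le, fun v hv hv1 => ((hok v hv).1 (by simpa using hv1)).2⟩
    · intro v hv hne
      by_cases h0 : s₂.a .ok v = 1
      · refine ⟨x, by omega, fun M m1 m2 => hZ3 M m1 m2 v ?_⟩
        by_contra hvZ
        exact hne (by simpa using (hok v hv).2 ⟨h0, hvZ⟩)
      · obtain ⟨y, hy, hy'⟩ := hneg v hv h0
        exact ⟨y, by omega, hy'⟩
  rintro l₂ s₂ hf₂ ⟨-, hpos, hneg⟩ - hl₂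
  have hE₂ := hE₁.frame hf₂ rfl rfl
  have htau₂ : s₂.a .tau = s.a .tau := (hf₂.2 .tau rfl).trans htau₁
  have hi₂ : s₂.v .i = j := (hf₂.1 .i rfl).trans (by simpa using hi₁)
  refine tri_for (I := fun i s' => ∀ v, s'.a .tau v =
    if v < i ∧ s.a .tau v = 0 ∧ s₂.a .ok v = 1 then j + 1 else s.a .tau v) G.n 3 ?_ ?_ ?_ ?_
  · intro i s' _ _ hf _
    exact (hE₂.frame hf rfl rfl).graph.n
  · simp [htau₂]
  · intro i s₃ hi hv hf hI
    have h1 : s₃.a .ok = s₂.a .ok := hf.2 .ok rfl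
    have h2 : s₃.v .i = j := (hf.1 .i rfl).trans hi₂
    have h3 : s₃.a .tau i = s.a .tau i := by rw [hI i]; simp
    simp [hv, h1, h2, h3]
    refine ⟨fun h0 hm v => ?_, fun hm v => ?_⟩
    · by_cases hvi : v = i
      · subst hvi; simp [hm, h0]
      · rw [Function.update_of_ne hvi, hI v]
        have : v ≤ i ↔ v < i := by omega
        simp [this]
    · rw [hI v]
      by_cases hvi : v = i
      · subst hvi
        rw [if_neg (by simp), if_neg (by simpa using hm)]
      · have : v ≤ i ↔ v < i := by omega
        simp [this]
  rintro l₃ s₃ hf₃ htau₃ - hl₃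
  let X : Set ℕ := {v | v < G.n ∧ s.a .tau v = 0 ∧ s₂.a .ok v = 1}
  have hX : ∀ v ∈ X, τ v = none := fun v hv => part_eq_none.2 hv.2.1
  refine ⟨X, ⟨hX, fun x hx => ?_⟩, ?_, ?_, ?_, ?_⟩
  · obtain ⟨M, m1, m2, m3⟩ := hpos x hx
    exact ⟨M, m1, m2, fun v hv => m3 v hv.1 hv.2.2⟩
  · funext v
    unfold part assign
    rw [htau₃ v]
    by_cases hv : v < G.n ∧ s.a .tau v = 0 ∧ s₂.a .ok v = 1
    · have hvX : v ∈ X := hv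
      rw [if_pos hv, if_pos hvX]
      simp [hd]
    · have hvX : v ∉ X := hv
      rw [if_neg hv, if_neg hvX]
      rfl
  · intro v hv
    rw [htau₃ v]
    split_ifs
    · omega
    · exact hτ v hv
  · intro v hv h0
    rw [htau₃ v] at h0
    split_ifs at h0 with hif
    have hne : s₂.a .ok v ≠ 1 := fun h => hif ⟨hv, h0, h⟩
    obtain ⟨x, hx, hx'⟩ := hneg v hv hne
    exact ⟨x, hx, sideCut_lt_assign hv (part_eq_none.2 h0) hx'⟩
  · have : S.t * (cutTime G + G.n * 5 + 5 + 2) ≤ S.t * (cutTime G + G.n * 5 + 9) :=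
      Nat.mul_le_mul_left _ (by omega)
    omega

end ZeroExt

namespace ZeroExt

open Imp ArcGraph

variable {G : ArcGraph} {W : Type*} {S : Splits W} {dl : ℕ → W} {k q : ℕ}

/-- The set of labels. -/
def labels (dl : ℕ → W) (k : ℕ) : Set W := {y | ∃ i < k, dl i = y}

/-- Afterwards, assigning any label to any unlabelled vertex increases the bound. -/
theorem tri_fixLabels {s : Mem} (hS : S.IsTree) (hE : Env G S dl k s)
    (hτ : TauOK G k (s.a .tau)) :
    Tri fixLabels s fun l s' => TauOK G k (s'.a .tau) ∧
      (G.Solvable S (labels dl k) q (part dl (s'.a .tau)) ↔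
        G.Solvable S (labels dl k) q (part dl (s.a .tau))) ∧
      G.bound S (part dl (s'.a .tau)) = G.bound S (part dl (s.a .tau)) ∧
      (∀ v < G.n, s'.a .tau v = 0 → ∀ j < k, G.bound S (part dl (s.a .tau)) <
        G.bound S (assign (part dl (s'.a .tau)) {v} (dl j))) ∧
      l ≤ 2 + k * (7 + G.n * 8 + S.t * (cutTime G + G.n * 5 + 9) + 2) := by
  refine tri_for (I := fun i s' => TauOK G k (s'.a .tau) ∧
      (G.Solvable S (labels dl k) q (part dl (s'.a .tau)) ↔
        G.Solvable S (labels dl k) q (part dl (s.a .tau))) ∧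
      (∀ x < S.t, G.sideCut (part dl (s'.a .tau)) (S.σ x) =
        G.sideCut (part dl (s.a .tau)) (S.σ x)) ∧
      ∀ v < G.n, s'.a .tau v = 0 → ∀ j < i, ∃ x < S.t, G.sideCut (part dl (s.a .tau)) (S.σ x) <
        G.sideCut (assign (part dl (s'.a .tau)) {v} (dl j)) (S.σ x)) k
      (7 + G.n * 8 + S.t * (cutTime G + G.n * 5 + 9)) ?_ ?_ ?_ ?_
  · intro i s' _ _ hf _
    exact (hE.frame hf rfl rfl).k_eq
  · exact ⟨hτ, Iff.rfl, fun _ _ => rfl, by omega⟩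
  · rintro i s₁ hi hv hf ⟨h1, h2, h3, h4⟩
    have hE₁ := hE.frame hf rfl rfl
    refine (tri_fixLabel hE₁ h1 (hv ▸ hi)).mono ?_
    rintro l s₂ hf₂ ⟨X, hX, hτ₂, hok, hbl, hl⟩
    rw [hv] at hX hτ₂ hbl
    have hmono : ∀ v j, s₂.a .tau v = 0 → ∀ x, G.sideCut (assign (part dl (s₁.a .tau)) {v} (dl j))
        (S.σ x) ≤ G.sideCut (assign (part dl (s₂.a .tau)) {v} (dl j)) (S.σ x) := by
      intro v j _ x
      refine sideCut_mono (fun u _ y hy => ?_) _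
      unfold assign at hy ⊢
      split_ifs at hy ⊢ with hu
      · exact hy
      · rw [hτ₂]; exact le_assign hX.1 u y hy
    have hzero : ∀ v, s₂.a .tau v = 0 → s₁.a .tau v = 0 := by
      intro v hv0
      by_contra hne
      have h5 : part dl (s₁.a .tau) v = some (dl (s₁.a .tau v - 1)) := if_neg hne
      have h6 := le_assign (d := dl i) hX.1 v _ h5
      rw [← hτ₂, part_eq_none.2 hv0] at h6
      cases h6
    refine ⟨(hf₂.1 .i rfl).trans hv, hl, hok, ?_, fun x hx => ?_, fun v hvn hv0 j hj => ?_⟩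
    · rw [Store.setV_a, hτ₂, ← h2]
      exact hX.solvable_iff hS (show dl i ∈ labels dl k from ⟨i, hi, rfl⟩)
    · rw [Store.setV_a, hτ₂, hX.sideCut hx, h3 x hx]
    · rw [Store.setV_a] at hv0 ⊢
      rcases Nat.lt_succ_iff_lt_or_eq.1 hj with hlt | rfl
      · obtain ⟨x, hx, hx'⟩ := h4 v hvn (hzero v hv0) j hlt
        exact ⟨x, hx, hx'.trans_le (hmono v j hv0 x)⟩
      · obtain ⟨x, hx, hx'⟩ := hbl v hvn hv0
        rw [h3 x hx] at hx'
        exact ⟨x, hx, hx'.trans_le (hmono v j hv0 x)⟩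
  · rintro l s' hf ⟨h1, h2, h3, h4⟩ hv hl
    refine ⟨h1, h2, Finset.sum_congr rfl fun x hx => h3 x (Finset.mem_range.1 hx),
      fun v hvn hv0 j hj => ?_, hl⟩
    obtain ⟨x, hx, hx'⟩ := h4 v hvn hv0 j hj
    refine Finset.sum_lt_sum (fun y hy => ?_) ⟨x, Finset.mem_range.2 hx, hx'⟩
    rw [← h3 y (Finset.mem_range.1 hy)]
    exact sideCut_le_assign (by rintro u rfl; exact part_eq_none.2 hv0) _

theorem tri_findFree {s : Mem} (hn : s.v .n = G.n) :
    Tri findFree s fun l s' => ((s'.v .w = G.n ∧ ∀ v < G.n, s.a .tau v ≠ 0) ∨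
      (s'.v .w < G.n ∧ s.a .tau (s'.v .w) = 0)) ∧ l ≤ 3 + G.n * 4 := by
  refine tri_seq.2 (tri_assign.2 (tri_for (I := fun i s' =>
    (s'.v .w = G.n ∧ ∀ v < i, s.a .tau v ≠ 0) ∨ (s'.v .w < G.n ∧ s.a .tau (s'.v .w) = 0))
    G.n 2 ?_ ?_ ?_ ?_))
  · intro i s' _ _ hf _
    rw [AExp.eval_var, hf.1 .n rfl]; simpa using hn
  · simp [hn]
  · intro i s' hi hv hf hI
    have h1 : s'.a .tau = s.a .tau := hf.2 .tau rfl
    simp [hv, h1]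
    refine ⟨fun h0 => Or.inr ⟨hi, h0⟩, fun h0 => ?_⟩
    rcases hI with ⟨h2, h3⟩ | h2
    · refine Or.inl ⟨h2, fun v hvi => ?_⟩
      rcases Nat.lt_or_eq_of_le hvi with hlt | rfl
      · exact h3 v hlt
      · exact h0
    · exact Or.inr h2
  · rintro l s' hf hI hv hl
    exact ⟨hI, by omega⟩

theorem tri_pushChildren {s : Mem} {h : ℕ} (hn : s.v .n = G.n) (hk : s.v .k = k)
    (hsp : s.v .sp = h * G.n) :
    Tri pushChildren s fun l s' => s'.v .sp = (h + k) * G.n ∧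
      (∀ a < h * G.n, s'.a .stk a = s.a .stk a) ∧
      (∀ i < k, ∀ v < G.n, s'.a .stk ((h + i) * G.n + v) =
        if v = s.v .w then i + 1 else s.a .tau v) ∧ l ≤ 2 + k * (G.n * 3 + 6) := by
  refine tri_for (I := fun i s' => s'.v .sp = (h + i) * G.n ∧
      (∀ a < h * G.n, s'.a .stk a = s.a .stk a) ∧
      ∀ j < i, ∀ v < G.n, s'.a .stk ((h + j) * G.n + v) =
        if v = s.v .w then j + 1 else s.a .tau v) k (G.n * 3 + 4) ?_ ?_ ?_ ?_
  · intro i s' _ _ hf _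
    exact (hf.1 .k rfl).trans hk
  · exact ⟨by simp [hsp], fun _ _ => rfl, by omega⟩
  · rintro i s₁ hi hv hf ⟨h1, h2, h3⟩
    have hn₁ : s₁.v .n = G.n := (hf.1 .n rfl).trans hn
    have hw₁ : s₁.v .w = s.v .w := hf.1 .w rfl
    have htau₁ : s₁.a .tau = s.a .tau := hf.2 .tau rfl
    refine tri_seq.2 (tri_for (I := fun u s' => ∀ a, s'.a .stk a =
      if (h + i) * G.n ≤ a ∧ a < (h + i) * G.n + u then s.a .tau (a - (h + i) * G.n)
      else s₁.a .stk a) G.n 1 ?_ ?_ ?_ ?_)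
    · intro u s' _ _ hf' _
      exact (hf'.1 .n rfl).trans hn₁
    · intro a
      rw [if_neg (by omega)]
      rfl
    · intro u s₂ hu hv₂ hf₂ hI
      have h4 : s₂.v .sp = (h + i) * G.n := (hf₂.1 .sp rfl).trans h1
      have h5 : s₂.a .tau = s.a .tau := (hf₂.2 .tau rfl).trans htau₁
      simp [hv₂, h4, h5]
      intro a
      by_cases ha : a = (h + i) * G.n + u
      · subst ha; simp
      · rw [Function.update_of_ne ha, hI a]
        have : a < (h + i) * G.n + (u + 1) ↔ a < (h + i) * G.n + u := by omega
        simp [this]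
    rintro l s₂ hf₂ hI - hl
    have h4 : s₂.v .sp = (h + i) * G.n := (hf₂.1 .sp rfl).trans h1
    have h5 : s₂.v .i = i := (hf₂.1 .i rfl).trans hv
    have h6 : s₂.v .w = s.v .w := (hf₂.1 .w rfl).trans hw₁
    have h7 : s₂.v .n = G.n := (hf₂.1 .n rfl).trans hn₁
    have hle : h * G.n ≤ (h + i) * G.n := Nat.mul_le_mul_right _ (by omega)
    simp [h4, h5, h6, h7]
    refine ⟨by omega, by ring, fun a ha => ?_, fun j hj v hvn => ?_⟩
    · rw [Function.update_of_ne (by omega), hI a, if_neg (by omega), h2 a ha]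
    · rcases Nat.lt_or_eq_of_le hj with hlt | rfl
      · have : (h + j) * G.n + G.n ≤ (h + i) * G.n := by
          rw [← Nat.succ_mul]; exact Nat.mul_le_mul_right _ (by omega)
        rw [Function.update_of_ne (by omega), hI _, if_neg (by omega), h3 j hlt v hvn]
      · rw [Function.update_apply, hI]
        by_cases hvw : v = s.v .w
        · simp [hvw]
        · rw [if_neg (by omega), if_pos (by omega), if_neg hvw]
          congr 1; omega
  · rintro l s' hf ⟨h1, h2, h3⟩ hv hl
    exact ⟨h1, h2, h3, by omega⟩

theorem tri_pop {s : Mem} (hn : s.v .n = G.n) :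
    Tri pop s fun l s' => s'.v .sp = s.v .sp - G.n ∧
      (∀ v < G.n, s'.a .tau v = s.a .stk (s.v .sp - G.n + v)) ∧ l ≤ 3 + G.n * 3 := by
  refine tri_seq.2 (tri_assign.2 (tri_for (I := fun i s' =>
    ∀ v < i, s'.a .tau v = s.a .stk (s.v .sp - G.n + v)) G.n 1 ?_ (by omega) ?_ ?_))
  · intro i s' _ _ hf _
    rw [AExp.eval_var, hf.1 .n rfl]; simpa using hn
  · intro i s' hi hv hf hI
    have h1 : s'.a .stk = s.a .stk := hf.2 .stk rfl
    have h2 : s'.v .sp = s.v .sp - G.n := (hf.1 .sp rfl).trans (by simp [hn])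
    simp [hv, h1, h2]
    intro v hvi
    rcases Nat.lt_or_eq_of_le hvi with hlt | rfl
    · simpa [hlt.ne] using hI v hlt
    · simp
  · rintro l s' hf hI hv hl
    refine ⟨(hf.1 .sp rfl).trans (by simp [hn]), hI, by omega⟩

/-- The partial labelling number `j` on the stack. -/
def stackEntry (G : ArcGraph) (dl : ℕ → W) (stk : ℕ → ℕ) (j : ℕ) : ℕ → Option W :=
  part dl fun v => stk (j * G.n + v)

/-- All entries on a stack of height `h` are partial labellings. -/
def StackOK (G : ArcGraph) (k : ℕ) (stk : ℕ → ℕ) (h : ℕ) : Prop :=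
  ∀ j < h, TauOK G k fun v => stk (j * G.n + v)

/-- Either the current partial labelling is found to be solvable, or it is replaced by partial
labellings with larger bounds. -/
theorem tri_expand [Nonempty W] {s : Mem} {h : ℕ} (hS : S.IsTree) (hE : Env G S dl k s)
    (hτ : TauOK G k (s.a .tau)) (hsp : s.v .sp = h * G.n)
    (hq : G.bound S (part dl (s.a .tau)) ≤ q) :
    Tri expand s fun l s' =>
      ((s'.v .ans = 1 ∧ s'.v .sp = 0 ∧ G.Solvable S (labels dl k) q (part dl (s.a .tau))) ∨
        (s'.v .ans = s.v .ans ∧ s'.v .sp = (h + k) * G.n ∧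
          (∀ a < h * G.n, s'.a .stk a = s.a .stk a) ∧
          (∀ j, h ≤ j → j < h + k → TauOK G k (fun v => s'.a .stk (j * G.n + v)) ∧
            G.bound S (part dl (s.a .tau)) < G.bound S (stackEntry G dl (s'.a .stk) j)) ∧
          (G.Solvable S (labels dl k) q (part dl (s.a .tau)) ↔ ∃ j, h ≤ j ∧ j < h + k ∧
            G.Solvable S (labels dl k) q (stackEntry G dl (s'.a .stk) j)))) ∧
      l ≤ 12 + G.n * 4 + k * (G.n * 11 + 15 + S.t * (cutTime G + G.n * 5 + 9)) := by
  refine tri_seq.2 ((tri_fixLabels (q := q) hS hE hτ).mono ?_)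
  rintro l₁ s₁ hf₁ ⟨hτ₁, hsolv, hbound, hlt, hl₁⟩
  have hE₁ := hE.frame hf₁ rfl rfl
  refine tri_seq.2 ((tri_findFree hE₁.graph.n).mono ?_)
  rintro l₂ s₂ hf₂ ⟨hw, hl₂⟩
  have hE₂ := hE₁.frame hf₂ rfl rfl
  have htau₂ : s₂.a .tau = s₁.a .tau := hf₂.2 .tau rfl
  have hstk₂ : s₂.a .stk = s.a .stk := (hf₂.2 .stk rfl).trans (hf₁.2 .stk rfl)
  have hsp₂ : s₂.v .sp = h * G.n := (hf₂.1 .sp rfl).trans ((hf₁.1 .sp rfl).trans hsp)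
  have hans₂ : s₂.v .ans = s.v .ans := (hf₂.1 .ans rfl).trans (hf₁.1 .ans rfl)
  have htime : k * (7 + G.n * 8 + S.t * (cutTime G + G.n * 5 + 9) + 2) + k * (G.n * 3 + 6) =
      k * (G.n * 11 + 15 + S.t * (cutTime G + G.n * 5 + 9)) := by ring
  refine tri_ite.2 ⟨fun hc => ?_, fun hc => ?_⟩
  · simp [hE₂.graph.n] at hc
    rcases hw with ⟨-, hall⟩ | ⟨hw, -⟩
    · simp
      refine ⟨Or.inl (hsolv.1 (solvable_of_total hS (fun v hv => ?_) (hbound.trans_le hq))), by omega⟩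
      have h0 := hall v hv
      have h1 := hτ₁ v hv
      exact ⟨_, ⟨_, by omega, rfl⟩, if_neg h0⟩
    · omega
  · simp [hE₂.graph.n] at hc
    rcases hw with ⟨hw, -⟩ | ⟨hw, hw0⟩
    · exact absurd hw hc
    refine (tri_pushChildren hE₂.graph.n hE₂.k_eq hsp₂).mono ?_
    rintro l₃ s₃ hf₃ ⟨hsp₃, hold, hnew, hl₃⟩
    have hentry : ∀ j, h ≤ j → j < h + k → ∀ v < G.n, stackEntry G dl (s₃.a .stk) j v =
        assign (part dl (s₁.a .tau)) {s₂.v .w} (dl (j - h)) v := by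
      intro j hj hjk v hv
      have h1 := hnew (j - h) (by omega) v hv
      rw [Nat.add_sub_cancel' hj, htau₂] at h1
      simp only [stackEntry, part, assign, h1]
      by_cases hvw : v = s₂.v .w <;> simp [hvw]
    have hnone : part dl (s₁.a .tau) (s₂.v .w) = none := part_eq_none.2 hw0
    refine ⟨Or.inr ⟨(hf₃.1 .ans rfl).trans hans₂, hsp₃, fun a ha => (hold a ha).trans (by rw [hstk₂]),
      fun j hj hjk => ⟨fun v hv => ?_, ?_⟩, ?_⟩, by omega⟩
    · have h1 := hnew (j - h) (by omega) v hv
      rw [Nat.add_sub_cancel' hj, htau₂] at h1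
      simp only [h1]
      split_ifs
      · omega
      · exact hτ₁ v hv
    · rw [bound_congr (hentry j hj hjk)]
      exact hlt _ hw hw0 _ (by omega)
    · rw [← hsolv, solvable_branch hw hnone]
      constructor
      · rintro ⟨_, ⟨i, hi, rfl⟩, hs⟩
        refine ⟨h + i, by omega, by omega, (solvable_congr (hentry _ (by omega) (by omega))).2 ?_⟩
        rwa [Nat.add_sub_cancel_left]
      · rintro ⟨j, hj, hjk, hs⟩
        exact ⟨_, ⟨j - h, by omega, rfl⟩, (solvable_congr (hentry j hj hjk)).1 hs⟩

/-- The budget for a partial labelling with the bound `p`, including everything that comes from it,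
where `U` pays for a partial labelling that is abandoned and `U * k * 3` for any other. The last
term covers the abandoned ones among the descendants: there are at most `k ^ (q - p + 1)`. -/
def weight (U k q p : ℕ) : ℕ :=
  if q < p then U else U * k * (3 * ∑ i ∈ Finset.range (q - p + 1), k ^ i + k ^ (q - p))

theorem weight_branch {U p p' : ℕ} (hk : 1 ≤ k) (hp : p ≤ q) (hpp : p < p') :
    U * k * 3 + k * weight U k q p' ≤ weight U k q p := by
  unfold weight
  have hs : ∑ i ∈ Finset.range (q - p + 1), k ^ i =
      ∑ i ∈ Finset.range (q - p), k ^ (i + 1) + 1 := by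
    rw [Finset.sum_range_succ', pow_zero]
  rw [if_neg (not_lt.2 hp), hs]
  split_ifs with hq
  · have h1 : 1 ≤ k ^ (q - p) := Nat.one_le_pow _ _ hk
    calc U * k * 3 + k * U = U * k * (3 * 1 + 1) := by ring
      _ ≤ _ := Nat.mul_le_mul_left _ (by omega)
  · have h1 : k * k ^ (q - p') ≤ k ^ (q - p) := by
      rw [← pow_succ']; exact Nat.pow_le_pow_right hk (by omega)
    have h2 : k * ∑ i ∈ Finset.range (q - p' + 1), k ^ i ≤
        ∑ i ∈ Finset.range (q - p), k ^ (i + 1) := by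
      rw [Finset.mul_sum]
      simp only [← pow_succ']
      exact Finset.sum_le_sum_of_subset (Finset.range_subset_range.2 (by omega))
    calc U * k * 3 + k * (U * k * (3 * ∑ i ∈ Finset.range (q - p' + 1), k ^ i + k ^ (q - p')))
        = U * k * (3 * (k * ∑ i ∈ Finset.range (q - p' + 1), k ^ i + 1) + k * k ^ (q - p')) := by
          ring
      _ ≤ _ := Nat.mul_le_mul_left _ (by omega)

theorem weight_pos_le {U p : ℕ} (hp : p ≤ q) : U * k * 3 ≤ weight U k q p := by
  unfold weight
  rw [if_neg (not_lt.2 hp), Finset.sum_range_succ', pow_zero]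
  exact Nat.mul_le_mul_left _ (by omega)

theorem weight_le {U p : ℕ} (hk : 2 ≤ k) : weight U k q p ≤ U * k * (7 * k ^ (q - p)) := by
  have h1 : ∀ e, ∑ i ∈ Finset.range (e + 1), k ^ i ≤ 2 * k ^ e := by
    intro e
    induction e with
    | zero => simp
    | succ e ih =>
      rw [Finset.sum_range_succ, pow_succ]
      nlinarith [Nat.zero_le (k ^ e)]
  unfold weight
  split_ifs with hq
  · have h2 : 1 ≤ k ^ (q - p) := Nat.one_le_pow _ _ (by omega)
    calc U = U * 1 * 1 := by ring
      _ ≤ _ := Nat.mul_le_mul (Nat.mul_le_mul_left _ (by omega)) (by omega)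
  · have := h1 (q - p)
    exact Nat.mul_le_mul_left _ (by omega)

end ZeroExt

namespace ZeroExt

open Imp ArcGraph

variable {G : ArcGraph} {W : Type*} {S : Splits W} {dl : ℕ → W} {k q : ℕ}

theorem stackEntry_congr {stk stk' : ℕ → ℕ} {j h : ℕ} (hj : j < h)
    (hold : ∀ a < h * G.n, stk' a = stk a) (v : ℕ) (hv : v < G.n) :
    stackEntry G dl stk' j v = stackEntry G dl stk j v := by
  have : j * G.n + v < h * G.n := by
    have := Nat.mul_le_mul_right G.n hj
    rw [Nat.succ_mul] at this
    omega
  simp only [stackEntry, part, hold _ this]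

/-- The budget for the partial labellings on the stack. -/
noncomputable def stackWeight (G : ArcGraph) (S : Splits W) (dl : ℕ → W) (U k q : ℕ)
    (stk : ℕ → ℕ) (h : ℕ) : ℕ :=
  ∑ j ∈ Finset.range h, weight U k q (G.bound S (stackEntry G dl stk j))

theorem stackWeight_congr {U : ℕ} {stk stk' : ℕ → ℕ} {h : ℕ}
    (hold : ∀ a < h * G.n, stk' a = stk a) :
    stackWeight G S dl U k q stk' h = stackWeight G S dl U k q stk h := by
  refine Finset.sum_congr rfl fun j hj => ?_
  rw [bound_congr (stackEntry_congr (Finset.mem_range.1 hj) hold)]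

theorem weight_anti {U p p' : ℕ} (hk : 1 ≤ k) (hp : p ≤ p') : weight U k q p' ≤ weight U k q p := by
  unfold weight
  split_ifs with h1 h2
  · exact le_rfl
  · have h3 : 1 ≤ k ^ (q - p) := Nat.one_le_pow _ _ hk
    calc U = U * 1 * 1 := by ring
      _ ≤ _ := Nat.mul_le_mul (Nat.mul_le_mul_left _ hk) (by omega)
  · omega
  · refine Nat.mul_le_mul_left _ (Nat.add_le_add (Nat.mul_le_mul_left _ ?_) ?_)
    · exact Finset.sum_le_sum_of_subset (Finset.range_subset_range.2 (by omega))
    · exact Nat.pow_le_pow_right hk (by omega)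

theorem step_time_le {n t c k : ℕ} (ht : 1 ≤ t) (hk : 1 ≤ k) (hc : 400 * (n + 1) ≤ c) :
    (3 + n * 3) + (5 + t * (c + 2 + 2)) + 3 ≤ 3 * (t * c) ∧
    (3 + n * 3) + (5 + t * (c + 2 + 2)) + (12 + n * 4 + k * (n * 11 + 15 + t * (c + n * 5 + 9))) + 3
      ≤ 3 * (t * c) * k * 3 := by
  have h1 : 400 * (t * n) + 400 * t ≤ t * c := by nlinarith
  have h2 : n ≤ t * n := Nat.le_mul_of_pos_left _ ht
  have h3 : t * (c + 2 + 2) = t * c + 4 * t := by ring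
  have h4 : t * (c + n * 5 + 9) = t * c + 5 * (t * n) + 9 * t := by ring
  rw [h3, h4]
  refine ⟨by omega, ?_⟩
  have h5 : k * (n * 11 + 15 + (t * c + 5 * (t * n) + 9 * t)) ≤ k * (2 * (t * c)) :=
    Nat.mul_le_mul_left _ (by omega)
  have h6 : k * (2 * (t * c)) = 2 * (t * c * k) := by ring
  have h7 : t * c ≤ t * c * k := Nat.le_mul_of_pos_right _ hk
  have h8 : 3 * (t * c) * k * 3 = 9 * (t * c * k) := by ring
  omega

open scoped Classical in
/-- The search decides whether the partial labelling on the stack has an extension of cost at most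
`q`. -/
theorem tri_search [Nonempty W] {s : Mem} (hS : S.IsTree) (hE : Env G S dl k s) (hn : 0 < G.n)
    (ht : 1 ≤ S.t) (hk : 1 ≤ k) (hsp : s.v .sp = G.n) (hq : s.v .q = q)
    (hτ : TauOK G k (s.a .stk)) (hans : s.v .ans = 0) :
    Tri search s fun l s' =>
      s'.v .ans = (if G.Solvable S (labels dl k) q (part dl (s.a .stk)) then 1 else 0) ∧
      l ≤ 1 + weight (3 * (S.t * cutTime G)) k q (G.bound S (part dl (s.a .stk))) := by
  set U := 3 * (S.t * cutTime G) with hU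
  set D := labels dl k
  have hc : 400 * (G.n + 1) ≤ cutTime G := by
    unfold cutTime
    exact Nat.mul_le_mul_left _ (Nat.le_mul_of_pos_right _ (by omega))
  obtain ⟨hT1, hT2⟩ := step_time_le (n := G.n) ht hk hc
  rw [← hU] at hT1 hT2
  have h00 : stackEntry G dl (s.a .stk) 0 = part dl (s.a .stk) := by
    simp [stackEntry]
  refine tri_while (I := fun s' => ∃ h, s'.v .sp = h * G.n ∧ StackOK G k (s'.a .stk) h ∧
      ((s'.v .ans = 0 ∧ (G.Solvable S D q (part dl (s.a .stk)) ↔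
          ∃ j < h, G.Solvable S D q (stackEntry G dl (s'.a .stk) j))) ∨
        (s'.v .ans = 1 ∧ h = 0 ∧ G.Solvable S D q (part dl (s.a .stk)))))
    (pot := fun s' => stackWeight G S dl U k q (s'.a .stk) (s'.v .sp / G.n)) ?_ ?_ ?_
  · refine ⟨1, by simpa using hsp, fun j hj => ?_, Or.inl ⟨hans, ?_⟩⟩
    · obtain rfl : j = 0 := by omega
      simpa using hτ
    · constructor
      · intro h; exact ⟨0, by omega, by rwa [h00]⟩
      · rintro ⟨j, hj, h⟩
        obtain rfl : j = 0 := by omega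
        rwa [h00] at h
  · rintro s₁ hf₁ ⟨h, hsp₁, hok, hI⟩ he
    have hne : h ≠ 0 := by
      rintro rfl
      exact he (by simpa using hsp₁)
    obtain ⟨h, rfl⟩ : ∃ g, h = g + 1 := ⟨h - 1, by omega⟩
    obtain ⟨hans₁, hI⟩ : s₁.v .ans = 0 ∧ (G.Solvable S D q (part dl (s.a .stk)) ↔
        ∃ j < h + 1, G.Solvable S D q (stackEntry G dl (s₁.a .stk) j)) := by
      rcases hI with h1 | ⟨-, h1, -⟩
      · exact h1
      · omega
    have hE₁ := hE.frame hf₁ rfl rfl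
    have hdiv : ∀ g, g * G.n / G.n = g := fun g => Nat.mul_div_cancel _ hn
    refine tri_seq.2 ((tri_pop hE₁.graph.n).mono ?_)
    rintro l₂ s₂ hf₂ ⟨hsp₂, htau₂, hl₂⟩
    have hE₂ := hE₁.frame hf₂ rfl rfl
    have hsub : s₁.v .sp - G.n = h * G.n := by rw [hsp₁, Nat.succ_mul]; omega
    rw [hsub] at hsp₂
    simp only [hsub] at htau₂
    have hstk₂ : s₂.a .stk = s₁.a .stk := hf₂.2 .stk rfl
    have hτ₂ : TauOK G k (s₂.a .tau) := fun v hv => by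
      rw [htau₂ v hv]; exact hok h (by omega) v hv
    have hentry : ∀ v < G.n, part dl (s₂.a .tau) v = stackEntry G dl (s₁.a .stk) h v := by
      intro v hv
      simp only [part, stackEntry, htau₂ v hv]
    have hpot : stackWeight G S dl U k q (s₁.a .stk) (s₁.v .sp / G.n) =
        stackWeight G S dl U k q (s₁.a .stk) h + weight U k q (G.bound S (part dl (s₂.a .tau))) := by
      rw [hsp₁, hdiv, stackWeight, Finset.sum_range_succ, bound_congr hentry]
      rfl
    rw [hpot]
    refine tri_seq.2 ((tri_sumCuts hE₂ hτ₂).mono ?_)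
    rintro l₃ s₃ hf₃ ⟨hp₃, hl₃⟩
    have hE₃ := hE₂.frame hf₃ rfl rfl
    have hq₃ : s₃.v .q = q := by rw [hf₃.1 .q rfl, hf₂.1 .q rfl, hf₁.1 .q rfl, hq]
    have hsp₃ : s₃.v .sp = h * G.n := (hf₃.1 .sp rfl).trans hsp₂
    have hstk₃ : s₃.a .stk = s₁.a .stk := (hf₃.2 .stk rfl).trans hstk₂
    have htau₃ : s₃.a .tau = s₂.a .tau := hf₃.2 .tau rfl
    have hans₃ : s₃.v .ans = 0 := by rw [hf₃.1 .ans rfl, hf₂.1 .ans rfl, hans₁]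
    refine tri_ite.2 ⟨fun hlt => ?_, fun hge => ?_⟩
    · have hlt' : q < G.bound S (part dl (s₂.a .tau)) := by
        by_contra hcon
        exact hlt ((AExp.eval_lt _ _ _).2 (by simpa [hq₃, hp₃] using hcon))
      refine tri_skip.2 ⟨⟨h, hsp₃, fun j hj => hstk₃ ▸ hok j (by omega), Or.inl ⟨hans₃, ?_⟩⟩, ?_⟩
      · rw [hI, hstk₃]
        constructor
        · rintro ⟨j, hj, hs⟩
          rcases Nat.lt_succ_iff_lt_or_eq.1 hj with h1 | rfl
          · exact ⟨j, h1, hs⟩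
          · rw [← solvable_congr hentry] at hs
            exact absurd hs.bound_le (by omega)
        · rintro ⟨j, hj, hs⟩
          exact ⟨j, by omega, hs⟩
      · rw [hstk₃, hsp₃, hdiv, weight, if_pos hlt']
        omega
    · have hle : G.bound S (part dl (s₂.a .tau)) ≤ q := by
        simpa [hq₃, hp₃] using hge
      rw [← htau₃] at hle hτ₂
      refine (tri_expand hS hE₃ hτ₂ hsp₃ hle).mono ?_
      rintro l₄ s₄ - ⟨hcase, hl₄⟩
      rw [htau₃] at hcase hle
      have hpos : U * k * 3 ≤ weight U k q (G.bound S (part dl (s₂.a .tau))) := weight_pos_le hle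
      have htot : l₂ + (l₃ + (l₄ + 1)) + 1 ≤ U * k * 3 := by omega
      rcases hcase with ⟨ha, hsp₄, hs⟩ | ⟨ha, hsp₄, hold, hnew, hiff⟩
      · refine ⟨⟨0, by simpa using hsp₄, fun j hj => by omega, Or.inr ⟨ha, rfl, ?_⟩⟩, ?_⟩
        · rw [hI]
          exact ⟨h, by omega, (solvable_congr hentry).1 hs⟩
        · have : stackWeight G S dl U k q (s₄.a .stk) (s₄.v .sp / G.n) = 0 := by
            simp [hsp₄, stackWeight]
          omega
      · rw [hstk₃] at hold
        refine ⟨⟨h + k, hsp₄, fun j hj => ?_, Or.inl ⟨ha.trans hans₃, ?_⟩⟩, ?_⟩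
        · by_cases hjh : j < h
          · intro v hv
            have hlt : j * G.n + v < h * G.n := by
              have := Nat.mul_le_mul_right G.n hjh
              rw [Nat.succ_mul] at this
              omega
            simp only [hold _ hlt]
            exact hok j (by omega) v hv
          · exact (hnew j (by omega) hj).1
        · rw [hI]
          constructor
          · rintro ⟨j, hj, hs⟩
            rcases Nat.lt_succ_iff_lt_or_eq.1 hj with h1 | rfl
            · exact ⟨j, by omega, (solvable_congr (stackEntry_congr h1 hold)).2 hs⟩
            · obtain ⟨i, -, hi, hs'⟩ := hiff.1 ((solvable_congr hentry).2 hs)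
              exact ⟨i, hi, hs'⟩
          · rintro ⟨j, hj, hs⟩
            by_cases hjh : j < h
            · exact ⟨j, by omega, (solvable_congr (stackEntry_congr hjh hold)).1 hs⟩
            · exact ⟨h, by omega, (solvable_congr hentry).1 (hiff.2 ⟨j, by omega, hj, hs⟩)⟩
        · rw [hsp₄, hdiv, stackWeight, Finset.sum_range_add]
          have h1 : ∑ j ∈ Finset.range h, weight U k q (G.bound S (stackEntry G dl (s₄.a .stk) j)) =
              stackWeight G S dl U k q (s₁.a .stk) h := stackWeight_congr hold
          have h2 : U * k * 3 + ∑ j ∈ Finset.range k,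
              weight U k q (G.bound S (stackEntry G dl (s₄.a .stk) (h + j))) ≤
              weight U k q (G.bound S (part dl (s₂.a .tau))) := by
            refine le_trans (Nat.add_le_add_left (Finset.sum_le_card_nsmul _ _
              (weight U k q (G.bound S (part dl (s₂.a .tau)) + 1)) fun j hj => ?_) _) ?_
            · exact weight_anti hk ((hnew (h + j) (by omega)
                (by have := Finset.mem_range.1 hj; omega)).2)
            · rw [Finset.card_range, smul_eq_mul]
              exact weight_branch hk hle (Nat.lt_succ_self _)
          omega
  · rintro l s' hf ⟨h, hsp', hok, hI⟩ he hl
    have h0 : h = 0 := by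
      have : h * G.n = 0 := by simpa [hsp'] using he
      simpa [hn.ne'] using this
    subst h0
    have hw : stackWeight G S dl U k q (s.a .stk) (s.v .sp / G.n) =
        weight U k q (G.bound S (part dl (s.a .stk))) := by
      rw [hsp, Nat.div_self hn, stackWeight, Finset.sum_range_one, h00]
    refine ⟨?_, by omega⟩
    rcases hI with ⟨h1, h2⟩ | ⟨h1, -, h2⟩
    · rw [if_neg, h1]
      rw [h2]
      rintro ⟨j, hj, -⟩
      omega
    · rw [if_pos h2, h1]

end ZeroExt

/-! ### Splits of trees -/

namespace Splits

variable {W : Type*} {T : SimpleGraph W} {S : Splits W}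

/-- The splits are those that the edges of the tree `T` induce: every edge is separated by exactly
one split, and every split that is not trivial separates the ends of exactly one edge. -/
structure OfTree (T : SimpleGraph W) (S : Splits W) : Prop where
  adj : ∀ a b, T.Adj a b → ∃ x < S.t, ¬ (S.σ x a ↔ S.σ x b) ∧
    ∀ y < S.t, y ≠ x → (S.σ y a ↔ S.σ y b)
  edge : ∀ x < S.t, (∀ y z, S.σ x y ↔ S.σ x z) ∨ ∃ a b, T.Adj a b ∧ S.σ x a ∧ ¬ S.σ x b ∧
    ∀ c d, T.Adj c d → S.σ x c → ¬ S.σ x d → c = a ∧ d = b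

/-- A walk that does not contain the vertex `c` of the edge of a split stays on one side. -/
theorem walk_const {P : W → Prop} {c : W} (hP : ∀ a b, T.Adj a b → P a → ¬ P b → a = c ∨ b = c)
    {u v : W} (p : T.Walk u v) (hc : c ∉ p.support) : P u ↔ P v := by
  induction p with
  | nil => rfl
  | @cons u v w h p ih =>
    rw [SimpleGraph.Walk.support_cons, List.mem_cons, not_or] at hc
    have hv : c ≠ v := fun h => hc.2 (h ▸ p.start_mem_support)
    rw [← ih hc.2]
    by_contra hne
    rcases not_iff.1 hne |>.symm with hne
    by_cases hu : P u
    · have hv' : ¬ P v := by tauto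
      rcases hP u v h hu hv' with h | h
      · exact hc.1 h.symm
      · exact hv h.symm
    · have hv' : P v := by tauto
      rcases hP v u h.symm hv' hu with h | h
      · exact hv h.symm
      · exact hc.1 h.symm

namespace OfTree

variable (h : S.OfTree T)
include h

/-- The edge from `a` to `b` is the only one that a split separating `a` from `b` separates. -/
theorem eq_of_sep {a b c d : W} {x : ℕ} (hx : x < S.t) (hab : T.Adj a b) (ha : S.σ x a)
    (hb : ¬ S.σ x b) (hcd : T.Adj c d) (hc : S.σ x c) (hd : ¬ S.σ x d) : c = a ∧ d = b := by
  rcases h.edge x hx with h1 | ⟨a', b', -, -, -, h1⟩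
  · exact absurd ((h1 a b).1 ha) hb
  · obtain ⟨rfl, rfl⟩ := h1 _ _ hab ha hb
    exact h1 _ _ hcd hc hd

/-- The split of the first edge of a path separates the start from all other vertices. -/
theorem path_const {a b z : W} {x : ℕ} (hx : x < S.t) (hab : T.Adj a b)
    (hs : ¬ (S.σ x a ↔ S.σ x b)) (p : T.Walk b z) (hp : a ∉ p.support) : S.σ x b ↔ S.σ x z := by
  refine walk_const (c := a) (fun c d hcd hc hd => ?_) p hp
  by_cases ha : S.σ x a
  · exact Or.inl (h.eq_of_sep hx hab ha (by tauto) hcd hc hd).1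
  · exact Or.inr (h.eq_of_sep hx hab.symm (by tauto) ha hcd hc hd).2

open scoped Classical in
theorem path_length {y z : W} (p : T.Walk y z) (hp : p.IsPath) :
    p.length = ((Finset.range S.t).filter fun x => ¬ (S.σ x y ↔ S.σ x z)).card := by
  induction p with
  | nil => simp
  | @cons y w z hadj p ih =>
    rw [SimpleGraph.Walk.cons_isPath_iff] at hp
    obtain ⟨x, hx, hs, hu⟩ := h.adj y w hadj
    have hc := h.path_const hx hadj hs p hp.2
    have : ((Finset.range S.t).filter fun x => ¬ (S.σ x y ↔ S.σ x z)) =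
        insert x ((Finset.range S.t).filter fun x => ¬ (S.σ x w ↔ S.σ x z)) := by
      ext i
      simp only [Finset.mem_filter, Finset.mem_range, Finset.mem_insert]
      by_cases hi : i = x
      · subst hi
        simp only [hx, true_and, true_or, iff_true]
        tauto
      · simp only [hi, false_or]
        by_cases hit : i < S.t
        · rw [hu i hit hi]
        · simp [hit]
    rw [this, Finset.card_insert_of_notMem, SimpleGraph.Walk.length_cons, ih hp.1]
    simp [hc]

open scoped Classical in
/-- The distance in the tree is the number of splits that separate the two nodes. -/
theorem dist_eq (hT : T.IsTree) (y z : W) :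
    T.dist y z = ((Finset.range S.t).filter fun x => ¬ (S.σ x y ↔ S.σ x z)).card := by
  obtain ⟨p, hp, hl⟩ := (hT.connected.preconnected y z).exists_path_of_dist
  rw [← hl, h.path_length p hp]

/-- If the edge of the split `y` is on the side of `a` of the split `x`, then the other side, that of
`b`, is constant for `y`. -/
theorem side_const (hT : T.IsTree) {a b c d z : W} {x y : ℕ} (hx : x < S.t) (hy : y < S.t)
    (hsx : ¬ (S.σ x a ↔ S.σ x b)) (hcd : T.Adj c d) (hc : S.σ y c)
    (hd : ¬ S.σ y d) (hca : S.σ x c ↔ S.σ x a) (hz : S.σ x z ↔ S.σ x b) :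
    S.σ y z ↔ S.σ y b := by
  obtain ⟨p, hp, -⟩ := (hT.connected.preconnected z b).exists_path_of_dist
  refine walk_const (c := c) (fun c' d' h1 h2 h3 =>
    Or.inl (h.eq_of_sep hy hcd hc hd h1 h2 h3).1) p fun hcp => ?_
  -- A path with both ends on the side of `b` through `c` would contain the edge of `x` twice.
  classical
  have h1 := h.path_length _ (hp.takeUntil hcp)
  have h2 := h.path_length _ (hp.dropUntil hcp)
  have h3 := h.path_length _ hp
  have h4 : (p.takeUntil c hcp).length + (p.dropUntil c hcp).length = p.length := by
    rw [← SimpleGraph.Walk.length_append, SimpleGraph.Walk.take_spec]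
  have h5 : ((Finset.range S.t).filter fun x => ¬ (S.σ x z ↔ S.σ x b)) ⊆
      (((Finset.range S.t).filter fun x => ¬ (S.σ x z ↔ S.σ x c)) ∪
      ((Finset.range S.t).filter fun x => ¬ (S.σ x c ↔ S.σ x b))).erase x := by
    intro i
    simp only [Finset.mem_filter, Finset.mem_range, Finset.mem_erase, Finset.mem_union]
    rintro ⟨hi, hs⟩
    refine ⟨by rintro rfl; exact hs hz, ?_⟩
    by_cases h6 : S.σ i z ↔ S.σ i c
    · exact Or.inr ⟨hi, by tauto⟩
    · exact Or.inl ⟨hi, h6⟩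
  have h6 := Finset.card_le_card h5
  rw [Finset.card_erase_of_mem (by simp [hx]; tauto)] at h6
  have h7 := Finset.card_union_le
    ((Finset.range S.t).filter fun x => ¬ (S.σ x z ↔ S.σ x c))
    ((Finset.range S.t).filter fun x => ¬ (S.σ x c ↔ S.σ x b))
  have h8 : 0 < (((Finset.range S.t).filter fun x => ¬ (S.σ x z ↔ S.σ x c)) ∪
      ((Finset.range S.t).filter fun x => ¬ (S.σ x c ↔ S.σ x b))).card :=
    Finset.card_pos.2 ⟨x, by simp [hx]; tauto⟩
  omega

theorem isTree (hT : T.IsTree) : S.IsTree where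
  edge x hx := by
    rcases h.edge x hx with h1 | ⟨a, b, hab, ha, hb, -⟩
    · exact Or.inl h1
    · refine Or.inr ⟨a, b, ha, hb, fun y hy hne => ?_⟩
      obtain ⟨x', hx', -, hu⟩ := h.adj a b hab
      by_cases hxx : x = x'
      · exact hu y hy (hxx ▸ hne)
      · exact absurd ((hu x hx hxx).1 ha) hb
  cross x hx y hy hne a b he := by
    have hy' := he.2.2 y hy hne.symm
    rcases h.edge y hy with h1 | ⟨c, d, hcd, hc, hd, -⟩
    · exact Or.inl fun z _ => h1 z a
    have hsx : ¬ (S.σ x a ↔ S.σ x b) := fun hi => he.2.1 (hi.1 he.1)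
    by_cases hcx : S.σ x c
    · refine Or.inr fun z hz => ?_
      rw [hy']
      exact h.side_const hT hx hy hsx hcd hc hd (by simp [hcx, he.1]) (by simp [hz, he.2.1])
    · refine Or.inl fun z hz => ?_
      exact h.side_const hT hx hy (fun hi => hsx hi.symm) hcd hc hd (by simp [hcx, he.2.1])
        (by simp [hz, he.1])
  incident d z hne := by
    obtain ⟨p, hp, -⟩ := (hT.connected.preconnected d z).exists_path_of_dist
    cases p with
    | nil => exact absurd rfl hne
    | @cons _ w _ hadj p =>
      rw [SimpleGraph.Walk.cons_isPath_iff] at hp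
      obtain ⟨x, hx, hs, hu⟩ := h.adj d w hadj
      have hc := h.path_const hx hadj hs p hp.2
      refine ⟨x, hx, ⟨w, ?_⟩, by tauto⟩
      by_cases hd : S.σ x d
      · exact Or.inl ⟨hd, by tauto, hu⟩
      · exact Or.inr ⟨by tauto, hd, fun y hy hne => (hu y hy hne).symm⟩

end OfTree

end Splits

/-- A stage of the pruning of the tree `T`: `R` is the set of remaining nodes, `m` maps every node
to the remaining node in whose branch it lies, and `σ x` is the branch of the node `x`, which is
fixed when `x` is removed. -/
structure Pruned {W : Type*} (T : SimpleGraph W) (R : Finset W) (m : W → W) (σ : W → W → Prop) :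
    Prop where
  m_mem : ∀ z, m z ∈ R
  m_self : ∀ z ∈ R, m z = z
  branch : ∀ x ∈ R, ∀ z, σ x z ↔ m z = x
  cross : ∀ a b, T.Adj a b → m a ≠ m b → a ∈ R ∧ b ∈ R
  /-- an edge between remaining nodes is not separated by the branch of a removed node -/
  inner : ∀ a b, T.Adj a b → a ∈ R → b ∈ R → ∀ x ∉ R, (σ x a ↔ σ x b)
  /-- any other edge is separated by the branch of exactly one removed node -/
  outer : ∀ a b, T.Adj a b → ¬ (a ∈ R ∧ b ∈ R) → ∃ x ∉ R, ¬ (σ x a ↔ σ x b) ∧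
    ∀ y ∉ R, y ≠ x → (σ y a ↔ σ y b)
  edge : ∀ x ∉ R, ∃ a b, T.Adj a b ∧ σ x a ∧ ¬ σ x b ∧
    ∀ c d, T.Adj c d → σ x c → ¬ σ x d → c = a ∧ d = b

namespace Pruned

variable {W : Type*} {T : SimpleGraph W} {R : Finset W} {m : W → W} {σ : W → W → Prop}

theorem start [Fintype W] (T : SimpleGraph W) : Pruned T Finset.univ id fun x z => z = x := by
  constructor <;> simp

/-- Removing the leaf `y` with the remaining neighbour `z`. -/
theorem remove [DecidableEq W] (h : Pruned T R m σ) {y z : W} (hy : y ∈ R) (hz : z ∈ R)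
    (hyz : T.Adj y z) (hu : ∀ b ∈ R, T.Adj y b → b = z) :
    Pruned T (R.erase y) (fun w => if m w = y then z else m w)
      fun x w => if x = z then σ z w ∨ σ y w else σ x w := by
  have hne : z ≠ y := hyz.ne'
  -- The edge from `y` to `z` is the only one that leaves the branch of `y`.
  have hleave : ∀ c d, T.Adj c d → m c = y → m d ≠ y → c = y ∧ d = z := by
    intro c d hcd hc hd
    obtain ⟨h1, h2⟩ := h.cross c d hcd (by rw [hc]; exact hd.symm)
    rw [h.m_self c h1] at hc
    subst hc
    exact ⟨rfl, hu d h2 hcd⟩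
  constructor
  · intro w
    split_ifs with hw
    · simp [hne, hz]
    · simp [hw, h.m_mem w]
  · intro w hw
    simp only [Finset.mem_erase] at hw
    rw [h.m_self w hw.2, if_neg hw.1]
  · intro x hx w
    simp only [Finset.mem_erase] at hx
    by_cases hxz : x = z
    · subst hxz
      simp only [if_true, h.branch _ hz, h.branch _ hy]
      by_cases hw : m w = y <;> simp [hw]
    · simp only [if_neg hxz, h.branch _ hx.2]
      by_cases hw : m w = y
      · simp [hw, hx.1.symm, Ne.symm hxz]
      · simp [hw]
  · intro a b hab hmab
    have hm : m a ≠ m b := by intro hm; simp [hm] at hmab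
    obtain ⟨ha, hb⟩ := h.cross a b hab hm
    simp only [h.m_self a ha, h.m_self b hb] at hmab hm
    simp only [Finset.mem_erase]
    refine ⟨⟨?_, ha⟩, ?_, hb⟩
    · rintro rfl
      obtain rfl := hu b hb hab
      simp [hne] at hmab
    · rintro rfl
      obtain rfl := hu a ha hab.symm
      simp [hne] at hmab
  · intro a b hab ha hb x hx
    simp only [Finset.mem_erase, not_and_or, not_not] at ha hb hx
    have hxz : x ≠ z := by rintro rfl; tauto
    simp only [if_neg hxz]
    rcases hx with rfl | hx
    · simp only [h.branch _ hy, h.m_self a ha.2, h.m_self b hb.2]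
      tauto
    · exact h.inner a b hab ha.2 hb.2 x hx
  · intro a b hab hn
    by_cases hR : a ∈ R ∧ b ∈ R
    · refine ⟨y, by simp, ?_, fun x hx hxy => ?_⟩
      · simp only [if_neg hne.symm, h.branch _ hy, h.m_self a hR.1, h.m_self b hR.2]
        simp only [Finset.mem_erase] at hn
        intro hi
        have hay : a ≠ y := fun ha => hab.ne (ha.trans (hi.1 ha).symm)
        exact hn ⟨⟨hay, hR.1⟩, fun hb => hay (hi.2 hb), hR.2⟩
      · have hxR : x ∉ R := by simpa [hxy] using hx
        have hxz : x ≠ z := by rintro rfl; exact hxR hz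
        simp only [if_neg hxz]
        exact h.inner a b hab hR.1 hR.2 x hxR
    · obtain ⟨x, hx, hs, hx'⟩ := h.outer a b hab hR
      have hxz : x ≠ z := by rintro rfl; exact hx hz
      refine ⟨x, by simp [hx], by simpa only [if_neg hxz] using hs, fun w hw hwx => ?_⟩
      have hwz : w ≠ z := by
        rintro rfl
        simp [hne, hz] at hw
      simp only [if_neg hwz]
      by_cases hwR : w ∈ R
      · obtain rfl : w = y := by simpa [hwR] using hw
        rw [h.branch _ hy, h.branch _ hy]
        by_contra hcon
        have : m a = m b := by
          by_contra hm
          exact hR (h.cross a b hab hm)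
        exact hcon (by rw [this])
      · exact hx' w hwR hwx
  · intro x hx
    by_cases hxR : x ∈ R
    · obtain rfl : x = y := by simpa [hxR] using hx
      refine ⟨x, z, hyz, ?_⟩
      simp only [if_neg hne.symm, h.branch _ hy, h.m_self _ hz, h.m_self _ hy, true_and]
      exact ⟨hne, hleave⟩
    · have hxz : x ≠ z := by rintro rfl; exact hxR hz
      simp only [if_neg hxz]
      exact h.edge x hxR

/-- If no neighbour of `y` remains then only `y` remains. -/
theorem eq_singleton (h : Pruned T R m σ) (hT : T.Connected) {y : W} (hy : y ∈ R)
    (hu : ∀ b ∈ R, ¬ T.Adj y b) : R = {y} := by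
  have hstep : ∀ a b, T.Adj a b → m a = y → m b = y := by
    intro a b hab ha
    by_contra hb
    obtain ⟨h1, h2⟩ := h.cross a b hab (by rw [ha]; exact Ne.symm hb)
    rw [h.m_self a h1] at ha
    exact hu b h2 (ha ▸ hab)
  have hwalk : ∀ a b, T.Walk a b → m a = y → m b = y := by
    intro a b p
    induction p with
    | nil => exact id
    | cons hab _ ih => exact fun ha => ih (hstep _ _ hab ha)
  refine Finset.eq_singleton_iff_unique_mem.2 ⟨hy, fun z hz => ?_⟩
  obtain ⟨p⟩ := hT.preconnected y z
  rw [← h.m_self z hz]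
  exact hwalk y z p (h.m_self y hy)

/-- The splits of a completely pruned tree. The branch of the last node is everything, which is a
trivial split. -/
def splits {t : ℕ} (σ : Fin t → Fin t → Prop) : Splits (Fin t) where
  t := t
  σ x y := ∃ h : x < t, σ ⟨x, h⟩ y

theorem splits_ofTree {t : ℕ} {T : SimpleGraph (Fin t)} {m : Fin t → Fin t}
    {σ : Fin t → Fin t → Prop} {r : Fin t} (h : Pruned T {r} m σ) : (splits σ).OfTree T := by
  have hσ : ∀ (x : Fin t) y, (splits σ).σ x y ↔ σ x y := fun x y =>
    ⟨fun ⟨_, h⟩ => h, fun h => ⟨x.2, h⟩⟩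
  have hm : ∀ z, m z = r := fun z => Finset.mem_singleton.1 (h.m_mem z)
  have hr : ∀ y, σ r y := fun y => (h.branch r (by simp) y).2 (hm y)
  constructor
  · intro a b hab
    have hn : ¬ (a ∈ ({r} : Finset (Fin t)) ∧ b ∈ ({r} : Finset (Fin t))) := by
      simp only [Finset.mem_singleton]
      rintro ⟨rfl, rfl⟩
      exact hab.ne rfl
    obtain ⟨x, -, hs, hu⟩ := h.outer a b hab hn
    refine ⟨x, x.2, by rwa [hσ, hσ], fun y hy hne => ?_⟩
    have h1 := hσ ⟨y, hy⟩
    simp only at h1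
    rw [h1, h1]
    by_cases hyr : (⟨y, hy⟩ : Fin t) = r
    · simp [hyr, hr]
    · exact hu _ (by simpa using hyr) fun h => hne (congrArg Fin.val h)
  · intro x hx
    have h1 := hσ ⟨x, hx⟩
    simp only at h1
    simp only [h1]
    by_cases hxr : (⟨x, hx⟩ : Fin t) = r
    · exact Or.inl fun y z => by simp [hxr, hr]
    · exact Or.inr (h.edge _ (by simpa using hxr))

end Pruned

/-! ### Pruning the tree -/

namespace ZeroExt

open Imp ArcGraph

/-- Remove the leaf `y` from the tree, and continue with its neighbour. -/
def removeLeaf : Cmd :=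
  .z ≔ Arr.sm.at Var.y ;;
  .store .dg Var.y 0 ;;
  .store .dg Var.z (Arr.dg.at Var.z - 1) ;;
  .store .sm Var.z (Arr.sm.at Var.z - Var.y) ;;
  .for .i Var.k
    (.ite (.eq (Arr.bl.at (Arr.off.at Var.y + Var.i)) 1)
      (.store .bl (Arr.off.at Var.z + Var.i) 1) .skip) ;;
  .y ≔ Var.z

/-- Remove leaves as long as there are any. -/
def prune : Cmd :=
  .for .x Var.t (.y ≔ Var.x ;; .while (.eq (Arr.dg.at Var.y) 1) removeLeaf)

theorem index_inj {k x y i j : ℕ} (hi : i < k) (hj : j < k) (h : x * k + i = y * k + j) :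
    x = y ∧ i = j := by
  have h1 : (x * k + i) / k = x := by
    rw [Nat.add_comm, Nat.add_mul_div_right _ _ (by omega), Nat.div_eq_of_lt hi, Nat.zero_add]
  have h2 : (y * k + j) / k = y := by
    rw [Nat.add_comm, Nat.add_mul_div_right _ _ (by omega), Nat.div_eq_of_lt hj, Nat.zero_add]
  rw [h, h2] at h1
  subst h1
  exact ⟨rfl, by omega⟩

variable {t : ℕ} {T : SimpleGraph (Fin t)} {R : Finset (Fin t)} {m : Fin t → Fin t}
  {σ : Fin t → Fin t → Prop} {k : ℕ} {dl : ℕ → Fin t}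

open scoped Classical in
/-- The memory describes a stage of the pruning of the tree `T`. For the remaining nodes, the array
`dg` holds the number and the array `sm` the sum of the remaining neighbours. -/
structure PruneOK (T : SimpleGraph (Fin t)) (dl : ℕ → Fin t) (k : ℕ) (R : Finset (Fin t))
    (m : Fin t → Fin t) (σ : Fin t → Fin t → Prop) (s : Mem) : Prop where
  pruned : Pruned T R m σ
  t_eq : s.v .t = t
  k_eq : s.v .k = k
  off : ∀ x : Fin t, s.a .off x = x * k
  bl : ∀ x : Fin t, ∀ i < k, s.a .bl (x * k + i) = if σ x (dl i) then 1 else 0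
  dg : ∀ y ∈ R, s.a .dg y = (R.filter fun b => T.Adj y b).card
  dg_zero : ∀ y ∉ R, s.a .dg y = 0
  sm : ∀ y ∈ R, s.a .sm y = ∑ b ∈ R.filter fun b => T.Adj y b, b.val
  sum : ∑ y : Fin t, s.a .dg y + 2 = 2 * R.card

theorem tri_removeLeaf {s : Mem} (h : PruneOK T dl k R m σ s) {y : Fin t} (hy : s.v .y = y)
    (h1 : s.a .dg y = 1) :
    Tri removeLeaf s fun l s' => ∃ (R' : Finset (Fin t)) (m' : Fin t → Fin t)
      (σ' : Fin t → Fin t → Prop) (z : Fin t), PruneOK T dl k R' m' σ' s' ∧ s'.v .y = z ∧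
      (∀ w, w ≠ z → w ≠ y → s'.a .dg w = s.a .dg w) ∧ s'.a .dg y = 0 ∧
      ∑ y : Fin t, s'.a .dg y + 2 ≤ ∑ y : Fin t, s.a .dg y ∧ l ≤ 7 + k * 4 := by
  classical
  have hyR : y ∈ R := by
    by_contra hyR
    rw [h.dg_zero y hyR] at h1
    omega
  rw [h.dg y hyR, Finset.card_eq_one] at h1
  obtain ⟨z, hz⟩ := h1
  have hz' : ∀ b, b ∈ R ∧ T.Adj y b ↔ b = z := by
    intro b
    have := Finset.ext_iff.1 hz b
    simpa using this
  obtain ⟨hzR, hyz⟩ := (hz' z).2 rfl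
  have hsm : s.a .sm y = z := by rw [h.sm y hyR, hz, Finset.sum_singleton]
  have hne : (z : ℕ) ≠ y := fun he => hyz.ne' (Fin.ext he)
  have hfil : ∀ w, (R.erase y).filter (fun b => T.Adj w b) =
      (R.filter fun b => T.Adj w b).erase y := fun w => Finset.filter_erase _ _ _
  have hfar : ∀ w ∈ R.erase y, w ≠ z → y ∉ R.filter fun b => T.Adj w b := by
    intro w hw hwz hmem
    simp only [Finset.mem_filter, Finset.mem_erase] at hw hmem
    exact hwz ((hz' w).1 ⟨hw.2, hmem.2.symm⟩)
  have hnear : y ∈ R.filter fun b => T.Adj z b := by simp [hyR, hyz.symm]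
  have hcard : (R.erase y).card + 1 = R.card := Finset.card_erase_add_one hyR
  refine tri_seq.2 (tri_assign.2 (tri_seq.2 (tri_store.2 (tri_seq.2 (tri_store.2 (tri_seq.2
    (tri_store.2 (tri_seq.2 ?_))))))))
  refine tri_for (I := fun i s' => (∀ x : Fin t, x ≠ z → ∀ j < k, s'.a .bl (x * k + j) =
    s.a .bl (x * k + j)) ∧ ∀ j < k, s'.a .bl (z * k + j) =
      if j < i ∧ s.a .bl (y * k + j) = 1 then 1 else s.a .bl (z * k + j)) k 2 ?_ ?_ ?_ ?_
  · intro i s' _ _ hf _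
    rw [AExp.eval_var, hf.1 .k rfl]
    simpa using h.k_eq
  · simp
  · rintro i s' hi hv hf ⟨hI1, hI2⟩
    have e1 : s'.v .y = y := (hf.1 .y rfl).trans (by simp [hy])
    have e2 : s'.v .z = z := (hf.1 .z rfl).trans (by simp [hy, hsm])
    have e3 : s'.a .off = s.a .off := (hf.2 .off rfl).trans (by simp)
    have e4 := hI1 y hyz.ne i hi
    simp [hv, e1, e2, e3, h.off, e4]
    refine ⟨fun hb => ⟨fun x hx j hj => ?_, fun j hj => ?_⟩, fun hb => ⟨hI1, fun j hj => ?_⟩⟩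
    · rw [Function.update_of_ne, hI1 x hx j hj]
      intro he
      exact hx (Fin.ext (index_inj hj hi he).1)
    · rw [Function.update_apply]
      split_ifs with he h2 h2
      · rfl
      · obtain rfl := (index_inj hj hi he).2
        exact absurd ⟨le_rfl, hb⟩ h2
      · rw [hI2 j hj]
        by_cases hji : j = i
        · exact absurd (by rw [hji]) he
        · rw [if_pos ⟨by omega, h2.2⟩]
      · rw [hI2 j hj, if_neg]
        rintro ⟨h3, h4⟩
        exact h2 ⟨by omega, h4⟩
    · rw [hI2 j hj]
      by_cases hji : j = i
      · subst hji; simp [hb]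
      · have : j ≤ i ↔ j < i := by omega
        simp [this]
  · rintro l s' hf ⟨hI1, hI2⟩ - hl
    have e2 : s'.v .z = z := (hf.1 .z rfl).trans (by simp [hy, hsm])
    have e5 : s'.a .dg = Function.update (Function.update (s.a .dg) y 0) z (s.a .dg z - 1) := by
      rw [hf.2 .dg rfl]
      simp [hy, hsm, hne]
    have e6 : s'.a .sm = Function.update (s.a .sm) z (s.a .sm z - y) := by
      rw [hf.2 .sm rfl]
      simp [hy, hsm]
    have e7 : ∀ w : Fin t, w ≠ z → w ≠ y → s'.a .dg w = s.a .dg w := by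
      intro w hwz hwy
      rw [e5, Function.update_of_ne (fun he => hwz (Fin.ext he)),
        Function.update_of_ne (fun he => hwy (Fin.ext he))]
    have e8 : s'.a .dg y = 0 := by
      rw [e5, Function.update_of_ne hne.symm, Function.update_self]
    have e9 : s'.a .dg z + 1 = s.a .dg z := by
      rw [e5, Function.update_self, h.dg z hzR]
      have := Finset.card_pos.2 ⟨y, hnear⟩
      omega
    have hsum : ∑ w : Fin t, s'.a .dg w + 2 = ∑ w : Fin t, s.a .dg w := by
      have h2 : ∀ f : ℕ → ℕ, ∑ w : Fin t, f w =
          f y + (f z + ∑ w ∈ (Finset.univ.erase y).erase z, f w) := by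
        intro f
        rw [← Finset.add_sum_erase Finset.univ (fun w : Fin t => f w) (Finset.mem_univ y),
          ← Finset.add_sum_erase (Finset.univ.erase y) (fun w : Fin t => f w) (a := z)
            (by simp [hyz.ne'])]
      rw [h2, h2 (s.a .dg), e8, ← e9, h.dg y hyR, hz, Finset.card_singleton]
      have : ∑ w ∈ (Finset.univ.erase y).erase z, s'.a .dg w =
          ∑ w ∈ (Finset.univ.erase y).erase z, s.a .dg w := by
        refine Finset.sum_congr rfl fun w hw => e7 w ?_ ?_ <;> simp at hw <;> tauto
      omega
    refine tri_assign.2 ⟨R.erase y, _, _, z, ⟨h.pruned.remove hyR hzR hyz fun b hb hyb =>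
      (hz' b).1 ⟨hb, hyb⟩, ?_, ?_, fun x => ?_, fun x i hi => ?_, fun w hw => ?_, fun w hw => ?_,
      fun w hw => ?_, ?_⟩, by simpa using e2, e7, e8, hsum.le, by omega⟩
    · simpa using (hf.1 .t rfl).trans (by simpa using h.t_eq)
    · simpa using (hf.1 .k rfl).trans (by simpa using h.k_eq)
    · simpa using (congrFun (hf.2 .off rfl) x).trans (by simpa using h.off x)
    · rw [Store.setV_a]
      by_cases hx : x = z
      · subst hx
        rw [hI2 i hi, h.bl y i hi, h.bl x i hi]
        simp only [hi, true_and, if_true]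
        by_cases h3 : σ y (dl i) <;> by_cases h4 : σ x (dl i) <;> simp [h3, h4]
      · rw [hI1 x hx i hi, h.bl x i hi, if_neg hx]
    · rw [Store.setV_a, hfil]
      by_cases hwz : w = z
      · subst hwz
        have := Finset.card_erase_add_one hnear
        rw [h.dg _ hzR] at e9
        omega
      · rw [e7 w hwz (by simp at hw; exact hw.1), h.dg w (by simp at hw; exact hw.2),
          Finset.erase_eq_of_notMem (hfar w hw hwz)]
    · rw [Store.setV_a]
      by_cases hwy : w = y
      · rw [hwy, e8]
      · have hwR : w ∉ R := by simpa [hwy] using hw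
        rw [e7 w (by rintro rfl; exact hwR hzR) hwy, h.dg_zero w hwR]
    · rw [Store.setV_a, hfil, e6]
      by_cases hwz : w = z
      · subst hwz
        have := Finset.sum_erase_add (R.filter fun b => T.Adj w b) (fun b => b.val) hnear
        rw [Function.update_self, h.sm _ hzR]
        omega
      · rw [Function.update_of_ne (fun he => hwz (Fin.ext he)), h.sm w (by simp at hw; exact hw.2),
          Finset.erase_eq_of_notMem (hfar w hw hwz)]
    · have := h.sum
      rw [Store.setV_a]
      omega

/-- If no leaf is left then only one node remains. -/
theorem PruneOK.eq_singleton {s : Mem} (h : PruneOK T dl k R m σ s) (hT : T.Connected)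
    (h1 : ∀ y : Fin t, s.a .dg y ≠ 1) : ∃ r, R = {r} := by
  classical
  by_contra! hne
  have h2 : ∀ y ∈ R, 2 ≤ s.a .dg y := by
    intro y hy
    have h3 : s.a .dg y ≠ 0 := by
      rw [h.dg y hy, Finset.card_ne_zero]
      by_contra hemp
      rw [Finset.not_nonempty_iff_eq_empty] at hemp
      refine hne y (h.pruned.eq_singleton hT hy fun b hb hyb => ?_)
      have : b ∈ R.filter fun b => T.Adj y b := by simp [hb, hyb]
      rw [hemp] at this
      simp at this
    have := h1 y
    omega
  have h3 : ∑ y ∈ R, 2 ≤ ∑ y ∈ R, s.a .dg y := Finset.sum_le_sum h2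
  have h4 : ∑ y ∈ R, s.a .dg y ≤ ∑ y : Fin t, s.a .dg y :=
    Finset.sum_le_sum_of_subset (Finset.subset_univ _)
  have h5 := h.sum
  simp at h3
  omega

theorem tri_prune {s : Mem} (h : PruneOK T dl k R m σ s) (hT : T.Connected) :
    Tri prune s fun l s' => ∃ r m' σ', PruneOK T dl k {r} m' σ' s' ∧
      l ≤ 2 + t * 4 + (k * 4 + 8) * ∑ y : Fin t, s.a .dg y := by
  refine tri_for_pot (I := fun i s' => ∃ R m σ, PruneOK T dl k R m σ s' ∧
    ∀ y : Fin t, y.val < i → s'.a .dg y ≠ 1)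
    (pot := fun s' => (k * 4 + 8) * ∑ y : Fin t, s'.a .dg y) t 2 ?_ ?_ ?_ ?_
  · rintro i s' _ _ _ ⟨R, m, σ, h', -⟩
    exact h'.t_eq
  · refine ⟨R, m, σ, ?_, by omega⟩
    exact ⟨h.pruned, by simpa using h.t_eq, by simpa using h.k_eq, h.off, h.bl, h.dg, h.dg_zero,
      h.sm, h.sum⟩
  · rintro i s₁ hi hv hf ⟨R, m, σ, h₁, hlt⟩
    refine tri_seq.2 (tri_assign.2 ?_)
    refine tri_while (I := fun s' => s'.v .x = i ∧ ∃ R m σ, PruneOK T dl k R m σ s' ∧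
      ∃ y : Fin t, s'.v .y = y ∧ ∀ w : Fin t, w.val ≤ i → w ≠ y → s'.a .dg w ≠ 1)
      (pot := fun s' => (k * 4 + 8) * ∑ y : Fin t, s'.a .dg y) ?_ ?_ ?_
    · refine ⟨by simpa using hv, R, m, σ, ⟨h₁.pruned, by simpa using h₁.t_eq,
        by simpa using h₁.k_eq, h₁.off, h₁.bl, h₁.dg, h₁.dg_zero, h₁.sm, h₁.sum⟩, ⟨i, hi⟩,
        by simp [hv], fun w hw hne => ?_⟩
      rcases Nat.lt_or_eq_of_le hw with hlt' | he
      · exact hlt w hlt'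
      · exact absurd (Fin.ext he) hne
    · rintro s₂ - ⟨hx, R, m, σ, h₂, y, hy, hdg⟩ he
      have h1 : s₂.a .dg y = 1 := by
        by_contra hne
        exact he ((AExp.eval_eq _ _ _).2 (by simpa [hy] using hne))
      refine (tri_removeLeaf h₂ hy h1).mono ?_
      rintro l s₃ hf₃ ⟨R', m', σ', z, h₃, hz, hsame, hzero, hsum, hl⟩
      refine ⟨⟨(hf₃.1 .x rfl).trans hx, R', m', σ', h₃, z, hz, fun w hw hne => ?_⟩, ?_⟩
      · by_cases hwy : w = y
        · rw [hwy, hzero]; omega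
        · rw [hsame w hne hwy]
          exact hdg w hw hwy
      · have := Nat.mul_le_mul_left (k * 4 + 8) hsum
        rw [Nat.mul_add] at this
        omega
    · rintro l s₂ - ⟨hx, R, m, σ, h₂, y, hy, hdg⟩ he hl
      rw [Store.setV_a] at hl
      refine ⟨hx, by rw [Store.setV_a]; omega, R, m, σ, ⟨h₂.pruned, by simpa using h₂.t_eq,
        by simpa using h₂.k_eq, h₂.off, h₂.bl, h₂.dg, h₂.dg_zero, h₂.sm, h₂.sum⟩, fun w hw => ?_⟩
      by_cases hwy : w = y
      · rw [AExp.eval_eq] at he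
        simpa [hy, hwy] using he
      · exact hdg w (by omega) hwy
  · rintro l s' hf ⟨R, m, σ, h', hlt⟩ - hl
    obtain ⟨r, rfl⟩ := h'.eq_singleton hT fun y => hlt y y.2
    refine ⟨r, m, σ, h', ?_⟩
    rw [Store.setV_a] at hl
    omega

end ZeroExt

/-! ### Reading the input -/

namespace ListsEdges

variable {V : Type*} {G : SimpleGraph V} {es : List (V × V)}

theorem sum_map [Fintype G.edgeSet] (h : ListsEdges es G) (F : Sym2 V → ℕ) :
    (es.map fun e => F s(e.1, e.2)).sum = ∑ e ∈ G.edgeFinset, F e := by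
  classical
  have h1 : (es.map fun e => s(e.1, e.2)).toFinset = G.edgeFinset := by
    ext e
    rw [List.mem_toFinset, h.2, SimpleGraph.mem_edgeFinset]
  rw [← h1, List.sum_toFinset _ h.1, List.map_map]
  rfl

theorem adj (h : ListsEdges es G) {e : V × V} (he : e ∈ es) : G.Adj e.1 e.2 := by
  rw [← SimpleGraph.mem_edgeSet, ← h.2]
  exact List.mem_map_of_mem he

theorem length_eq [Fintype G.edgeSet] (h : ListsEdges es G) : es.length = G.edgeFinset.card := by
  rw [Finset.card_eq_sum_ones, ← h.sum_map fun _ => 1]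
  simp

open scoped Classical in
/-- The sum of the weights of the neighbours of `y`, edge by edge. -/
theorem sum_neighbors [Fintype V] (h : ListsEdges es G) (g : V → ℕ) (y : V) :
    (es.map fun e => (if e.1 = y then g e.2 else 0) + if e.2 = y then g e.1 else 0).sum =
      ∑ b with G.Adj y b, g b := by
  have h1 : (es.map fun e => (if e.1 = y then g e.2 else 0) + if e.2 = y then g e.1 else 0) =
      es.map fun e => (fun f : Sym2 V => ∑ b, if f = s(y, b) then g b else 0) s(e.1, e.2) := by
    refine List.map_congr_left fun e he => ?_
    obtain ⟨a, c⟩ := e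
    have hac : a ≠ c := (h.adj he).ne
    dsimp only
    have h2 : ∀ b, (if s(a, c) = s(y, b) then g b else 0) =
        (if b = c then (if a = y then g c else 0) else 0) +
          if b = a then (if c = y then g a else 0) else 0 := by
      intro b
      by_cases h3 : a = y
      · subst h3
        by_cases h4 : b = c
        · subst h4; simp [hac.symm]
        · simp [h4, hac.symm, Ne.symm h4]
      · by_cases h4 : c = y
        · subst h4
          by_cases h5 : b = a
          · subst h5; simp [h3]
          · simp [h3, h5, Ne.symm h5]
        · simp [h3, h4]
    simp only [h2, Finset.sum_add_distrib, Finset.sum_ite_eq', Finset.mem_univ, if_true]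
  rw [h1, h.sum_map fun f => ∑ b, if f = s(y, b) then g b else 0, Finset.sum_comm,
    Finset.sum_filter]
  refine Finset.sum_congr rfl fun b _ => ?_
  rw [Finset.sum_ite_eq']
  simp

end ListsEdges

namespace ZeroExt

open Imp ArcGraph

/-- Read the sizes; `e` and `w` become the positions of the edges of the tree and of the labels. -/
def loadSizes : Cmd :=
  .n ≔ Arr.inp.at 0 ;; .m ≔ Arr.inp.at 1 ;; .t ≔ Arr.inp.at 2 ;; .k ≔ Arr.inp.at 3 ;;
  .q ≔ Arr.inp.at 5 ;; .M ≔ (Var.m : Expr) + Var.m ;; .ans ≔ 0 ;;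
  .e ≔ (Var.M : Expr) + 6 ;; .w ≔ (Var.e : Expr) + ((Var.t : Expr) - 1) + ((Var.t : Expr) - 1)

/-- Read the graph, with the arcs `2 * j` and `2 * j + 1` for the edge number `j`, and link the arcs
out of every vertex. -/
def loadGraph : Cmd :=
  .for .c Var.M (.store .tl Var.c (Arr.inp.at ((Var.c : Expr) + 6))) ;;
  .for .v Var.n (.store .fst Var.v Var.M) ;;
  .for .i Var.m (.store .rv ((Var.i : Expr) + Var.i) ((Var.i : Expr) + Var.i + 1) ;;
    .store .rv ((Var.i : Expr) + Var.i + 1) ((Var.i : Expr) + Var.i)) ;;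
  .for .c Var.M (.u ≔ (Var.M : Expr) - 1 - Var.c ;;
    .store .nxt Var.u (Arr.fst.at (Arr.tl.at Var.u)) ;;
    .store .fst (Arr.tl.at Var.u) Var.u)

/-- Read the partial labelling, and put it on the stack. -/
def loadLabels : Cmd :=
  .for .i Var.k (.store .ix (Arr.inp.at ((Var.w : Expr) + Var.i)) ((Var.i : Expr) + 1)) ;;
  .u ≔ (Var.w : Expr) + Var.k ;;
  .for .v Var.n (.ite (.eq (Arr.inp.at ((Var.u : Expr) + Var.v)) 0) (.store .stk Var.v 0)
    (.store .stk Var.v (Arr.ix.at (Arr.inp.at ((Var.u : Expr) + Var.v) - 1)))) ;;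
  .sp ≔ Var.n

/-- Initialize the branches of the nodes of the tree. -/
def initBranches : Cmd :=
  .xo ≔ 0 ;;
  .for .x Var.t
    (.store .off Var.x Var.xo ;; .store .dg Var.x 0 ;; .store .sm Var.x 0 ;;
      .for .i Var.k (.ite (.eq (Arr.inp.at ((Var.w : Expr) + Var.i)) Var.x)
        (.store .bl ((Var.xo : Expr) + Var.i) 1) (.store .bl ((Var.xo : Expr) + Var.i) 0)) ;;
      .xo ≔ ((Var.xo : Expr) + Var.k))

/-- Read the tree. -/
def loadTree : Cmd :=
  .for .c ((Var.t : Expr) - 1)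
    (.y ≔ Arr.inp.at Var.e ;; .z ≔ Arr.inp.at ((Var.e : Expr) + 1) ;;
      .store .dg Var.y (Arr.dg.at Var.y + 1) ;; .store .dg Var.z (Arr.dg.at Var.z + 1) ;;
      .store .sm Var.y (Arr.sm.at Var.y + Var.z) ;; .store .sm Var.z (Arr.sm.at Var.z + Var.y) ;;
      .e ≔ (Var.e : Expr) + 2)

/-- The whole program: read the input, compute the splits of the labels, and search. -/
def main : Cmd := loadSizes ;; loadGraph ;; loadLabels ;; initBranches ;; loadTree ;; prune ;; search

/-- The array holds the input, where the edges of the graph and of the tree and the labels are listed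
in the order of the given lists. -/
structure InputOK (I : TreeInstance) (es : List (Fin I.n × Fin I.n)) (ts : List (Fin I.t × Fin I.t))
    (ds : List (Fin I.t)) (inp : ℕ → ℕ) : Prop where
  n : inp 0 = I.n
  m : inp 1 = es.length
  t : inp 2 = I.t
  k : inp 3 = ds.length
  q : inp 5 = I.q.natAbs
  arcs : ∀ j, ∀ h : j < es.length, inp (6 + 2 * j) = es[j].1 ∧ inp (6 + 2 * j + 1) = es[j].2
  edges : ∀ j, ∀ h : j < ts.length, inp (6 + 2 * es.length + 2 * j) = ts[j].1 ∧
    inp (6 + 2 * es.length + 2 * j + 1) = ts[j].2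
  labels : ∀ j, ∀ h : j < ds.length, inp (6 + 2 * es.length + 2 * ts.length + j) = ds[j]
  τ : ∀ v : Fin I.n, inp (6 + 2 * es.length + 2 * ts.length + ds.length + v) =
    ((I.τ v).map fun d => d.val.val + 1).getD 0

theorem tri_loadGraph {s : Mem} {n m : ℕ} (hn : s.v .n = n) (hm : s.v .m = m) (hM : s.v .M = m + m)
    (hlt : ∀ c < m + m, s.a .inp (c + 6) < n)
    (hne : ∀ j < m, s.a .inp (j + j + 6) ≠ s.a .inp (j + j + 1 + 6)) :
    Tri loadGraph s fun l s' => ∃ G : ArcGraph, GraphOK G s' ∧ G.n = n ∧ G.M = m + m ∧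
      (∀ c < m + m, G.tl c = s.a .inp (c + 6)) ∧
      (∀ j < m, G.rv (j + j) = j + j + 1 ∧ G.rv (j + j + 1) = j + j) ∧ l ≤ 8 + n * 3 + m * 20 := by
  refine tri_seq.2 (tri_for (I := fun i s' => ∀ c < i, s'.a .tl c = s.a .inp (c + 6)) (m + m) 1
    ?_ (by omega) ?_ ?_)
  · intro i s' _ _ hf _
    exact (hf.1 .M rfl).trans hM
  · intro i s' hi hv hf hI
    have h1 : s'.a .inp = s.a .inp := hf.2 .inp rfl
    simp [hv, h1]
    intro c hc
    rcases Nat.lt_or_eq_of_le hc with h | rfl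
    · rw [Function.update_of_ne h.ne, hI c h]
    · simp
  rintro l₁ s₁ hf₁ htl - hl₁
  have hn₁ : s₁.v .n = n := (hf₁.1 .n rfl).trans hn
  have hm₁ : s₁.v .m = m := (hf₁.1 .m rfl).trans hm
  have hM₁ : s₁.v .M = m + m := (hf₁.1 .M rfl).trans hM
  refine tri_seq.2 (tri_for (I := fun i s' => ∀ v < i, s'.a .fst v = m + m) n 1
    ?_ (by omega) ?_ ?_)
  · intro i s' _ _ hf _
    exact (hf.1 .n rfl).trans hn₁
  · intro i s' hi hv hf hI
    have h1 : s'.v .M = m + m := (hf.1 .M rfl).trans hM₁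
    simp [hv, h1]
    intro c hc
    rcases Nat.lt_or_eq_of_le hc with h | rfl
    · rw [Function.update_of_ne h.ne, hI c h]
    · simp
  rintro l₂ s₂ hf₂ hfst - hl₂
  have hn₂ : s₂.v .n = n := (hf₂.1 .n rfl).trans hn₁
  have hm₂ : s₂.v .m = m := (hf₂.1 .m rfl).trans hm₁
  have hM₂ : s₂.v .M = m + m := (hf₂.1 .M rfl).trans hM₁
  refine tri_seq.2 (tri_for (I := fun i s' => ∀ j < i, s'.a .rv (j + j) = j + j + 1 ∧
    s'.a .rv (j + j + 1) = j + j) m 2 ?_ (by omega) ?_ ?_)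
  · intro i s' _ _ hf _
    exact (hf.1 .m rfl).trans hm₂
  · intro i s' hi hv hf hI
    simp [hv]
    intro j hj
    rcases Nat.lt_or_eq_of_le hj with h | rfl
    · obtain ⟨h1, h2⟩ := hI j h
      rw [Function.update_of_ne (by omega), Function.update_of_ne (by omega),
        Function.update_of_ne (by omega), Function.update_of_ne (by omega)]
      exact ⟨h1, h2⟩
    · rw [Function.update_of_ne (by omega), Function.update_self, Function.update_self]
      exact ⟨rfl, rfl⟩
  rintro l₃ s₃ hf₃ hrv - hl₃
  have hn₃ : s₃.v .n = n := (hf₃.1 .n rfl).trans hn₂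
  have hM₃ : s₃.v .M = m + m := (hf₃.1 .M rfl).trans hM₂
  have htl₃ : s₃.a .tl = s₁.a .tl := (hf₃.2 .tl rfl).trans (hf₂.2 .tl rfl)
  have hfst₃ : s₃.a .fst = s₂.a .fst := hf₃.2 .fst rfl
  have hrev : ∀ c < m + m, s₃.a .rv c < m + m ∧ s₃.a .rv (s₃.a .rv c) = c ∧
      s₃.a .tl (s₃.a .rv c) ≠ s₃.a .tl c := by
    intro c hc
    rw [htl₃]
    obtain ⟨j, rfl | rfl⟩ : ∃ j, c = j + j ∨ c = j + j + 1 := ⟨c / 2, by omega⟩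
    · obtain ⟨h1, h2⟩ := hrv j (by omega)
      rw [h1, h2, htl _ (by omega), htl _ (by omega)]
      exact ⟨by omega, rfl, (hne j (by omega)).symm⟩
    · obtain ⟨h1, h2⟩ := hrv j (by omega)
      rw [h2, h1, htl _ (by omega), htl _ (by omega)]
      exact ⟨by omega, rfl, hne j (by omega)⟩
  set G : ArcGraph :=
    { n := n, M := m + m, tl := s₃.a .tl, rv := s₃.a .rv
      tl_lt := fun c hc => by rw [htl₃, htl c hc]; exact hlt c hc
      rv_lt := fun c hc => (hrev c hc).1
      rv_rv := fun c hc => (hrev c hc).2.1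
      tl_rv_ne := fun c hc => (hrev c hc).2.2 } with hG
  -- The arcs are linked in decreasing order.
  refine tri_for (I := fun i s' => (∀ v < n, m + m - i ≤ s'.a .fst v) ∧
    (∀ c < m + m, m + m - i ≤ c → s'.a .fst (G.tl c) ≤ c) ∧
    (∀ v < n, s'.a .fst v < m + m → G.tl (s'.a .fst v) = v) ∧
    ∀ c < m + m, m + m - i ≤ c → c < s'.a .nxt c ∧
      (∀ e < m + m, c < e → e < s'.a .nxt c → G.tl e ≠ G.tl c) ∧
      (s'.a .nxt c < m + m → G.tl (s'.a .nxt c) = G.tl c)) (m + m) 3 ?_ ?_ ?_ ?_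
  · intro i s' _ _ hf _
    exact (hf.1 .M rfl).trans hM₃
  · simp only [Store.setV_a, hfst₃]
    refine ⟨fun v hv => by rw [hfst v hv]; omega, by omega, fun v hv => ?_, by omega⟩
    rw [hfst v hv]; omega
  · rintro i s' hi hv hf ⟨h1, h2, h3, h4⟩
    have e1 : s'.v .M = m + m := (hf.1 .M rfl).trans hM₃
    have e2 : s'.a .tl = G.tl := hf.2 .tl rfl
    have hu : m + m - 1 - i < m + m := by omega
    have ht := G.tl_lt _ hu
    simp only [tri_seq, tri_assign, tri_store, Store.setV_a, Store.setV_v, Store.setA_v,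
      Store.setA_a, AExp.eval_var, AExp.eval_sub, AExp.eval_one, AExp.eval_get, hv, e1, e2,
      if_true, if_false, reduceCtorEq]
    set u := m + m - 1 - i with hud
    have hle : m + m - (i + 1) = u := by omega
    have hle' : m + m - i = u + 1 := by omega
    rw [hle'] at h1 h2 h4
    rw [hle]
    refine ⟨trivial, by omega, fun v hvn => ?_, fun c hc huc => ?_, fun v hvn hvM => ?_,
      fun c hc huc => ?_⟩
    · rw [Function.update_apply]
      split_ifs
      · exact le_rfl
      · exact (h1 v hvn).trans' (Nat.le_succ _)
    · rw [Function.update_apply]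
      split_ifs with h5
      · exact huc
      · refine h2 c hc ?_
        have : c ≠ u := by rintro rfl; exact h5 rfl
        omega
    · rw [Function.update_apply] at hvM ⊢
      split_ifs with h5
      · exact h5.symm
      · rw [if_neg h5] at hvM
        exact h3 v hvn hvM
    · rw [Function.update_apply]
      split_ifs with h5
      · subst h5
        refine ⟨h1 _ ht, fun e he hue heu heq => ?_, h3 _ ht⟩
        have := h2 e he hue
        rw [heq] at this
        omega
      · exact h4 c hc (by omega)
  · rintro l₄ s₄ hf₄ ⟨h1, h2, h3, h4⟩ - hl₄
    simp only [Nat.sub_self] at h2 h4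
    refine ⟨G, ⟨(hf₄.1 .n rfl).trans hn₃, (hf₄.1 .M rfl).trans hM₃, hf₄.2 .tl rfl, hf₄.2 .rv rfl,
      fun c hc => h2 c hc (Nat.zero_le _), h3, fun c hc => (h4 c hc (Nat.zero_le _)).1,
      fun c hc => (h4 c hc (Nat.zero_le _)).2.1, fun c hc => (h4 c hc (Nat.zero_le _)).2.2⟩, rfl,
      rfl, fun c hc => ?_, hrv, by omega⟩
    exact (congrFun htl₃ c).trans (htl c hc)

end ZeroExt

namespace ZeroExt

open Imp ArcGraph

variable {I : TreeInstance} {es : List (Fin I.n × Fin I.n)} {ts : List (Fin I.t × Fin I.t)}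
  {ds : List (Fin I.t)} {inp : ℕ → ℕ}

theorem tri_loadSizes {s : Mem} (hI : InputOK I es ts ds (s.a .inp)) (hts : ts.length + 1 = I.t) :
    Tri loadSizes s fun l s' => s'.v .n = I.n ∧ s'.v .m = es.length ∧
      s'.v .M = es.length + es.length ∧ s'.v .t = I.t ∧ s'.v .k = ds.length ∧
      s'.v .q = I.q.natAbs ∧ s'.v .ans = 0 ∧ s'.v .e = 6 + 2 * es.length ∧
      s'.v .w = 6 + 2 * es.length + 2 * ts.length ∧ l = 9 := by
  simp [loadSizes, hI.n, hI.m, hI.t, hI.k, hI.q]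
  omega

/-- The label number `i`. -/
def labelAt {t : ℕ} (ds : List (Fin t)) (d₀ : Fin t) (i : ℕ) : Fin t := ds.getD i d₀

theorem labelAt_eq {t : ℕ} {ds : List (Fin t)} {d₀ : Fin t} {i : ℕ} (hi : i < ds.length) :
    labelAt ds d₀ i = ds[i] := List.getD_eq_getElem _ _ hi

theorem tri_loadLabels {s : Mem} (hI : InputOK I es ts ds (s.a .inp)) (hds : ds.Nodup)
    (hD : ∀ x, x ∈ ds ↔ x ∈ I.D) (d₀ : Fin I.t) (hn : s.v .n = I.n) (hk : s.v .k = ds.length)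
    (hw : s.v .w = 6 + 2 * es.length + 2 * ts.length) :
    Tri loadLabels s fun l s' => s'.v .sp = I.n ∧
      (∀ v : Fin I.n, s'.a .stk v ≤ ds.length ∧
        part (labelAt ds d₀) (s'.a .stk) v = (I.τ v).map Subtype.val) ∧
      l ≤ 6 + ds.length * 3 + I.n * 4 := by
  refine tri_seq.2 (tri_for (I := fun i s' => ∀ j, ∀ h : j < ds.length, j < i →
    s'.a .ix ds[j] = j + 1) ds.length 1 ?_ (by omega) ?_ ?_)
  · intro i s' _ _ hf _
    exact (hf.1 .k rfl).trans hk
  · intro i s' hi hv hf h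
    have h1 : s'.a .inp = s.a .inp := hf.2 .inp rfl
    have h2 : s'.v .w = 6 + 2 * es.length + 2 * ts.length := (hf.1 .w rfl).trans hw
    simp [hv, h1, h2, hI.labels i hi]
    intro j hj hji
    rw [Function.update_apply]
    split_ifs with he
    · have := (hds.getElem_inj_iff).1 (Fin.ext he)
      omega
    · refine h j hj ?_
      have : j ≠ i := by rintro rfl; exact he rfl
      omega
  rintro l₁ s₁ hf₁ hix - hl₁
  have hw₁ : s₁.v .w = 6 + 2 * es.length + 2 * ts.length := (hf₁.1 .w rfl).trans hw
  have hk₁ : s₁.v .k = ds.length := (hf₁.1 .k rfl).trans hk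
  have hn₁ : s₁.v .n = I.n := (hf₁.1 .n rfl).trans hn
  have hinp₁ : s₁.a .inp = s.a .inp := hf₁.2 .inp rfl
  refine tri_seq.2 (tri_assign.2 (tri_seq.2 ?_))
  refine tri_for (I := fun i s' => ∀ v : Fin I.n, v.val < i → s'.a .stk v ≤ ds.length ∧
        part (labelAt ds d₀) (s'.a .stk) v = (I.τ v).map Subtype.val) I.n 2 ?_ (by omega) ?_ ?_
  · intro i s' _ _ hf _
    rw [AExp.eval_var, hf.1 .n rfl]
    simpa using hn₁
  · intro i s' hi hv hf h
    have h1 : s'.a .inp = s.a .inp := (hf.2 .inp rfl).trans (by simpa using hinp₁)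
    have h2 : s'.v .u = 6 + 2 * es.length + 2 * ts.length + ds.length :=
      (hf.1 .u rfl).trans (by simp [hw₁, hk₁])
    have h3 : s'.a .ix = s₁.a .ix := hf.2 .ix rfl
    have h4 := hI.τ ⟨i, hi⟩
    simp only at h4
    simp only [tri_ite, tri_store, ne_eq, AExp.eval_eq, AExp.eval_get, AExp.eval_add,
      AExp.eval_var, AExp.eval_zero, AExp.eval_sub, AExp.eval_one, hv, h1, h2, h3, h4, not_not,
      Store.setV_a, Store.setA_v, Store.setA_a, if_true]
    have hold : ∀ c, ∀ v : Fin I.n, v.val < i →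
        Function.update (s'.a .stk) i c v ≤ ds.length ∧
        part (labelAt ds d₀) (Function.update (s'.a .stk) i c) v = (I.τ v).map Subtype.val := by
      intro c v hvi
      have h5 := h v hvi
      unfold part at h5 ⊢
      rw [Function.update_of_ne hvi.ne]
      exact h5
    rcases hτ : I.τ ⟨i, hi⟩ with _ | d
    · refine ⟨fun _ => ⟨trivial, le_rfl, fun v hvi => ?_⟩, by simp⟩
      rcases Nat.lt_succ_iff_lt_or_eq.1 hvi with h5 | h5
      · exact hold _ v h5
      · obtain rfl : v = ⟨i, hi⟩ := Fin.ext h5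
        simp [part, hτ]
    · refine ⟨by simp, fun _ => ⟨trivial, le_rfl, fun v hvi => ?_⟩⟩
      rcases Nat.lt_succ_iff_lt_or_eq.1 hvi with h5 | h5
      · exact hold _ v h5
      · obtain rfl : v = ⟨i, hi⟩ := Fin.ext h5
        obtain ⟨j, hj, hjd⟩ := List.mem_iff_getElem.1 ((hD d).2 d.2)
        have h6 := hix j hj hj
        rw [hjd] at h6
        simp [part, hτ, h6, labelAt_eq hj, hjd]
        omega
  · rintro l₂ s₂ hf₂ h - hl₂
    have hn₂ : s₂.v .n = I.n := (hf₂.1 .n rfl).trans (by simpa using hn₁)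
    simp [hn₂]
    exact ⟨fun v => h v v.2, by omega⟩

theorem tri_initBranches {s : Mem} (hI : InputOK I es ts ds (s.a .inp)) (d₀ : Fin I.t)
    (ht : s.v .t = I.t) (hk : s.v .k = ds.length)
    (hw : s.v .w = 6 + 2 * es.length + 2 * ts.length) :
    Tri initBranches s fun l s' => (∀ x : Fin I.t, s'.a .off x = x * ds.length ∧ s'.a .dg x = 0 ∧
      s'.a .sm x = 0 ∧ ∀ i < ds.length, s'.a .bl (x * ds.length + i) =
        if labelAt ds d₀ i = x then 1 else 0) ∧ l ≤ 3 + I.t * (8 + ds.length * 4) := by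
  refine tri_seq.2 (tri_assign.2 (tri_for (I := fun i s' => s'.v .xo = i * ds.length ∧
    ∀ x : Fin I.t, x.val < i → s'.a .off x = x * ds.length ∧ s'.a .dg x = 0 ∧
      s'.a .sm x = 0 ∧ ∀ i < ds.length, s'.a .bl (x * ds.length + i) =
        if labelAt ds d₀ i = x then 1 else 0) I.t (6 + ds.length * 4) ?_ (by simp) ?_ ?_))
  · intro i s' _ _ hf _
    rw [AExp.eval_var, hf.1 .t rfl]
    simpa using ht
  · rintro x s₁ hx hv hf ⟨hxo, h⟩
    have hinp : s₁.a .inp = s.a .inp := hf.2 .inp rfl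
    have hw₁ : s₁.v .w = 6 + 2 * es.length + 2 * ts.length :=
      (hf.1 .w rfl).trans (by simpa using hw)
    have hk₁ : s₁.v .k = ds.length := (hf.1 .k rfl).trans (by simpa using hk)
    refine tri_seq.2 (tri_store.2 (tri_seq.2 (tri_store.2 (tri_seq.2 (tri_store.2 (tri_seq.2
      (tri_for (I := fun i s' => (∀ a < x * ds.length, s'.a .bl a = s₁.a .bl a) ∧ ∀ j < i,
        s'.a .bl (x * ds.length + j) = if (labelAt ds d₀ j : ℕ) = x then 1 else 0) ds.length 2
        ?_ ?_ ?_ ?_)))))))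
    · intro i s' _ _ hf' _
      rw [AExp.eval_var, hf'.1 .k rfl]
      simpa using hk₁
    · simp
    · rintro i s' hi hv' hf' ⟨h1, h2⟩
      have e1 : s'.a .inp = s.a .inp := (hf'.2 .inp rfl).trans (by simpa using hinp)
      have e2 : s'.v .w = 6 + 2 * es.length + 2 * ts.length :=
        (hf'.1 .w rfl).trans (by simpa using hw₁)
      have e3 : s'.v .x = x := (hf'.1 .x rfl).trans (by simpa using hv)
      have e4 : s'.v .xo = x * ds.length := (hf'.1 .xo rfl).trans (by simpa using hxo)
      have e5 := hI.labels i hi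
      rw [← labelAt_eq (d₀ := d₀) hi] at e5
      simp [hv', e1, e2, e3, e4, e5]
      constructor
      · intro he
        refine ⟨fun a ha => ?_, fun j hj => ?_⟩
        · rw [Function.update_of_ne (by omega), h1 a ha]
        · rcases Nat.lt_or_eq_of_le hj with h5 | rfl
          · rw [Function.update_of_ne (by omega), h2 j h5]
          · simp [he]
      · intro he
        refine ⟨fun a ha => ?_, fun j hj => ?_⟩
        · rw [Function.update_of_ne (by omega), h1 a ha]
        · rcases Nat.lt_or_eq_of_le hj with h5 | rfl
          · rw [Function.update_of_ne (by omega), h2 j h5]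
          · simp [he]
    · rintro l s₂ hf₂ ⟨h1, h2⟩ - hl
      have e1 : s₂.v .x = x := (hf₂.1 .x rfl).trans (by simpa using hv)
      have e2 : s₂.v .xo = x * ds.length := (hf₂.1 .xo rfl).trans (by simpa using hxo)
      have e3 : s₂.v .k = ds.length := (hf₂.1 .k rfl).trans (by simpa using hk₁)
      have e4 : s₂.a .off = Function.update (s₁.a .off) x (x * ds.length) :=
        (hf₂.2 .off rfl).trans (by simp [hv, hxo])
      have e5 : s₂.a .dg = Function.update (s₁.a .dg) x 0 := (hf₂.2 .dg rfl).trans (by simp [hv])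
      have e6 : s₂.a .sm = Function.update (s₁.a .sm) x 0 := (hf₂.2 .sm rfl).trans (by simp [hv])
      simp [e1, e2, e3, e4, e5, e6]
      refine ⟨by omega, by ring, fun y hy => ?_⟩
      rcases Nat.lt_or_eq_of_le hy with h5 | h5
      · rw [Function.update_of_ne h5.ne, Function.update_of_ne h5.ne, Function.update_of_ne h5.ne]
        obtain ⟨f1, f2, f3, f4⟩ := h y h5
        refine ⟨f1, f2, f3, fun i hi => ?_⟩
        have := Nat.mul_le_mul_right ds.length h5
        rw [Nat.succ_mul] at this
        rw [h1 _ (by omega), f4 i hi]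
      · rw [h5]
        simp only [Function.update_self, true_and]
        intro i hi
        rw [h2 i hi]
        simp [Fin.ext_iff, h5]
  · rintro l s' hf ⟨-, h⟩ - hl
    refine ⟨fun x => h x x.2, ?_⟩
    have : I.t * (8 + ds.length * 4) = I.t * (6 + ds.length * 4 + 2) := by ring
    omega

theorem tri_loadTree {s : Mem} (hI : InputOK I es ts ds (s.a .inp)) (hts : ts.length + 1 = I.t)
    (hT : ListsEdges ts I.T) (d₀ : Fin I.t) (ht : s.v .t = I.t) (hk : s.v .k = ds.length)
    (he : s.v .e = 6 + 2 * es.length)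
    (hs : ∀ x : Fin I.t, s.a .off x = x * ds.length ∧ s.a .dg x = 0 ∧
      s.a .sm x = 0 ∧ ∀ i < ds.length, s.a .bl (x * ds.length + i) =
        if labelAt ds d₀ i = x then 1 else 0) :
    Tri loadTree s fun l s' => PruneOK I.T (labelAt ds d₀) ds.length Finset.univ id (fun x z => z = x)
      s' ∧ l ≤ 2 + I.t * 9 := by
  classical
  obtain ⟨F, hF⟩ : ∃ F : (Fin I.t → ℕ) → Fin I.t → ℕ → ℕ, F = fun g y i => ((ts.take i).map fun e =>
    (if e.1 = y then g e.2 else 0) + if e.2 = y then g e.1 else 0).sum := ⟨_, rfl⟩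
  have hstep : ∀ g y i, ∀ h : i < ts.length, F g y (i + 1) = F g y i +
      ((if ts[i].1 = y then g ts[i].2 else 0) + if ts[i].2 = y then g ts[i].1 else 0) := by
    intro g y i h
    rw [hF]
    simp only [List.take_succ_eq_append_getElem h, List.map_append, List.sum_append, List.map_cons,
      List.map_nil, List.sum_singleton]
  have hall : ∀ g y, F g y ts.length = ∑ b with I.T.Adj y b, g b := by
    intro g y
    rw [hF]
    simp only [List.take_length]
    convert hT.sum_neighbors g y
  refine tri_for (I := fun i s' => s'.v .e = 6 + 2 * es.length + 2 * i ∧ ∀ y : Fin I.t,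
    s'.a .dg y = F (fun _ => 1) y i ∧ s'.a .sm y = F Fin.val y i) ts.length 7 ?_ ?_ ?_ ?_
  · intro i s' _ _ hf _
    rw [AExp.eval_sub, AExp.eval_var, hf.1 .t rfl, ht, AExp.eval_one]
    omega
  · simp [he, hF]
    exact fun y => ⟨(hs y).2.1, (hs y).2.2.1⟩
  · rintro i s' hi hv hf ⟨h1, h2⟩
    have hinp : s'.a .inp = s.a .inp := hf.2 .inp rfl
    obtain ⟨h3, h4⟩ := hI.edges i hi
    have h5 := fun g y => hstep g y i hi
    have hadj := hT.adj (List.getElem_mem hi)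
    generalize ts[i] = e at h3 h4 h5 hadj
    obtain ⟨a, c⟩ := e
    have hne : (a : ℕ) ≠ c := fun h => hadj.ne (Fin.ext h)
    simp [h1, hinp, h3, h4, hv]
    refine ⟨by ring, fun y => ?_⟩
    rw [h5, h5, ← (h2 y).1, ← (h2 y).2]
    by_cases hay : a = y
    · subst hay
      simp [hne, hne.symm, Fin.ext_iff]
    · have hay' : (y : ℕ) ≠ a := fun h => hay (Fin.ext h.symm)
      by_cases hcy : c = y
      · subst hcy
        simp [hne, hay', Fin.ext_iff]
      · have hcy' : (y : ℕ) ≠ c := fun h => hcy (Fin.ext h.symm)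
        simp [hay, hcy, hay', hcy']
  · rintro l s' hf ⟨-, h⟩ - hl
    have hdg : ∀ y : Fin I.t, s'.a .dg y = (Finset.univ.filter fun b => I.T.Adj y b).card := by
      intro y
      rw [(h y).1, Finset.card_eq_sum_ones, hall]
    refine ⟨⟨Pruned.start _, (hf.1 .t rfl).trans ht, (hf.1 .k rfl).trans hk, fun x => ?_,
      fun x i hi => ?_, fun y _ => hdg y, fun y hy => absurd (Finset.mem_univ y) hy, fun y _ => ?_, ?_⟩,
      by omega⟩
    · rw [hf.2 .off rfl]; exact (hs x).1
    · rw [hf.2 .bl rfl, (hs x).2.2.2 i hi]; congr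
    · rw [(h y).2, hall]
    · have h1 : ∑ y : Fin I.t, s'.a .dg y = ∑ y : Fin I.t, I.T.degree y := by
        refine Finset.sum_congr rfl fun y _ => ?_
        rw [hdg y, ← SimpleGraph.card_neighborFinset_eq_degree, SimpleGraph.neighborFinset_eq_filter]
      rw [h1, SimpleGraph.sum_degrees_eq_twice_card_edges]
      have := I.isTree.card_edgeFinset
      rw [Finset.card_univ, ← this]
      ring

end ZeroExt

/-! ### Costs and cuts -/

namespace ZeroExt

open Imp ArcGraph

variable {I : TreeInstance} {es : List (Fin I.n × Fin I.n)} {ts : List (Fin I.t × Fin I.t)}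
  {ds : List (Fin I.t)} {inp : ℕ → ℕ}

/-- The arcs `2 * j` and `2 * j + 1` belong to the edge number `j` of the list. -/
structure ArcsOf (G : ArcGraph) (es : List (Fin I.n × Fin I.n)) : Prop where
  n : G.n = I.n
  M : G.M = es.length + es.length
  tl : ∀ j, ∀ h : j < es.length, G.tl (j + j) = es[j].1 ∧ G.tl (j + j + 1) = es[j].2
  rv : ∀ j < es.length, G.rv (j + j) = j + j + 1 ∧ G.rv (j + j + 1) = j + j

variable {G : ArcGraph} {S : Splits (Fin I.t)}

open scoped Classical in
theorem cut_eq_sum (hG : ArcsOf G es) (X : Set ℕ) :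
    G.cut X = ∑ j : Fin es.length,
      if ((es[j.1].1 : ℕ) ∈ X ↔ (es[j.1].2 : ℕ) ∈ X) then 0 else 1 := by
  have h1 : ∀ f : ℕ → ℕ, ∀ n, ∑ c ∈ Finset.range (n + n), f c =
      ∑ j ∈ Finset.range n, (f (j + j) + f (j + j + 1)) := by
    intro f n
    induction n with
    | zero => rfl
    | succ n ih =>
      have : n + 1 + (n + 1) = n + n + 1 + 1 := by omega
      rw [this, Finset.sum_range_succ, Finset.sum_range_succ, ih, Finset.sum_range_succ, add_assoc]
  rw [cut, hG.M, h1, Finset.sum_range]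
  refine Finset.sum_congr rfl fun j _ => ?_
  obtain ⟨h2, h3⟩ := hG.tl j j.2
  obtain ⟨h4, h5⟩ := hG.rv j j.2
  simp only [hd, h2, h3, h4, h5]
  by_cases h6 : (es[j.1].1 : ℕ) ∈ X <;> by_cases h7 : (es[j.1].2 : ℕ) ∈ X <;> simp [h6, h7]

theorem labelCost_eq (hG : ArcsOf G es) (hes : ListsEdges es I.G) (hS : S.OfTree I.T)
    (l : Fin I.n → Fin I.t) (l' : ℕ → Fin I.t) (hl : ∀ v : Fin I.n, l' v = l v) :
    G.labelCost S l' = I.relaxed.cost l := by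
  classical
  rw [labelCost, ZeroExtension.cost]
  have h1 := hes.sum_map (I.relaxed.edgeCost l)
  rw [← Fin.sum_univ_fun_getElem] at h1
  refine Eq.trans ?_ (h1.trans (by congr))
  simp only [cut_eq_sum hG]
  rw [Finset.sum_comm]
  refine Finset.sum_congr rfl fun j _ => ?_
  have h2 : I.relaxed.edgeCost l s(es[j.1].1, es[j.1].2) =
      I.T.dist (l es[j.1].1) (l es[j.1].2) := rfl
  rw [h2, hS.dist_eq I.isTree, Finset.card_filter]
  refine Finset.sum_congr rfl fun x _ => ?_
  simp only [Set.mem_ofPred_eq, hl]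
  split_ifs <;> simp_all

theorem relaxed_cost (l : Fin I.n → I.D) : I.relaxed.cost (fun v => (l v).val) = I.inst.cost l := by
  refine Finset.sum_congr rfl fun e _ => ?_
  induction e using Sym2.ind
  rfl

variable {τ : ℕ → Option (Fin I.t)}

theorem isYes_iff (hG : ArcsOf G es) (hes : ListsEdges es I.G) (hS : S.OfTree I.T)
    (hq : 0 ≤ I.q) (d₀ : Fin I.t) (hD : ∀ x, x ∈ ds ↔ x ∈ I.D)
    (hτ : ∀ v : Fin I.n, τ v = (I.τ v).map Subtype.val) :
    I.inst.IsYes ↔ G.Solvable S (labels (labelAt ds d₀) ds.length) I.q.natAbs τ := by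
  have hlab : ∀ x, x ∈ labels (labelAt ds d₀) ds.length ↔ x ∈ I.D := by
    intro x
    rw [← hD, List.mem_iff_getElem]
    constructor
    · rintro ⟨i, hi, rfl⟩
      exact ⟨i, hi, (labelAt_eq hi).symm⟩
    · rintro ⟨i, hi, rfl⟩
      exact ⟨i, hi, labelAt_eq hi⟩
  constructor
  · rintro ⟨l, hl, hc⟩
    refine ⟨fun v => if h : v < I.n then l ⟨v, h⟩ else d₀, fun v hv y hy => ?_, fun v hv => ?_, ?_⟩
    · rw [hG.n] at hv
      have h1 := hτ ⟨v, hv⟩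
      simp only at h1
      rw [hy, eq_comm, Option.map_eq_some_iff] at h1
      obtain ⟨d, hd, rfl⟩ := h1
      simp only [dif_pos hv, hl _ d hd]
    · rw [hG.n] at hv
      simp only [dif_pos hv]
      exact (hlab _).2 (l _).2
    · rw [labelCost_eq hG hes hS (fun v => (l v).val) _ (by simp), relaxed_cost]
      have : I.inst.q = I.q := rfl
      omega
  · rintro ⟨l, hl, hlD, hc⟩
    refine ⟨fun v => ⟨l v, (hlab _).1 (hlD v (v.2.trans_eq hG.n.symm))⟩, fun v d hd => ?_, ?_⟩
    · refine Subtype.ext (hl v (v.2.trans_eq hG.n.symm) d ?_)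
      have h1 : I.τ v = some d := hd
      rw [hτ, h1]
      rfl
    · rw [← relaxed_cost, ← labelCost_eq hG hes hS (fun v : Fin I.n => l v) l fun _ => rfl]
      have : I.inst.q = I.q := rfl
      omega

theorem opt_le_bound (hG : ArcsOf G es) (hes : ListsEdges es I.G) (hS : S.OfTree I.T)
    (hτ : ∀ v : Fin I.n, τ v = (I.τ v).map Subtype.val) : I.relaxed.opt ≤ G.bound S τ := by
  have : Nonempty (Fin I.t) := I.isTree.connected.nonempty
  obtain ⟨l, hl, hc⟩ := G.exists_labelCost_le (hS.isTree I.isTree) τ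
  refine le_trans (Nat.sInf_le ⟨fun v => l v, fun v d hd => ?_, rfl⟩)
    ((labelCost_eq hG hes hS (fun v : Fin I.n => l v) l fun _ => rfl).symm.le.trans hc)
  refine hl v (v.2.trans_eq hG.n.symm) d ?_
  rw [hτ]
  exact hd

end ZeroExt

/-! ### The main program -/

namespace ZeroExt

open Imp ArcGraph

variable {I : TreeInstance} {es : List (Fin I.n × Fin I.n)} {ts : List (Fin I.t × Fin I.t)}
  {ds : List (Fin I.t)}

theorem main_time_le {n m t k a p q dgs e : ℕ} (hn : 1 ≤ n) (hm : 1 ≤ m) (ht : 1 ≤ t) (hk : 2 ≤ k)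
    (hdg : dgs + 2 = 2 * t) (he : q - p ≤ e)
    (ha : a ≤ 9 + (8 + n * 3 + m * 20) + (6 + k * 3 + n * 4) + (3 + t * (8 + k * 4)) + (2 + t * 9) +
      (2 + t * 4 + (k * 4 + 8) * dgs) +
      (1 + weight (3 * (t * (400 * ((n + 1) * (m + m + 1))))) k q p)) :
    a ≤ 60000 * (k ^ e * t * k * n * m) := by
  have h1 : weight (3 * (t * (400 * ((n + 1) * (m + m + 1))))) k q p ≤
      3 * (t * (400 * ((n + 1) * (m + m + 1)))) * k * (7 * k ^ (q - p)) := weight_le hk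
  have h2 : 3 * (t * (400 * ((n + 1) * (m + m + 1)))) * k * (7 * k ^ (q - p)) ≤
      3 * (t * (400 * ((2 * n) * (3 * m)))) * k * (7 * k ^ e) :=
    Nat.mul_le_mul (Nat.mul_le_mul_right _ (Nat.mul_le_mul_left _ (Nat.mul_le_mul_left _
      (Nat.mul_le_mul_left _ (Nat.mul_le_mul (by omega) (by omega))))))
      (Nat.mul_le_mul_left _ (Nat.pow_le_pow_right (by omega) he))
  have h3 : 3 * (t * (400 * ((2 * n) * (3 * m)))) * k * (7 * k ^ e) =
      50400 * (k ^ e * t * k * n * m) := by ring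
  have hY : t * k * n * m ≤ k ^ e * t * k * n * m := by
    have h4 : 1 ≤ k ^ e := Nat.one_le_pow _ _ (by omega)
    calc t * k * n * m = 1 * (t * k * n * m) := by ring
      _ ≤ k ^ e * (t * k * n * m) := Nat.mul_le_mul_right _ h4
      _ = _ := by ring
  have h5 : t * k ≤ t * k * n * m :=
    (Nat.le_mul_of_pos_right _ hn).trans (Nat.le_mul_of_pos_right _ hm)
  have h6 : t ≤ t * k := Nat.le_mul_of_pos_right _ (by omega)
  have h7 : k ≤ t * k := Nat.le_mul_of_pos_left _ ht
  have h8 : n ≤ t * k * n * m :=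
    (Nat.le_mul_of_pos_left _ (by positivity)).trans (Nat.le_mul_of_pos_right _ hm)
  have h9 : m ≤ t * k * n * m := Nat.le_mul_of_pos_left _ (by positivity)
  have h10 : (k * 4 + 8) * dgs ≤ (k * 4 + 8) * (2 * t) := Nat.mul_le_mul_left _ (by omega)
  have h11 : (k * 4 + 8) * (2 * t) = 8 * (t * k) + 16 * t := by ring
  have h12 : t * (8 + k * 4) = 8 * t + 4 * (t * k) := by ring
  omega

open scoped Classical in
/-- The program decides the instance within the time bound, unless it is trivial. -/
theorem tri_main {s : Mem} (hI : InputOK I es ts ds (s.a .inp)) (hes : ListsEdges es I.G)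
    (hT : ListsEdges ts I.T) (hds : ds.Nodup) (hD : ∀ x, x ∈ ds ↔ x ∈ I.D) (hm : 1 ≤ es.length)
    (hk : 2 ≤ ds.length) (hq : 0 ≤ I.q) :
    Tri main s fun l s' => s'.v .ans = (if I.inst.IsYes then 1 else 0) ∧
      l ≤ 60000 * (ds.length ^ (I.q - (I.relaxed.opt : ℤ)).toNat * I.t * ds.length * I.n *
        es.length) := by
  have hn : 1 ≤ I.n := by
    have := (es[0].1).2
    omega
  have hne : Nonempty (Fin I.t) := I.isTree.connected.nonempty
  obtain ⟨d₀⟩ := id hne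
  have ht : 1 ≤ I.t := by
    have := d₀.2
    omega
  have hts : ts.length + 1 = I.t := by
    have := I.isTree.card_edgeFinset
    rwa [← hT.length_eq, Fintype.card_fin] at this
  refine tri_seq.2 ((tri_loadSizes hI hts).mono ?_)
  rintro l₁ s₁ hf₁ ⟨n₁, m₁, M₁, t₁, k₁, q₁, ans₁, e₁, w₁, hl₁⟩
  have inp₁ : s₁.a .inp = s.a .inp := hf₁.2 .inp rfl
  rw [← inp₁] at hI
  refine tri_seq.2 ((tri_loadGraph n₁ m₁ M₁ ?_ ?_).mono ?_)
  · intro c hc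
    obtain ⟨j, rfl | rfl⟩ : ∃ j, c = j + j ∨ c = j + j + 1 := ⟨c / 2, by omega⟩
    · have : j + j + 6 = 6 + 2 * j := by omega
      rw [this, (hI.arcs j (by omega)).1]
      exact Fin.is_lt _
    · have : j + j + 1 + 6 = 6 + 2 * j + 1 := by omega
      rw [this, (hI.arcs j (by omega)).2]
      exact Fin.is_lt _
  · intro j hj
    have h1 : j + j + 6 = 6 + 2 * j := by omega
    have h2 : j + j + 1 + 6 = 6 + 2 * j + 1 := by omega
    rw [h1, h2, (hI.arcs j hj).1, (hI.arcs j hj).2]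
    exact fun h => (hes.adj (List.getElem_mem hj)).ne (Fin.ext h)
  rintro l₂ s₂ hf₂ ⟨G, hG, Gn, GM, Gtl, Grv, hl₂⟩
  have hA : ArcsOf G es := by
    refine ⟨Gn, GM, fun j hj => ?_, Grv⟩
    have h1 : j + j + 6 = 6 + 2 * j := by omega
    have h2 : j + j + 1 + 6 = 6 + 2 * j + 1 := by omega
    rw [Gtl _ (by omega), Gtl _ (by omega), h1, h2]
    exact hI.arcs j hj
  have inp₂ : s₂.a .inp = s₁.a .inp := hf₂.2 .inp rfl
  rw [← inp₂] at hI
  refine tri_seq.2 ((tri_loadLabels hI hds hD d₀ ((hf₂.1 .n rfl).trans n₁)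
    ((hf₂.1 .k rfl).trans k₁) ((hf₂.1 .w rfl).trans w₁)).mono ?_)
  rintro l₃ s₃ hf₃ ⟨sp₃, stk₃, hl₃⟩
  have inp₃ : s₃.a .inp = s₂.a .inp := hf₃.2 .inp rfl
  have t₃ : s₃.v .t = I.t := by rw [hf₃.1 .t rfl, hf₂.1 .t rfl, t₁]
  have k₃ : s₃.v .k = ds.length := by rw [hf₃.1 .k rfl, hf₂.1 .k rfl, k₁]
  have w₃ : s₃.v .w = 6 + 2 * es.length + 2 * ts.length := by
    rw [hf₃.1 .w rfl, hf₂.1 .w rfl, w₁]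
  have e₃ : s₃.v .e = 6 + 2 * es.length := by rw [hf₃.1 .e rfl, hf₂.1 .e rfl, e₁]
  have ans₃ : s₃.v .ans = 0 := by rw [hf₃.1 .ans rfl, hf₂.1 .ans rfl, ans₁]
  have q₃ : s₃.v .q = I.q.natAbs := by rw [hf₃.1 .q rfl, hf₂.1 .q rfl, q₁]
  rw [← inp₃] at hI
  refine tri_seq.2 ((tri_initBranches hI d₀ t₃ k₃ w₃).mono ?_)
  rintro l₄ s₄ hf₄ ⟨hinit, hl₄⟩
  have inp₄ : s₄.a .inp = s₃.a .inp := hf₄.2 .inp rfl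
  rw [← inp₄] at hI
  refine tri_seq.2 ((tri_loadTree hI hts hT d₀ ((hf₄.1 .t rfl).trans t₃)
    ((hf₄.1 .k rfl).trans k₃) ((hf₄.1 .e rfl).trans e₃) hinit).mono ?_)
  rintro l₅ s₅ hf₅ ⟨hP, hl₅⟩
  have hsum : ∑ y : Fin I.t, s₅.a .dg y + 2 = 2 * I.t := by
    simpa using hP.sum
  refine tri_seq.2 ((tri_prune hP I.isTree.connected).mono ?_)
  rintro l₆ s₆ hf₆ ⟨r, m', σ, hP', hl₆⟩
  have hS : (Pruned.splits σ).OfTree I.T := Pruned.splits_ofTree hP'.pruned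
  have stk₆ : s₆.a .stk = s₃.a .stk := by rw [hf₆.2 .stk rfl, hf₅.2 .stk rfl, hf₄.2 .stk rfl]
  have hE : Env G (Pruned.splits σ) (labelAt ds d₀) ds.length s₆ := by
    refine ⟨(((hG.frame hf₃ rfl).frame hf₄ rfl).frame hf₅ rfl).frame hf₆ rfl, hP'.t_eq, hP'.k_eq,
      fun x hx i hi => ?_⟩
    have h1 : (Pruned.splits σ).σ x (labelAt ds d₀ i) ↔ σ ⟨x, hx⟩ (labelAt ds d₀ i) :=
      ⟨fun ⟨_, h⟩ => h, fun h => ⟨hx, h⟩⟩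
    rw [hP'.bl ⟨x, hx⟩ i hi]
    simp only [h1]
  have hτ : ∀ v : Fin I.n, part (labelAt ds d₀) (s₆.a .stk) v = (I.τ v).map Subtype.val :=
    fun v => stk₆ ▸ (stk₃ v).2
  have sp₆ : s₆.v .sp = G.n := by
    rw [hf₆.1 .sp rfl, hf₅.1 .sp rfl, hf₄.1 .sp rfl, sp₃, Gn]
  have q₆ : s₆.v .q = I.q.natAbs := by rw [hf₆.1 .q rfl, hf₅.1 .q rfl, hf₄.1 .q rfl, q₃]
  have ans₆ : s₆.v .ans = 0 := by rw [hf₆.1 .ans rfl, hf₅.1 .ans rfl, hf₄.1 .ans rfl, ans₃]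
  refine (tri_search (hS.isTree I.isTree) hE (by omega) ht (by omega) sp₆ q₆
    (fun v hv => stk₆ ▸ (stk₃ ⟨v, Gn ▸ hv⟩).1) ans₆).mono ?_
  rintro l₇ s₇ - ⟨hans, hl₇⟩
  refine ⟨?_, ?_⟩
  · rw [hans]
    exact if_congr (isYes_iff hA hes hS hq d₀ hD hτ).symm rfl rfl
  · have hopt : I.relaxed.opt ≤ _ := opt_le_bound hA hes hS hτ
    unfold cutTime at hl₇
    rw [Gn, GM] at hl₇
    refine main_time_le (p := G.bound (Pruned.splits σ) (part (labelAt ds d₀) (s₆.a .stk)))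
      (q := I.q.natAbs) hn hm ht hk hsum (by omega) ?_
    change l₇ ≤ 1 + weight (3 * (I.t * _)) _ _ _ at hl₇
    omega

end ZeroExt

/-! ### Layout of the memory and trivial instances -/

namespace ZeroExt

open Imp

/-- The layout for the treatment of the input as it is given: the whole memory is one array. -/
def rawLayout : Layout Var Unit where
  w := 0
  cv := Var.ctorIdx
  ca _ := 0
  cv_inj := Function.LeftInverse.injective (g := Var.ofNat) fun b => by cases b <;> rfl
  ca_inj _ _ _ := rfl
  ca_lt _ := by simp

/-- The layout with interleaved arrays. The variables are in the same registers as before. -/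
def layout : Layout Var Arr where
  w := 5
  cv := Var.ctorIdx
  ca := Arr.ctorIdx
  cv_inj := Function.LeftInverse.injective (g := Var.ofNat) fun b => by cases b <;> rfl
  ca_inj := Function.LeftInverse.injective (g := Arr.ofNat) fun b => by cases b <;> rfl
  ca_lt X := by cases X <;> simp [Arr.ctorIdx]

/-- The content of a memory cell. -/
abbrev cell (e : AExp Var Unit) : AExp Var Unit := .get () e

/-- Move the input to the multiples of 32, the cell with the highest address first, so that no cell is
overwritten before it is moved. -/
def spread : Com Var Unit :=
  .c ≔ (AExp.var .m + .var .m + (.var .t - 1) + (.var .t - 1) + .var .k + .var .n + 6) ;;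
  .while (.var .c)
    (.c ≔ (.var .c - 1) ;; .u ≔ (.var .c + .var .c) ;; .u ≔ (.var .u + .var .u) ;;
      .u ≔ (.var .u + .var .u) ;; .u ≔ (.var .u + .var .u) ;; .u ≔ (.var .u + .var .u) ;;
      .store () (.var .u) (cell (.var .c)))

/-- Decide the trivial instances; for all others, prepare the memory and set the flag `go`. -/
def prelude : Com Var Unit :=
  .n ≔ cell 0 ;; .m ≔ cell 1 ;; .t ≔ cell 2 ;; .k ≔ cell 3 ;;
  .go ≔ 0 ;;
  .ite (cell 4) (.ans ≔ 0)
    (.ite (.eq (.var .k) 0) (.ite (.var .n) (.ans ≔ 0) (.ans ≔ 1))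
      (.ite (.eq (.var .m) 0) (.ans ≔ 1)
        (.ite (.eq (.var .k) 1) (.ans ≔ 1) (.go ≔ 1 ;; spread))))

theorem tri_spread {s : Store Var Unit} {L : ℕ}
    (hL : s.v .m + s.v .m + (s.v .t - 1) + (s.v .t - 1) + s.v .k + s.v .n + 6 = L) :
    Tri spread s fun l s' => (∀ i < L, s'.a () (32 * i) = s.a () i) ∧ l ≤ 2 + L * 8 := by
  refine tri_seq.2 (tri_assign.2 (tri_while (I := fun s' => s'.v .c ≤ L ∧
    (∀ i < s'.v .c, s'.a () i = s.a () i) ∧ ∀ i < L, s'.v .c ≤ i → s'.a () (32 * i) = s.a () i)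
    (pot := fun s' => s'.v .c * 8) ?_ ?_ ?_))
  · simp [hL]
    intros
    omega
  · rintro s' - ⟨h1, h2, h3⟩ hc
    obtain ⟨c, hc'⟩ : ∃ c, s'.v .c = c + 1 := ⟨s'.v .c - 1, by simp at hc; omega⟩
    rw [hc'] at h1 h2 h3
    simp [hc', h2 c (by omega)]
    refine ⟨⟨by omega, fun i hi => ?_, fun i hi hci => ?_⟩, by omega⟩
    · rw [Function.update_of_ne (by omega), h2 i (by omega)]
    · by_cases hic : i = c
      · subst hic
        rw [Function.update_apply, if_pos (by omega)]
      · rw [Function.update_of_ne (by omega), h3 i hi (by omega)]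
  · rintro l s' - ⟨-, -, h3⟩ hc hl
    have h4 : s'.v .c = 0 := hc
    simp [h4, hL] at hl
    exact ⟨fun i hi => h3 i hi (by omega), by omega⟩

theorem length_pairWords {k : ℕ} (es : List (Fin k × Fin k)) :
    (pairWords es).length = 2 * es.length := by
  induction es with
  | nil => rfl
  | cons e es ih =>
    have : pairWords (e :: es) = e.1.val :: e.2.val :: pairWords es := rfl
    rw [this]
    simp [ih]
    ring

theorem getD_pairWords {k : ℕ} (es : List (Fin k × Fin k)) (l : List ℕ) (j : ℕ)
    (h : j < es.length) : (pairWords es ++ l).getD (2 * j) 0 = es[j].1 ∧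
      (pairWords es ++ l).getD (2 * j + 1) 0 = es[j].2 := by
  induction es generalizing j with
  | nil => simp at h
  | cons e es ih =>
    have h1 : pairWords (e :: es) = e.1.val :: e.2.val :: pairWords es := rfl
    rw [h1]
    cases j with
    | zero => simp
    | succ j =>
      have := ih j (by simpa using h)
      rw [show 2 * (j + 1) = 2 * j + 1 + 1 by ring]
      simpa using this

theorem inputOK_words (I : TreeInstance) (es : List (Fin I.n × Fin I.n))
    (ts : List (Fin I.t × Fin I.t)) (ds : List (Fin I.t)) :
    InputOK I es ts ds fun i => ([I.n, es.length, I.t, ds.length, if I.q < 0 then 1 else 0,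
      I.q.natAbs] ++ pairWords es ++ pairWords ts ++ ds.map Fin.val
      ++ List.ofFn fun v : Fin I.n =>
        ((I.τ v).map fun d : I.D => d.val.val + 1).getD 0).getD i 0 := by
  have hskip : ∀ (l₁ l₂ : List ℕ) i, (l₁ ++ l₂).getD (l₁.length + i) 0 = l₂.getD i 0 := by
    intro l₁ l₂ i
    rw [List.getD_append_right _ _ _ _ (Nat.le_add_right _ _), Nat.add_sub_cancel_left]
  simp only [List.append_assoc]
  set h₀ := [I.n, es.length, I.t, ds.length, if I.q < 0 then 1 else 0, I.q.natAbs] with hh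
  have hl : h₀.length = 6 := rfl
  refine ⟨rfl, rfl, rfl, rfl, rfl, fun j h => ?_, fun j h => ?_, fun j h => ?_, fun v => ?_⟩
  · rw [← hl, Nat.add_assoc, hskip, hskip]
    exact getD_pairWords _ _ j h
  · rw [← hl, ← length_pairWords, Nat.add_assoc, Nat.add_assoc, Nat.add_assoc, hskip, hskip, hskip,
      hskip]
    exact getD_pairWords _ _ j h
  · rw [← hl, ← length_pairWords, ← length_pairWords, Nat.add_assoc, Nat.add_assoc, hskip, hskip,
      hskip, List.getD_append _ _ _ _ (by simpa using h), List.getD_eq_getElem _ _ (by simpa using h)]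
    simp
  · have h1 : ds.length = (ds.map Fin.val).length := by simp
    rw [← hl, ← length_pairWords, ← length_pairWords, h1, Nat.add_assoc, Nat.add_assoc,
      Nat.add_assoc, hskip, hskip, hskip, hskip, List.getD_eq_getElem _ _ (by simp)]
    simp

theorem InputOK.congr {I : TreeInstance} {es : List (Fin I.n × Fin I.n)}
    {ts : List (Fin I.t × Fin I.t)} {ds : List (Fin I.t)} {inp inp' : ℕ → ℕ}
    (h : InputOK I es ts ds inp)
    (he : ∀ i < 6 + 2 * es.length + 2 * ts.length + ds.length + I.n, inp' i = inp i) :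
    InputOK I es ts ds inp' := by
  refine ⟨?_, ?_, ?_, ?_, ?_, fun j hj => ?_, fun j hj => ?_, fun j hj => ?_, fun v => ?_⟩
  · rw [he _ (by omega), h.n]
  · rw [he _ (by omega), h.m]
  · rw [he _ (by omega), h.t]
  · rw [he _ (by omega), h.k]
  · rw [he _ (by omega), h.q]
  · rw [he _ (by omega), he _ (by omega)]; exact h.arcs j hj
  · rw [he _ (by omega), he _ (by omega)]; exact h.edges j hj
  · rw [he _ (by omega)]; exact h.labels j hj
  · rw [he _ (by have := v.2; omega)]; exact h.τ v

theorem not_isYes_of_neg {I : TreeInstance} (hq : I.q < 0) : ¬ I.inst.IsYes := by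
  rintro ⟨l, -, hc⟩
  have : I.inst.q = I.q := rfl
  omega

theorem not_isYes_of_card_eq_zero {I : TreeInstance} (hD : I.D.card = 0) (hn : I.n ≠ 0) :
    ¬ I.inst.IsYes := by
  rintro ⟨l, -, -⟩
  exact Finset.card_ne_zero_of_mem (l ⟨0, Nat.pos_of_ne_zero hn⟩).2 hD

theorem isYes_of_cost_eq_zero {I : TreeInstance} (hq : 0 ≤ I.q) (hD : I.n ≠ 0 → I.D.card ≠ 0)
    (h0 : ∀ l, I.inst.cost l = 0) : I.inst.IsYes := by
  have h1 : ∀ v : Fin I.n, Nonempty I.D := by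
    intro v
    rw [nonempty_subtype, ← Finset.Nonempty, ← Finset.card_ne_zero]
    exact hD (Nat.ne_of_gt (Nat.pos_of_ne_zero (by have := v.2; omega)))
  refine ⟨fun v => (I.τ v).getD (h1 v).some, fun v d hv => ?_, ?_⟩
  · have hv' : I.τ v = some d := hv
    simp [hv']
  · rw [h0]
    exact hq

theorem cost_eq_zero_of_length_eq_zero {I : TreeInstance} {es : List (Fin I.n × Fin I.n)}
    (hes : ListsEdges es I.G) (h0 : es.length = 0) (l : Fin I.n → I.D) : I.inst.cost l = 0 := by
  classical
  rw [hes.length_eq, Finset.card_eq_zero] at h0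
  rw [ZeroExtension.cost]
  refine Finset.sum_eq_zero fun e he => ?_
  have h1 : e ∈ I.G.edgeFinset := by
    rw [SimpleGraph.mem_edgeFinset] at he ⊢
    exact he
  rw [h0] at h1
  simp at h1

theorem cost_eq_zero_of_card_eq_one {I : TreeInstance} (h1 : I.D.card = 1) (l : Fin I.n → I.D) :
    I.inst.cost l = 0 := by
  refine Finset.sum_eq_zero fun e _ => ?_
  induction e using Sym2.ind with
  | _ u v =>
    have : l u = l v := Subtype.ext (Finset.card_le_one.1 h1.le _ (l u).2 _ (l v).2)
    change I.T.dist (l u) (l v) = 0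
    rw [this, SimpleGraph.dist_self]

end ZeroExt

namespace ZeroExt

open Imp

variable {I : TreeInstance} {es : List (Fin I.n × Fin I.n)} {ts : List (Fin I.t × Fin I.t)}
  {ds : List (Fin I.t)}

theorem card_eq_length (hds : ds.Nodup) (hD : ∀ x, x ∈ ds ↔ x ∈ I.D) : I.D.card = ds.length := by
  rw [← List.toFinset_card_of_nodup hds]
  congr 1
  ext x
  rw [List.mem_toFinset, hD]

theorem sizes_le {a n m t k : ℕ} (ha : 1 ≤ a) (hn : 1 ≤ n) (hm : 1 ≤ m) (ht : 1 ≤ t)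
    (hk : 1 ≤ k) : n ≤ a * t * k * n * m ∧ m ≤ a * t * k * n * m ∧ t ≤ a * t * k * n * m ∧
      k ≤ a * t * k * n * m := by
  refine ⟨?_, ?_, ?_, ?_⟩
  · calc n = 1 * 1 * 1 * n * 1 := by ring
      _ ≤ _ := by gcongr
  · calc m = 1 * 1 * 1 * 1 * m := by ring
      _ ≤ _ := by gcongr
  · calc t = 1 * t * 1 * 1 * 1 := by ring
      _ ≤ _ := by gcongr
  · calc k = 1 * 1 * k * 1 * 1 := by ring
      _ ≤ _ := by gcongr

open scoped Classical in
/-- The prelude either decides the instance or spreads the input out for the main program. -/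
theorem tri_prelude {s : Store Var Unit} (hI : InputOK I es ts ds (s.a ()))
    (h4 : s.a () 4 = if I.q < 0 then 1 else 0) (hes : ListsEdges es I.G) (hT : ListsEdges ts I.T)
    (hds : ds.Nodup) (hD : ∀ x, x ∈ ds ↔ x ∈ I.D) :
    Tri prelude s fun l s' =>
      (s'.v .go = 0 ∧ s'.v .ans = (if I.inst.IsYes then 1 else 0) ∧ l ≤ 20) ∨
      (s'.v .go = 1 ∧ 0 ≤ I.q ∧ 1 ≤ es.length ∧ 2 ≤ ds.length ∧
        InputOK I es ts ds (fun i => s'.a () (32 * i)) ∧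
        l ≤ 20 + (6 + 2 * es.length + 2 * ts.length + ds.length + I.n) * 8) := by
  have hcard := card_eq_length hds hD
  have hts : ts.length + 1 = I.t := by
    have := I.isTree.card_edgeFinset
    rwa [← hT.length_eq, Fintype.card_fin] at this
  refine tri_seq.2 (tri_assign.2 (tri_seq.2 (tri_assign.2 (tri_seq.2 (tri_assign.2 (tri_seq.2
    (tri_assign.2 (tri_seq.2 (tri_assign.2 (tri_ite.2 ⟨fun hq => ?_, fun hq => ?_⟩))))))))))
  · have hq' : I.q < 0 := by
      by_contra hcon
      simp [h4, hcon] at hq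
    simp [not_isYes_of_neg hq']
  have hq' : 0 ≤ I.q := by
    by_contra hcon
    simp [h4, not_le.1 hcon] at hq
  refine tri_ite.2 ⟨fun hk => ?_, fun hk => ?_⟩
  · have hk' : ds.length = 0 := by
      by_contra hcon
      exact hk ((AExp.eval_eq _ _ _).2 (by simpa [hI.k] using hcon))
    refine tri_ite.2 ⟨fun hn => ?_, fun hn => ?_⟩
    · have hn' : I.n ≠ 0 := by simpa [hI.n] using hn
      simp [not_isYes_of_card_eq_zero (hcard.trans hk') hn']
    · have hn' : I.n = 0 := by simpa [hI.n] using hn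
      have hm : es.length = 0 := by
        by_contra hm
        have := (es[0]'(Nat.pos_of_ne_zero hm)).1.2
        omega
      have : I.inst.IsYes := isYes_of_cost_eq_zero hq' (fun h => absurd hn' h)
        (cost_eq_zero_of_length_eq_zero hes hm)
      simp [this]
  have hk' : ds.length ≠ 0 := by simpa [hI.k] using hk
  refine tri_ite.2 ⟨fun hm => ?_, fun hm => ?_⟩
  · have hm' : es.length = 0 := by
      by_contra hcon
      exact hm ((AExp.eval_eq _ _ _).2 (by simpa [hI.m] using hcon))
    have : I.inst.IsYes := isYes_of_cost_eq_zero hq' (fun _ => by omega)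
      (cost_eq_zero_of_length_eq_zero hes hm')
    simp [this]
  have hm' : es.length ≠ 0 := by simpa [hI.m] using hm
  refine tri_ite.2 ⟨fun hk => ?_, fun hk => ?_⟩
  · have hk1 : ds.length = 1 := by
      by_contra hcon
      exact hk ((AExp.eval_eq _ _ _).2 (by simpa [hI.k] using hcon))
    have : I.inst.IsYes := isYes_of_cost_eq_zero hq' (fun _ => by omega)
      (cost_eq_zero_of_card_eq_one (hcard.trans hk1))
    simp [this]
  have hk1 : ds.length ≠ 1 := by simpa [hI.k] using hk
  refine tri_seq.2 (tri_assign.2 ((tri_spread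
    (L := 6 + 2 * es.length + 2 * ts.length + ds.length + I.n) ?_).mono ?_))
  · simp [hI.n, hI.m, hI.t, hI.k]
    omega
  · rintro l s' hf ⟨h1, hl⟩
    refine Or.inr ⟨(hf.1 .go rfl).trans (by simp), hq', by omega, by omega, hI.congr h1, by omega⟩

/-- The program of the random access machine. -/
def program : RAM.Prog :=
  .seq (prelude.compile rawLayout) ((Com.ite (.var .go) main .skip).compile layout)

end ZeroExt

open Classical in
theorem theorem3 :
    ∃ (P : RAM.Prog) (C : ℕ), ∀ (I : TreeInstance) (w : List ℕ), I.EncodedBy w →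
      ∃ (k : ℕ) (s : RAM.State), RAM.Exec P (RAM.init w) k s ∧
        s.reg 0 = (if I.inst.IsYes then 1 else 0) ∧
        k ≤ C * (I.D.card ^ (I.q - (I.relaxed.opt : ℤ)).toNat * I.t * I.D.card * I.n * I.m + 1) := by
  open ZeroExt Imp in
  refine ⟨program, 200 * prelude.factor 0 + 60002 * (Com.ite (.var .go) main .skip).factor 5, ?_⟩
  rintro I w ⟨es, ts, ds, hes, hT, hds, hD, hw⟩
  have hm : I.m = es.length := by
    rw [hes.length_eq, TreeInstance.m, ← SimpleGraph.coe_edgeFinset, Set.ncard_coe_finset]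
  rw [card_eq_length hds hD, hm]
  have hI : InputOK I es ts ds fun i => w.getD i 0 := hw ▸ inputOK_words I es ts ds
  set s₀ := RAM.init w
  have ha₀ : (rawLayout.view s₀).a () = fun i => w.getD i 0 := by
    funext i
    simp [Layout.view, rawLayout, s₀, RAM.init]
  rw [← ha₀] at hI
  have h4 : (rawLayout.view s₀).a () 4 = if I.q < 0 then 1 else 0 := by
    rw [ha₀, hw]
    rfl
  obtain ⟨l₁, u₁, hr₁, hQ⟩ := tri_prelude hI h4 hes hT hds hD
  obtain ⟨s₁, k₁, he₁, hk₁, hv₁⟩ := prelude.exec_compile rawLayout hr₁ s₀ rfl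
  have hgo : (layout.view s₁).v .go = u₁.v .go := by rw [← hv₁]; rfl
  have hinp : (layout.view s₁).a .inp = fun i => u₁.a () (32 * i) := by
    rw [← hv₁]
    funext i
    simp [Layout.view, rawLayout, layout]
    rfl
  set X := ds.length ^ (I.q - (I.relaxed.opt : ℤ)).toNat * I.t * ds.length * I.n * es.length
  set F := prelude.factor 0
  set F' := (Com.ite (.var Var.go) main .skip).factor 5
  rcases hQ with ⟨hgo0, hans, hl₁⟩ | ⟨hgo1, hq, hm1, hk2, hI', hl₁⟩
  · obtain ⟨s₂, k₂, he₂, hk₂, hv₂⟩ := (Com.ite (.var Var.go) main .skip).exec_compile layout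
      (Run.ite_neg (by rw [AExp.eval_var, hgo, hgo0]) (Run.skip _)) s₁ rfl
    refine ⟨_, s₂, he₁.seq he₂, ?_, ?_⟩
    · have h1 : s₂.reg 0 = (layout.view s₁).v .ans := by rw [← hv₂]; rfl
      have h2 : (layout.view s₁).v .ans = u₁.v .ans := by rw [← hv₁]; rfl
      rw [h1, h2, hans]
    · have h1 : k₁ ≤ F * 20 := hk₁.trans (Nat.mul_le_mul_left _ hl₁)
      have h2 : k₂ ≤ F' * 2 := hk₂
      calc k₁ + k₂ ≤ F * 20 + F' * 2 := Nat.add_le_add h1 h2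
        _ ≤ (200 * F + 60002 * F') * 1 := by omega
        _ ≤ _ := Nat.mul_le_mul_left _ (by omega)
  · rw [← hinp] at hI'
    obtain ⟨l₂, u₂, hr₂, hans, hl₂⟩ := tri_main hI' hes hT hds hD hm1 hk2 hq
    obtain ⟨s₂, k₂, he₂, hk₂, hv₂⟩ := (Com.ite (.var Var.go) main .skip).exec_compile layout
      (Run.ite_pos (by rw [AExp.eval_var, hgo, hgo1]; omega) hr₂) s₁ rfl
    refine ⟨_, s₂, he₁.seq he₂, ?_, ?_⟩
    · have h1 : s₂.reg 0 = u₂.v .ans := by rw [← hv₂]; rfl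
      rw [h1, hans]
    · have hlin : 20 + (6 + 2 * es.length + 2 * ts.length + ds.length + I.n) * 8 ≤ 124 * X := by
        have hn := (es[0]).1.2
        have ht := I.isTree.connected.nonempty.some.2
        have hts := I.isTree.card_edgeFinset
        rw [← hT.length_eq, Fintype.card_fin] at hts
        obtain ⟨f1, f2, f3, f4⟩ := sizes_le (a := ds.length ^ (I.q - (I.relaxed.opt : ℤ)).toNat)
          (n := I.n) (m := es.length) (t := I.t) (k := ds.length) (Nat.one_le_pow _ _ (by omega))
          (by omega) hm1 (by omega) (by omega)
        omega
      have h1 : k₁ ≤ F * (124 * X) := hk₁.trans (Nat.mul_le_mul_left _ (hl₁.trans hlin))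
      have h2 : k₂ ≤ F' * (60000 * X + 1) := hk₂.trans (Nat.mul_le_mul_left _ (by omega))
      calc k₁ + k₂ ≤ F * (124 * X) + F' * (60000 * X + 1) := Nat.add_le_add h1 h2
        _ ≤ F * (200 * (X + 1)) + F' * (60002 * (X + 1)) :=
          Nat.add_le_add (Nat.mul_le_mul_left _ (by omega)) (Nat.mul_le_mul_left _ (by omega))
        _ = _ := by ring
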